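/- **Theorem (Constrained, Stochastic HP Principle).** Let $a<b$, let $(\Omega,\mathcal F,\mathbb P)$ be a probability space with a filtration $(\mathcal F_t)$, and let $W_1,\dots,W_m$ be independent Wiener processes on $[a,b]$ relative to $(\mathcal F_t)$. Let $Q$ be a paracompact (Hausdorff) smooth $n$-manifold, let $\mathcal L:TQ\to\mathbb R$ be of class $C^2$ with $\partial^2\mathcal L/\partial v^2$ invertible at every point of $TQ$, let $\gamma_1,\dots,\gamma_m:Q\to\mathbb R$ be of class $C^2$, and let $g:Q\to\mathbb R^k$, $k<n$, be smooth with $0$ as a regular value. Let $S=g^{-1}(0)$ with its structure of an embedded submanifold of dimension $n-k$, $i:S\to Q$ the inclusion, $\mathcal L^S=\mathcal L|_{TS}=\mathcal L\circ Ti$, $\gamma_j^S=\gamma_j|_S=\gamma_j\circ i$, and fix $q_1,q_2\in S$. For a smooth manifold $M$ and $x_1,x_2\in M$ let $\mathcal C_M(x_1,x_2)$ be the space of continuous curves $z=(q,v,p):[a,b]\to TM\oplus T^*M$ with $q$ of class $C^1$, $q(a)=x_1$, $q(b)=x_2$. For $\omega\in\Omega$ and $z\in\mathcal C_Q(q_1,q_2)$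 let $$\mathfrak G(\omega,z)=\int_a^b \mathcal L(q,v)\,dt+\sum_{j=1}^m\int_a^b\gamma_j(q)\circ dW_j(\omega)+\int_a^b\Big\langle p,\frac{dq}{dt}-v\Big\rangle dt ,$$ let $\mathfrak G^S$ be the same functional on $\mathcal C_S(q_1,q_2)$ built from $\mathcal L^S,\gamma_j^S$, and for $\lambda\in C^0([a,b],\mathbb R^k)$ let $$\bar{\mathfrak G}(\omega,z,\lambda)=\mathfrak G(\omega,z)+\int_a^b\Big\langle\lambda(t),\frac{d}{dt}g(q(t))\Big\rangle dt .$$ Since $q$ is $C^1$, the Stratonovich integral is defined path by path, as the limit of the trapezoidal sums $\sum\tfrac12\big(\gamma_j(q(t_l))+\gamma_j(q(t_{l+1}))\big)\big(W_j(t_{l+1})-W_j(t_l)\big)$ as the mesh tends to $0$. A critical point is a point at which the derivative of the functional (for fixed $\omega$) vanishes along every $C^1$ one-parameter family of curves in $\mathcal C_M(x_1,x_2)$ (the topology being $C^0$ for $(q,v,p)$ and for $dq/dt$), together with a $C^1$ family of multipliers in $C^0([a,b],\mathbb R^k)$ in the case of $\bar{\mathfrak G}$. For continuous $\lambda$ and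 $f$ of class $C^1$ put $\int_s^t\langle d\lambda,f\rangle:=\langle\lambda,f\rangle|_s^t-\int_s^t\langle\lambda,df/d\tau\rangle d\tau$. Say that $z=(q,v,p)\in\mathcal C_Q(q_1,q_2)$ lies over $y=(q',v',\pi)\in\mathcal C_S(q_1,q_2)$ if $q=i\circ q'$, $v=Ti\,v'$ and $\pi=(Ti)^*p=p|_{TS}$. Then, for almost every $\omega$, the following holds. (A) For every $y\in\mathcal C_S(q_1,q_2)$ these are equivalent: (i) (stochastic HP principle on $TS\oplus T^*S$ for $\mathcal L^S,\gamma_j^S$) $y$ is a critical point of $\mathfrak G^S(\omega,\cdot)$. (ii) There are $z=(q,v,p)\in\mathcal C_Q(q_1,q_2)$ lying over $y$ and $\lambda\in C^0([a,b],\mathbb R^k)$ such that $(z,\lambda)$ is a critical point of $\bar{\mathfrak G}(\omega,\cdot,\cdot)$ on $\mathcal C_Q(q_1,q_2)\times C^0([a,b],\mathbb R^k)$. (iii) There are $z=(q,v,p)\in\mathcal C_Q(q_1,q_2)$ lying over $y$ and $\lambda\in C^0([a,b],\mathbb R^k)$ that satisfy the constrained, stochastic HP equations $$dq=v\,dt,\qquad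 dp=\frac{\partial\mathcal L}{\partial q}(q,v)\,dt+\sum_{j=1}^m\frac{\partial\gamma_j}{\partial q}(q)\circ dW_j+\frac{\partial g}{\partial q}(q)^*\cdot d\lambda,\qquad p=\frac{\partial\mathcal L}{\partial v}(q,v),\qquad g(q)=0,$$ the second equation being understood in integrated form in every chart of $Q$, on every time interval during which $q$ stays in the domain of the chart. (B) For every $z\in\mathcal C_Q(q_1,q_2)$, there is a $\lambda\in C^0([a,b],\mathbb R^k)$ with $(z,\lambda)$ a critical point of $\bar{\mathfrak G}(\omega,\cdot,\cdot)$ if and only if there is a $\lambda\in C^0([a,b],\mathbb R^k)$ with which $z$ satisfies the constrained, stochastic HP equations; and in that case $z$ lies over some $y\in\mathcal C_S(q_1,q_2)$. -/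

import Mathlib

open Set Filter Topology MeasureTheory ProbabilityTheory Manifold Bundle

namespace StochasticHP

noncomputable section

/-! ### Wiener processes and Stratonovich integrals -/

/-- `W i`, `i : Fin m`, are independent Wiener processes on `[a, b]` relative to the filtration `ℱ`
(their values at the initial time `a` are not prescribed). -/
structure IsWienerFamily {Ω : Type*} {mΩ : MeasurableSpace Ω} (P : Measure Ω)
    (ℱ : Filtration ℝ mΩ) (a b : ℝ) {m : ℕ} (W : Fin m → ℝ → Ω → ℝ) : Prop where
  adapted : ∀ i, ∀ t ∈ Icc a b, Measurable[ℱ t] (W i t)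
  gaussian_increments : ∀ i, ∀ s ∈ Icc a b, ∀ t ∈ Icc a b, s ≤ t →
    HasLaw (fun ω => W i t ω - W i s ω) (gaussianReal 0 (t - s).toNNReal) P
  indep_increments : ∀ i, ∀ s ∈ Icc a b, ∀ t ∈ Icc a b, s ≤ t →
    Indep (MeasurableSpace.comap (fun ω => W i t ω - W i s ω) inferInstance) (ℱ s) P
  continuous_paths : ∀ᵐ ω ∂P, ∀ i, ContinuousOn (fun t => W i t ω) (Icc a b)
  independent : iIndepFun (fun (i : Fin m) (ω : Ω) (t : Icc a b) => W i t ω) P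

/-- `s = τ 0 ≤ ⋯ ≤ τ N = t` is a partition of `[s, t]` with all steps smaller than `δ`. -/
structure IsPartition (s t δ : ℝ) (N : ℕ) (τ : ℕ → ℝ) : Prop where
  mono : Monotone τ
  left : τ 0 = s
  right : τ N = t
  mesh : ∀ j < N, τ (j + 1) - τ j < δ

/-- The Stratonovich (trapezoidal) sum of the integrand `x` against the integrator `w`. -/
def stratonovichSum (x w : ℝ → ℝ) (N : ℕ) (τ : ℕ → ℝ) : ℝ :=
  ∑ j ∈ Finset.range N, (x (τ j) + x (τ (j + 1))) / 2 * (w (τ (j + 1)) - w (τ j))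

/-- `J` is the limit of the Stratonovich sums of `x` against `w` over partitions of `[s, t]`, as the
mesh tends to zero. -/
def IsStratonovichIntegral (x w : ℝ → ℝ) (s t J : ℝ) : Prop :=
  ∀ ε > 0, ∃ δ > 0, ∀ N τ, IsPartition s t δ N τ → |stratonovichSum x w N τ - J| < ε

theorem IsPartition.mem_Icc {s t δ : ℝ} {N : ℕ} {τ : ℕ → ℝ} (h : IsPartition s t δ N τ) {j : ℕ}
    (hj : j ≤ N) : τ j ∈ Icc s t :=
  ⟨h.left ▸ h.mono (Nat.zero_le j), h.right ▸ h.mono hj⟩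

theorem exists_isPartition {s t δ : ℝ} (hst : s ≤ t) (hδ : 0 < δ) :
    ∃ N τ, IsPartition s t δ N τ := by
  obtain ⟨N, hN⟩ := exists_nat_gt ((t - s) / δ)
  have hN0 : (0 : ℝ) < N := lt_of_le_of_lt (div_nonneg (by linarith) hδ.le) hN
  refine ⟨N, fun j => s + j * ((t - s) / N), ?_, by simp, by field_simp; ring, fun j _ => ?_⟩
  · intro i j hij
    have h1 : (i : ℝ) ≤ j := by exact_mod_cast hij
    have h2 : 0 ≤ (t - s) / N := div_nonneg (by linarith) hN0.le
    simpa using mul_le_mul_of_nonneg_right h1 h2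
  · have : (t - s) / N < δ := by
      rw [div_lt_iff₀ hδ] at hN
      rw [div_lt_iff₀ hN0]
      linarith
    push_cast
    linarith

theorem IsStratonovichIntegral.unique {x w : ℝ → ℝ} {s t J J' : ℝ} (hst : s ≤ t)
    (h : IsStratonovichIntegral x w s t J) (h' : IsStratonovichIntegral x w s t J') : J = J' := by
  refine eq_of_forall_dist_le fun ε hε => ?_
  obtain ⟨δ, hδ, H⟩ := h (ε / 2) (half_pos hε)
  obtain ⟨δ', hδ', H'⟩ := h' (ε / 2) (half_pos hε)
  obtain ⟨N, τ, hτ⟩ := exists_isPartition hst (lt_min hδ hδ')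
  have h1 := H N τ ⟨hτ.mono, hτ.left, hτ.right, fun j hj => (hτ.mesh j hj).trans_le (min_le_left _ _)⟩
  have h2 := H' N τ
    ⟨hτ.mono, hτ.left, hτ.right, fun j hj => (hτ.mesh j hj).trans_le (min_le_right _ _)⟩
  rw [abs_lt] at h1 h2
  rw [Real.dist_eq, abs_le]
  constructor <;> linarith [h1.1, h1.2, h2.1, h2.2]

theorem isStratonovichIntegral_of_contDiffOn {x w : ℝ → ℝ} {s t : ℝ} (hst : s ≤ t)
    (hx : ContDiffOn ℝ 1 x (Icc s t)) (hw : ContinuousOn w (Icc s t)) :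
    IsStratonovichIntegral x w s t
      (x t * w t - x s * w s - ∫ τ in s..t, w τ * derivWithin x (Icc s t) τ) := by
  have parts : ∀ (τ : ℕ → ℝ) (N : ℕ), stratonovichSum x w N τ =
      x (τ N) * w (τ N) - x (τ 0) * w (τ 0)
        - ∑ j ∈ Finset.range N, (w (τ j) + w (τ (j + 1))) / 2 * (x (τ (j + 1)) - x (τ j)) := by
    intro τ N
    induction N with
    | zero => simp [stratonovichSum]
    | succ N ih =>
      rw [stratonovichSum, Finset.sum_range_succ, Finset.sum_range_succ,
        ← stratonovichSum, ih]
      ring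
  intro ε hε
  rcases hst.eq_or_lt with rfl | hlt
  · refine ⟨1, one_pos, fun N τ hτ => ?_⟩
    have hc : ∀ j ≤ N, τ j = s := fun j hj => by simpa using hτ.mem_Icc hj
    have : stratonovichSum x w N τ = 0 := by
      refine Finset.sum_eq_zero fun j hj => ?_
      rw [hc j (Finset.mem_range.1 hj).le, hc (j + 1) (Finset.mem_range.1 hj)]
      simp
    simpa [this] using hε
  set x' := derivWithin x (Icc s t) with hx'
  have hcont : ContinuousOn x' (Icc s t) :=
    hx.continuousOn_derivWithin (uniqueDiffOn_Icc hlt) le_rfl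
  obtain ⟨C, hC⟩ := isCompact_Icc.exists_bound_of_continuousOn hcont
  have hC0 : 0 ≤ C := (norm_nonneg _).trans (hC s (left_mem_Icc.2 hst))
  have hden : 0 < C * (t - s) + 1 := by have := sub_pos.2 hlt; positivity
  set η := ε / (C * (t - s) + 1) with hη
  have hη0 : 0 < η := div_pos hε hden
  obtain ⟨δ, hδ, H⟩ := Metric.uniformContinuousOn_iff.1
    (isCompact_Icc.uniformContinuousOn_of_continuous hw) η hη0
  refine ⟨δ, hδ, fun N τ hτ => ?_⟩
  have hsub : ∀ j < N, uIcc (τ j) (τ (j + 1)) ⊆ Icc s t := fun j hj => by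
    rw [uIcc_of_le (hτ.mono j.le_succ)]
    exact Icc_subset_Icc (hτ.mem_Icc hj.le).1 (hτ.mem_Icc hj).2
  have hint : ∀ j < N, IntervalIntegrable x' volume (τ j) (τ (j + 1)) := fun j hj =>
    (hcont.mono (hsub j hj)).intervalIntegrable
  have hint2 : ∀ j < N, IntervalIntegrable (fun r => w r * x' r) volume (τ j) (τ (j + 1)) :=
    fun j hj => ((hw.mul hcont).mono (hsub j hj)).intervalIntegrable
  have ftc : ∀ j < N, x (τ (j + 1)) - x (τ j) = ∫ r in τ j..τ (j + 1), x' r := fun j hj => by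
    symm
    refine intervalIntegral.integral_eq_sub_of_hasDerivAt_of_le (hτ.mono j.le_succ)
      (hx.continuousOn.mono ((uIcc_of_le (hτ.mono j.le_succ)) ▸ hsub j hj)) (fun r hr => ?_)
      (hint j hj)
    have hr' : r ∈ Ioo s t :=
      ⟨(hτ.mem_Icc hj.le).1.trans_lt hr.1, hr.2.trans_le (hτ.mem_Icc hj).2⟩
    exact ((hx.differentiableOn one_ne_zero r (Ioo_subset_Icc_self hr')).hasDerivWithinAt).hasDerivAt
      (Icc_mem_nhds hr'.1 hr'.2)
  have hsum : ∫ r in s..t, w r * x' r =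
      ∑ j ∈ Finset.range N, ∫ r in τ j..τ (j + 1), w r * x' r := by
    rw [intervalIntegral.sum_integral_adjacent_intervals hint2, hτ.left, hτ.right]
  have key : stratonovichSum x w N τ - (x t * w t - x s * w s - ∫ r in s..t, w r * x' r) =
      ∑ j ∈ Finset.range N,
        ∫ r in τ j..τ (j + 1), (w r - (w (τ j) + w (τ (j + 1))) / 2) * x' r := by
    rw [parts, hτ.left, hτ.right, hsum]
    have : ∀ j ∈ Finset.range N,
        ∫ r in τ j..τ (j + 1), (w r - (w (τ j) + w (τ (j + 1))) / 2) * x' r =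
        (∫ r in τ j..τ (j + 1), w r * x' r)
          - (w (τ j) + w (τ (j + 1))) / 2 * (x (τ (j + 1)) - x (τ j)) := fun j hj => by
      have hj := Finset.mem_range.1 hj
      simp_rw [sub_mul]
      rw [intervalIntegral.integral_sub (hint2 j hj) ((hint j hj).const_mul _),
        intervalIntegral.integral_const_mul, ftc j hj]
    rw [Finset.sum_congr rfl this, Finset.sum_sub_distrib]
    ring
  rw [key]
  have bound : ∀ j ∈ Finset.range N,
      |∫ r in τ j..τ (j + 1), (w r - (w (τ j) + w (τ (j + 1))) / 2) * x' r| ≤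
        η * C * (τ (j + 1) - τ j) := fun j hj => by
    have hj := Finset.mem_range.1 hj
    rw [← abs_of_nonneg (sub_nonneg.2 (hτ.mono j.le_succ)), ← Real.norm_eq_abs]
    refine intervalIntegral.norm_integral_le_of_norm_le_const fun r hr => ?_
    have hr1 : r ∈ Icc (τ j) (τ (j + 1)) := by
      rw [← uIcc_of_le (hτ.mono j.le_succ)]; exact uIoc_subset_uIcc hr
    have hr2 : r ∈ Icc s t := by
      rw [← uIcc_of_le (hτ.mono j.le_succ)] at hr1; exact hsub j hj hr1
    have hm := hτ.mesh j hj
    have d1 := H r hr2 (τ j) (hτ.mem_Icc hj.le) (by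
      rw [Real.dist_eq, abs_of_nonneg (sub_nonneg.2 hr1.1)]; linarith [hr1.2])
    have d2 := H r hr2 (τ (j + 1)) (hτ.mem_Icc hj) (by
      rw [Real.dist_eq, abs_sub_comm, abs_of_nonneg (sub_nonneg.2 hr1.2)]; linarith [hr1.1])
    rw [Real.dist_eq, abs_lt] at d1 d2
    have d3 : |w r - (w (τ j) + w (τ (j + 1))) / 2| ≤ η := by
      rw [abs_le]; constructor <;> linarith [d1.1, d1.2, d2.1, d2.2]
    rw [norm_mul, Real.norm_eq_abs]
    exact mul_le_mul d3 (hC r hr2) (norm_nonneg _) hη0.le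
  calc _ ≤ ∑ j ∈ Finset.range N, η * C * (τ (j + 1) - τ j) :=
        (Finset.abs_sum_le_sum_abs _ _).trans (Finset.sum_le_sum bound)
    _ = η * (C * (t - s)) := by
        rw [← Finset.mul_sum, Finset.sum_range_sub, hτ.left, hτ.right]; ring
    _ < η * (C * (t - s) + 1) := by gcongr; linarith
    _ = ε := by rw [hη]; field_simp

open Classical in
/-- The Stratonovich integral `∫ₛᵗ x ∘ dw` along one sample path. It is only used for integrands
`x` of class `C¹` and continuous `w`: by `isStratonovichIntegral_of_contDiffOn` the limit then
exists, and by `tendstoInMeasure_stratonovichSum` it is, as a random variable, the limit in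
probability of the Stratonovich sums, that is, the usual Stratonovich integral. -/
def stratonovichIntegral (x w : ℝ → ℝ) (s t : ℝ) : ℝ :=
  if h : ∃ J, IsStratonovichIntegral x w s t J then h.choose else 0

theorem isStratonovichIntegral_stratonovichIntegral {x w : ℝ → ℝ} {s t : ℝ} (hst : s ≤ t)
    (hx : ContDiffOn ℝ 1 x (Icc s t)) (hw : ContinuousOn w (Icc s t)) :
    IsStratonovichIntegral x w s t (stratonovichIntegral x w s t) := by
  have h : ∃ J, IsStratonovichIntegral x w s t J :=
    ⟨_, isStratonovichIntegral_of_contDiffOn hst hx hw⟩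
  rw [stratonovichIntegral, dif_pos h]
  exact h.choose_spec

theorem tendstoInMeasure_stratonovichSum {Ω : Type*} {mΩ : MeasurableSpace Ω} {P : Measure Ω}
    [IsFiniteMeasure P] {s t : ℝ} (hst : s ≤ t) {X W : ℝ → Ω → ℝ}
    (hX : ∀ r ∈ Icc s t, Measurable (X r)) (hW : ∀ r ∈ Icc s t, Measurable (W r))
    (hX1 : ∀ᵐ ω ∂P, ContDiffOn ℝ 1 (fun r => X r ω) (Icc s t))
    (hW0 : ∀ᵐ ω ∂P, ContinuousOn (fun r => W r ω) (Icc s t))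
    {δ : ℕ → ℝ} (hδ : Tendsto δ atTop (𝓝 0)) {N : ℕ → ℕ} {τ : ℕ → ℕ → ℝ}
    (hτ : ∀ i, IsPartition s t (δ i) (N i) (τ i)) :
    TendstoInMeasure P
      (fun i ω => stratonovichSum (fun r => X r ω) (fun r => W r ω) (N i) (τ i)) atTop
      (fun ω => stratonovichIntegral (fun r => X r ω) (fun r => W r ω) s t) := by
  refine tendstoInMeasure_of_tendsto_ae (fun i => Measurable.aestronglyMeasurable ?_) ?_
  · refine Finset.measurable_fun_sum _ fun j hj => ?_
    have h1 := (hτ i).mem_Icc (Finset.mem_range.1 hj).le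
    have h2 := (hτ i).mem_Icc (Finset.mem_range.1 hj)
    exact (((hX _ h1).add (hX _ h2)).div_const 2).mul ((hW _ h2).sub (hW _ h1))
  · filter_upwards [hX1, hW0] with ω h1 h2
    rw [Metric.tendsto_atTop']
    intro ε hε
    obtain ⟨d, hd, H⟩ := isStratonovichIntegral_stratonovichIntegral hst h1 h2 ε hε
    obtain ⟨i₀, hi₀⟩ := eventually_atTop.1 (hδ.eventually (gt_mem_nhds hd))
    refine ⟨i₀, fun i hi => H _ _ ⟨(hτ i).mono, (hτ i).left, (hτ i).right, fun j hj => ?_⟩⟩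
    exact ((hτ i).mesh j hj).trans (hi₀ i hi.le)

/-- `∫ₛᵗ ⟨dμ, f⟩` for continuous `μ` and `f` of class `C¹`, defined by
`⟨μ, f⟩|ₛᵗ - ∫ₛᵗ ⟨μ, df/dτ⟩ dτ`. -/
def integralD {F : Type*} [NormedAddCommGroup F] [InnerProductSpace ℝ F]
    (μ f : ℝ → F) (s t : ℝ) : ℝ :=
  inner ℝ (μ t) (f t) - inner ℝ (μ s) (f s)
    - ∫ τ in s..t, inner ℝ (μ τ) (derivWithin f (Icc s t) τ)

/-! ### The Pontryagin bundle and path space -/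

section Geometry

open scoped ContDiff

variable {E : Type*} [NormedAddCommGroup E] [NormedSpace ℝ E]
  {M : Type*} [TopologicalSpace M] [ChartedSpace E M] [IsManifold 𝓘(ℝ, E) ∞ M]

variable (E M) in
/-- The Pontryagin bundle `TM ⊕ T*M`: a point is `⟨x, (v, p)⟩` with `v ∈ TₓM` and `p ∈ Tₓ*M`. -/
abbrev PontryaginBundle : Type _ :=
  TotalSpace (E × (E →L[ℝ] ℝ))
    ((fun x : M => TangentSpace 𝓘(ℝ, E) x) ×ᵇ
      (fun x : M => TangentSpace 𝓘(ℝ, E) x →L[ℝ] Bundle.Trivial M ℝ x))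

/-- The velocity `dq/dt` at time `t` of a curve `q : [a, b] → M` (one-sided at `a` and `b`). -/
def velocity (a b : ℝ) (q : ℝ → M) (t : ℝ) : TangentSpace 𝓘(ℝ, E) (q t) :=
  mfderivWithin 𝓘(ℝ, ℝ) 𝓘(ℝ, E) q (Icc a b) t (1 : ℝ)

/-- The path space `𝒞([a, b], q₁, q₂)`: continuous curves `z = (q, v, p)` in the Pontryagin bundle
with `q` of class `C¹`, `q a = q₁` and `q b = q₂`. Curves on `[a, b]` are functions on `ℝ` of which
only the values on `[a, b]` matter. -/
structure IsPath (a b : ℝ) (q₁ q₂ : M) (z : ℝ → PontryaginBundle E M) : Prop where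
  continuousOn : ContinuousOn z (Icc a b)
  contMDiffOn : ContMDiffOn 𝓘(ℝ, ℝ) 𝓘(ℝ, E) 1 (fun t => (z t).proj) (Icc a b)
  left : (z a).proj = q₁
  right : (z b).proj = q₂

/-- The stochastic HP action along the sample path `w` of the noise:
`𝔊(z) = ∫ L(q, v) dt + ∑ᵢ ∫ γᵢ(q) ∘ dwᵢ + ∫ ⟨p, dq/dt - v⟩ dt`. -/
def action {m : ℕ} (L : TangentBundle 𝓘(ℝ, E) M → ℝ) (γ : Fin m → M → ℝ) (w : Fin m → ℝ → ℝ)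
    (a b : ℝ) (z : ℝ → PontryaginBundle E M) : ℝ :=
  (∫ t in a..b, L ⟨(z t).proj, (z t).2.1⟩)
    + ∑ i, stratonovichIntegral (fun t => γ i (z t).proj) (w i) a b
    + ∫ t in a..b, (z t).2.2 (velocity a b (fun r => (z r).proj) t - (z t).2.1)

/-- The augmented action `𝔊(z) + ∫ ⟨ℓ, d/dt g(q)⟩ dt`. -/
def augmentedAction {m k : ℕ} (L : TangentBundle 𝓘(ℝ, E) M → ℝ) (γ : Fin m → M → ℝ)
    (g : M → EuclideanSpace ℝ (Fin k)) (w : Fin m → ℝ → ℝ) (a b : ℝ)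
    (z : ℝ → PontryaginBundle E M) (ℓ : ℝ → EuclideanSpace ℝ (Fin k)) : ℝ :=
  action L γ w a b z
    + ∫ t in a..b, inner ℝ (ℓ t) (derivWithin (fun r => g (z r).proj) (Icc a b) t)

end Geometry

/-! ### Variations and critical points -/

section Variations

open scoped ContDiff

/-- `ε ↦ f ε` is a `C¹` curve in `C⁰([a, b], M)`, for `ε ∈ (-δ, δ)`: the partial derivative of
`(ε, t) ↦ f ε t` in `ε` exists and is continuous, as a map into `TM`, in `(ε, t)` jointly. -/
structure IsC1Family {E H : Type*} [NormedAddCommGroup E] [NormedSpace ℝ E] [TopologicalSpace H]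
    (I : ModelWithCorners ℝ E H) {M : Type*} [TopologicalSpace M] [ChartedSpace H M]
    [IsManifold I 1 M] (δ a b : ℝ) (f : ℝ → ℝ → M) : Prop where
  mdifferentiableAt : ∀ ε ∈ Ioo (-δ) δ, ∀ t ∈ Icc a b, MDifferentiableAt 𝓘(ℝ, ℝ) I (f · t) ε
  continuousOn_partial : ContinuousOn
    (fun x : ℝ × ℝ =>
      (⟨f x.1 x.2, mfderiv 𝓘(ℝ, ℝ) I (f · x.2) x.1 (1 : ℝ)⟩ : TangentBundle I M))
    (Ioo (-δ) δ ×ˢ Icc a b)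

variable {E : Type*} [NormedAddCommGroup E] [NormedSpace ℝ E]
  {M : Type*} [TopologicalSpace M] [ChartedSpace E M] [IsManifold 𝓘(ℝ, E) ∞ M]

/-- `Z` is a variation of `z` in path space: a one-parameter family `Z ε`, `ε ∈ (-δ, δ)`, of
paths with the same end points and with `Z 0 = z`, that is continuously differentiable in `ε` for
the topology of path space (`C⁰` for `(q, v, p)` and for `dq/dt`). -/
structure IsVariation (a b : ℝ) (q₁ q₂ : M) (z : ℝ → PontryaginBundle E M) (δ : ℝ)
    (Z : ℝ → ℝ → PontryaginBundle E M) : Prop where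
  pos : 0 < δ
  base : ∀ t ∈ Icc a b, Z 0 t = z t
  isPath : ∀ ε ∈ Ioo (-δ) δ, IsPath a b q₁ q₂ (Z ε)
  isC1Family : IsC1Family (𝓘(ℝ, E).prod 𝓘(ℝ, E × (E →L[ℝ] ℝ))) δ a b Z
  isC1Family_velocity : IsC1Family 𝓘(ℝ, E).tangent δ a b
    (fun ε t => (⟨(Z ε t).proj, velocity a b (fun r => (Z ε r).proj) t⟩ :
      TangentBundle 𝓘(ℝ, E) M))

/-- `z` is a critical point of the stochastic HP action on `𝒞([a, b], q₁, q₂)`: the derivative of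
the action along every variation of `z` vanishes. -/
def IsCriticalPath {m : ℕ} (L : TangentBundle 𝓘(ℝ, E) M → ℝ) (γ : Fin m → M → ℝ)
    (w : Fin m → ℝ → ℝ) (a b : ℝ) (q₁ q₂ : M) (z : ℝ → PontryaginBundle E M) : Prop :=
  IsPath a b q₁ q₂ z ∧
    ∀ δ Z, IsVariation a b q₁ q₂ z δ Z → HasDerivAt (fun ε => action L γ w a b (Z ε)) 0 0

/-- `(z, ℓ)` is a critical point of the augmented action on
`𝒞([a, b], q₁, q₂) × C⁰([a, b], ℝᵏ)`. -/
def IsAugmentedCritical {m k : ℕ} (L : TangentBundle 𝓘(ℝ, E) M → ℝ) (γ : Fin m → M → ℝ)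
    (g : M → EuclideanSpace ℝ (Fin k)) (w : Fin m → ℝ → ℝ) (a b : ℝ) (q₁ q₂ : M)
    (z : ℝ → PontryaginBundle E M) (ℓ : ℝ → EuclideanSpace ℝ (Fin k)) : Prop :=
  IsPath a b q₁ q₂ z ∧ ContinuousOn ℓ (Icc a b) ∧
    ∀ δ Z Λ, IsVariation a b q₁ q₂ z δ Z →
      IsC1Family 𝓘(ℝ, EuclideanSpace ℝ (Fin k)) δ a b Λ → (∀ t ∈ Icc a b, Λ 0 t = ℓ t) →
      HasDerivAt (fun ε => augmentedAction L γ g w a b (Z ε) (Λ ε)) 0 0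

end Variations

/-! ### The constrained, stochastic HP equations -/

section Equations

open scoped ContDiff

variable {E : Type*} [NormedAddCommGroup E] [NormedSpace ℝ E]
  {M : Type*} [TopologicalSpace M] [ChartedSpace E M] [IsManifold 𝓘(ℝ, E) ∞ M]

/-- The fiber derivative `∂L/∂v (x, v) ∈ Tₓ*M`. -/
def fiberDeriv (L : TangentBundle 𝓘(ℝ, E) M → ℝ) (x : M) (v : TangentSpace 𝓘(ℝ, E) x) :
    TangentSpace 𝓘(ℝ, E) x →L[ℝ] ℝ :=
  fderiv ℝ (fun u : E => L ⟨x, u⟩) v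

/-- The fiber Hessian `∂²L/∂v² (x, v) : TₓM → Tₓ*M` is invertible at every point `(x, v)`. -/
def HasInvertibleFiberHessian (L : TangentBundle 𝓘(ℝ, E) M → ℝ) : Prop :=
  ∀ (x : M) (v : E), Function.Bijective
    (fderiv ℝ (fun u : E => fderiv ℝ (fun u' : E => L ⟨x, u'⟩) u) v : E →L[ℝ] E →L[ℝ] ℝ)

/-- The position `q` in the chart `e`. -/
def localPos (e : OpenPartialHomeomorph M E) (z : ℝ → PontryaginBundle E M) (t : ℝ) : E :=
  e (z t).proj

/-- The velocity component `v` in the coordinates induced by the chart `e`. -/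
def localVel (e : OpenPartialHomeomorph M E) (z : ℝ → PontryaginBundle E M) (t : ℝ) : E :=
  mfderiv 𝓘(ℝ, E) 𝓘(ℝ, E) e (z t).proj (z t).2.1

/-- The momentum component `p` in the coordinates induced by the chart `e`. -/
def localMom (e : OpenPartialHomeomorph M E) (z : ℝ → PontryaginBundle E M) (t : ℝ) : E →L[ℝ] ℝ :=
  (z t).2.2.comp (mfderiv 𝓘(ℝ, E) 𝓘(ℝ, E) e (z t).proj).inverse

/-- The Lagrangian in the coordinates `(x, u)` of `TM` induced by the chart `e`. -/
def localLagrangian (L : TangentBundle 𝓘(ℝ, E) M → ℝ) (e : OpenPartialHomeomorph M E)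
    (x u : E) : ℝ :=
  L ⟨e.symm x, mfderiv 𝓘(ℝ, E) 𝓘(ℝ, E) e.symm x u⟩

/-- The constrained, stochastic HP equations for `z = (q, v, p)` and the multiplier `ℓ`, along the
sample path `w` of the noise. The equation
`dp = ∂L/∂q dt + ∑ᵢ ∂γᵢ/∂q ∘ dWᵢ + (∂g/∂q)* dℓ` is required in integrated form, componentwise, in
every chart `e` of `M` and on every time interval during which `q` stays in the domain of `e`. -/
structure ConstrainedHPEquations {m k : ℕ} (L : TangentBundle 𝓘(ℝ, E) M → ℝ) (γ : Fin m → M → ℝ)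
    (g : M → EuclideanSpace ℝ (Fin k)) (w : Fin m → ℝ → ℝ) (a b : ℝ)
    (z : ℝ → PontryaginBundle E M) (ℓ : ℝ → EuclideanSpace ℝ (Fin k)) : Prop where
  kinematic : ∀ t ∈ Icc a b, velocity a b (fun r => (z r).proj) t = (z t).2.1
  momentum : ∀ e ∈ IsManifold.maximalAtlas 𝓘(ℝ, E) ∞ M, ∀ s t, a ≤ s → s ≤ t → t ≤ b →
    (∀ τ ∈ Icc s t, (z τ).proj ∈ e.source) → ∀ ξ : E,
    localMom e z t ξ - localMom e z s ξ =
      (∫ τ in s..t, fderiv ℝ (fun x => localLagrangian L e x (localVel e z τ)) (localPos e z τ) ξ)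
      + ∑ i, stratonovichIntegral
          (fun τ => fderiv ℝ (fun x => γ i (e.symm x)) (localPos e z τ) ξ) (w i) s t
      + integralD ℓ (fun τ => fderiv ℝ (fun x => g (e.symm x)) (localPos e z τ) ξ) s t
  legendre : ∀ t ∈ Icc a b, (z t).2.2 = fiberDeriv L (z t).proj (z t).2.1
  constraint : ∀ t ∈ Icc a b, g (z t).proj = 0

/-- The curve `z = (q, v, p)` in `TM ⊕ T*M` corresponds to the curve `y = (q', v', p')` in
`TN ⊕ T*N` under `j : N → M`: on `[a, b]`, `q = j ∘ q'`, `v = Tj v'` and `p' = (Tj)* p`. -/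
def Corresponds {E' : Type*} [NormedAddCommGroup E'] [NormedSpace ℝ E']
    {N : Type*} [TopologicalSpace N] [ChartedSpace E' N] [IsManifold 𝓘(ℝ, E') ∞ N]
    (j : N → M) (a b : ℝ) (y : ℝ → PontryaginBundle E' N) (z : ℝ → PontryaginBundle E M) : Prop :=
  ∀ t ∈ Icc a b, ∃ p : TangentSpace 𝓘(ℝ, E) (j (y t).proj) →L[ℝ] ℝ,
    z t = ⟨j (y t).proj, (mfderiv 𝓘(ℝ, E') 𝓘(ℝ, E) j (y t).proj (y t).2.1, p)⟩ ∧
    (y t).2.2 = p.comp (mfderiv 𝓘(ℝ, E') 𝓘(ℝ, E) j (y t).proj)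

end Equations

end

end StochasticHP

open StochasticHP

/-!
The theorem is pathwise: it holds for each `ω` for which the Wiener paths `w` are continuous.

*From stochastic integrals to multipliers.* As `q` is of class `C¹`, integration by parts gives
`∫ γᵢ(q) ∘ dwᵢ = γᵢ(q) wᵢ|ₐᵇ - ∫ wᵢ d/dt γᵢ(q) dt`. Hence the noise acts like a constraint with the
prescribed multiplier `-w`. With `N = (γ, g)` and `μ = (-w, ℓ)` the augmented action is, up to a
constant, the action `∫ L(q, v) dt + ∫ ⟨p, dq/dt - v⟩ dt + ∫ ⟨μ, d/dt N(q)⟩ dt`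
(`augmentedAction_eq_pairedAction_add`), and the momentum equation becomes the balance
`d(p + ⟨μ, ∂N/∂q⟩) = (∂L/∂q + ⟨μ, ∂²N/∂q² dq/dt⟩) dt` (`momentum_iff_momentumBalance`), which
contains no stochastic integral and in which `μ` is only continuous.

*Critical points are solutions.* The derivative of this action along a variation is the integral of
an integrand that is local in charts (`firstVariation_eq`). If `(z, ℓ)` is critical, perturbations
of `z` and `ℓ` with support in the domain of a chart yield all the equations, by the fundamental
lemma of the calculus of variations and the lemma of du Bois-Reymond
(`IsPairedCritical.momentumBalance` and its companions). Conversely, a given variation need not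
be a sum of variations supported in charts. Instead `[a, b]` is cut into pieces on which `q` stays
in one chart; on each piece integration by parts reduces the first variation to the boundary terms
`⟨p, δq⟩ + ⟨μ, δN(q)⟩`, which do not depend on the chart and telescope
(`hasDerivAt_pairedAction_zero`). Together this is `isAugmentedCritical_iff`. The multipliers in the
action and in the equations have opposite signs. As `g` vanishes on `S`, the same result
applies to the restricted action (`isCriticalPath_iff_isAugmentedCritical`).

*Restriction and lifting.* In charts in which the inclusion of `S` is linear, the momentum balance
on `S` is the balance on `Q` tested on tangent vectors of `S` (`Corresponds.momentumBalance_iff`).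
Hence solutions on `Q` restrict to critical points on `S`. Given a critical point `y` on `S`, the
velocity is pushed forward and the momentum is defined by the Legendre transform `p = ∂L/∂v`
(`liftPath`). The balance for this `p` then holds on vectors tangent to `S`. On a complement of the
tangent space, where `∂g/∂q` is invertible because `0` is a regular value, it is an equation
`d(Λ H) = dρ + Λ dH` for the multiplier `Λ`, with `H` of class `C¹` and `ρ` only continuous. Its
formal solution `dΛ = dρ H⁻¹` makes sense after integration by parts (`exists_multiplier`). The
initial value of `Λ` is free, so the multipliers on the pieces of a partition can be glued
(`Corresponds.exists_constrainedHPEquations`).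

Finally, a path that satisfies the equations on `Q` has its base curve in `S` and its velocity
tangent to `S`, so it lies over a path on `S` (`IsPath.exists_corresponds`).
-/

open Set Filter Topology MeasureTheory ProbabilityTheory Manifold Bundle

namespace StochasticHP

/-! ### One-parameter families of curves -/

/-- The family `(ε, t) ↦ f ε t` of curves in a normed space is `C¹` in the parameter `ε` on
`D ⊆ ℝ × ℝ`: `∂f/∂ε` exists, and `f` and `∂f/∂ε` are continuous in `(ε, t)` jointly. -/
structure C1FamilyOn {V : Type*} [NormedAddCommGroup V] [NormedSpace ℝ V] (D : Set (ℝ × ℝ))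
    (f : ℝ → ℝ → V) : Prop where
  differentiableAt : ∀ x ∈ D, DifferentiableAt ℝ (f · x.2) x.1
  continuousOn : ContinuousOn (fun x : ℝ × ℝ => f x.1 x.2) D
  continuousOn_deriv : ContinuousOn (fun x : ℝ × ℝ => deriv (f · x.2) x.1) D

/-- The manifold version of `C1FamilyOn`; on `Ioo (-δ) δ ×ˢ Icc a b` this is `IsC1Family`. -/
structure MC1FamilyOn {E H : Type*} [NormedAddCommGroup E] [NormedSpace ℝ E] [TopologicalSpace H]
    (I : ModelWithCorners ℝ E H) {M : Type*} [TopologicalSpace M] [ChartedSpace H M]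
    [IsManifold I 1 M] (D : Set (ℝ × ℝ)) (f : ℝ → ℝ → M) : Prop where
  mdifferentiableAt : ∀ x ∈ D, MDifferentiableAt 𝓘(ℝ, ℝ) I (f · x.2) x.1
  continuousOn_partial : ContinuousOn
    (fun x : ℝ × ℝ =>
      (⟨f x.1 x.2, mfderiv 𝓘(ℝ, ℝ) I (f · x.2) x.1 (1 : ℝ)⟩ : TangentBundle I M)) D

/-- `D` contains, with each of its points `(ε, t)`, all points `(ε', t)` with `ε'` near `ε`. -/
def IsParamOpen (D : Set (ℝ × ℝ)) : Prop :=
  ∀ x ∈ D, ∀ᶠ ε in 𝓝 x.1, (ε, x.2) ∈ D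

theorem isParamOpen_prod (δ : ℝ) (T : Set ℝ) : IsParamOpen (Ioo (-δ) δ ×ˢ T) := fun _ hx => by
  filter_upwards [isOpen_Ioo.mem_nhds hx.1] with ε hε using ⟨hε, hx.2⟩

theorem IsParamOpen.inter {D U : Set (ℝ × ℝ)} (hD : IsParamOpen D) (hU : IsOpen U) :
    IsParamOpen (D ∩ U) := fun x hx => by
  have h2 : ∀ᶠ ε in 𝓝 x.1, (ε, x.2) ∈ U :=
    (Continuous.prodMk_left x.2).continuousAt (hU.mem_nhds hx.2)
  filter_upwards [hD x hx.1, h2] with ε h h' using ⟨h, h'⟩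

theorem IsParamOpen.inter_preimage {D : Set (ℝ × ℝ)} (hD : IsParamOpen D) {X : Type*}
    [TopologicalSpace X] {f : ℝ × ℝ → X} (hf : ContinuousOn f D) {U : Set X} (hU : IsOpen U) :
    IsParamOpen (D ∩ f ⁻¹' U) := by
  obtain ⟨u, hu, h⟩ := continuousOn_iff'.1 hf U hU
  rw [inter_comm, h, inter_comm]
  exact hD.inter hu

section Manifold

variable {E H : Type*} [NormedAddCommGroup E] [NormedSpace ℝ E] [TopologicalSpace H]
  {I : ModelWithCorners ℝ E H} {M : Type*} [TopologicalSpace M] [ChartedSpace H M]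
  [IsManifold I 1 M]
  {E' H' : Type*} [NormedAddCommGroup E'] [NormedSpace ℝ E'] [TopologicalSpace H']
  {I' : ModelWithCorners ℝ E' H'} {M' : Type*} [TopologicalSpace M'] [ChartedSpace H' M']
  [IsManifold I' 1 M']
  {V : Type*} [NormedAddCommGroup V] [NormedSpace ℝ V]
  {D : Set (ℝ × ℝ)}

theorem isC1Family_iff {δ a b : ℝ} {f : ℝ → ℝ → M} :
    IsC1Family I δ a b f ↔ MC1FamilyOn I (Ioo (-δ) δ ×ˢ Icc a b) f :=
  ⟨fun h => ⟨fun _ hx => h.mdifferentiableAt _ hx.1 _ hx.2, h.continuousOn_partial⟩,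
    fun h => ⟨fun ε hε t ht => h.mdifferentiableAt (ε, t) ⟨hε, ht⟩, h.continuousOn_partial⟩⟩

theorem MC1FamilyOn.continuousOn {f : ℝ → ℝ → M} (h : MC1FamilyOn I D f) :
    ContinuousOn (fun x : ℝ × ℝ => f x.1 x.2) D :=
  (FiberBundle.continuous_proj E (TangentSpace I : M → Type _)).comp_continuousOn
    h.continuousOn_partial

theorem MC1FamilyOn.mono {D' : Set (ℝ × ℝ)} {f : ℝ → ℝ → M} (h : MC1FamilyOn I D f)
    (hD : D' ⊆ D) : MC1FamilyOn I D' f :=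
  ⟨fun x hx => h.mdifferentiableAt x (hD hx), h.continuousOn_partial.mono hD⟩

theorem MC1FamilyOn.congr {f g : ℝ → ℝ → M} (h : MC1FamilyOn I D f) (hD : IsParamOpen D)
    (hfg : ∀ x ∈ D, g x.1 x.2 = f x.1 x.2) : MC1FamilyOn I D g := by
  have key : ∀ x ∈ D, (g · x.2) =ᶠ[𝓝 x.1] (f · x.2) := fun x hx => by
    filter_upwards [hD x hx] with ε hε using hfg _ hε
  refine ⟨fun x hx => (h.mdifferentiableAt x hx).congr_of_eventuallyEq (key x hx),
    h.continuousOn_partial.congr fun x hx => ?_⟩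
  have := (key x hx).mfderiv_eq (I := 𝓘(ℝ, ℝ)) (I' := I)
  refine TotalSpace.ext (hfg x hx) ?_
  simp only
  rw [this]
  exact HEq.rfl

/-- Being a `C¹` family is a local property in `(ε, t)`. -/
theorem MC1FamilyOn.of_local {f : ℝ → ℝ → M}
    (h : ∀ x ∈ D, ∃ D', D' ∈ 𝓝[D] x ∧ x ∈ D' ∧ MC1FamilyOn I D' f) : MC1FamilyOn I D f := by
  refine ⟨fun x hx => ?_, fun x hx => ?_⟩
  · obtain ⟨D', _, h2, h3⟩ := h x hx
    exact h3.mdifferentiableAt x h2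
  · obtain ⟨D', h1, h2, h3⟩ := h x hx
    exact (h3.continuousOn_partial x h2).mono_of_mem_nhdsWithin h1

theorem MC1FamilyOn.comp {f : ℝ → ℝ → M} (h : MC1FamilyOn I D f) {Φ : M → M'} {O : Set M}
    (hO : IsOpen O) (hΦ : ContMDiffOn I I' 1 Φ O) (hfO : ∀ x ∈ D, f x.1 x.2 ∈ O) :
    MC1FamilyOn I' D (fun ε t => Φ (f ε t)) := by
  have hd : ∀ x ∈ D, MDifferentiableAt I I' Φ (f x.1 x.2) := fun x hx =>
    ((hΦ.contMDiffAt (hO.mem_nhds (hfO x hx))).mdifferentiableAt one_ne_zero)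
  refine ⟨fun x hx => (hd x hx).comp x.1 (h.mdifferentiableAt x hx), ?_⟩
  have h1 := (hΦ.continuousOn_tangentMapWithin le_rfl hO.uniqueMDiffOn).comp
    h.continuousOn_partial (fun x hx => hfO x hx)
  refine h1.congr fun x hx => ?_
  have h2 := mfderiv_comp x.1 (hd x hx) (h.mdifferentiableAt x hx)
  simp only [Function.comp_apply, tangentMapWithin]
  rw [mfderivWithin_of_isOpen hO (hfO x hx)]
  have h3 := DFunLike.congr_fun h2 (1 : ℝ)
  exact congrArg (fun v : E' => (⟨Φ (f x.1 x.2), v⟩ : TangentBundle I' M')) h3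

theorem mc1FamilyOn_iff_c1FamilyOn {f : ℝ → ℝ → V} :
    MC1FamilyOn 𝓘(ℝ, V) D f ↔ C1FamilyOn D f := by
  have key : ∀ x : ℝ × ℝ, mfderiv 𝓘(ℝ, ℝ) 𝓘(ℝ, V) (f · x.2) x.1 (1 : ℝ) = deriv (f · x.2) x.1 :=
    fun x => by rw [mfderiv_eq_fderiv]; exact fderiv_apply_one_eq_deriv (f := (f · x.2)) (x := x.1)
  have hc : ContinuousOn (fun x : ℝ × ℝ =>
      (⟨f x.1 x.2, mfderiv 𝓘(ℝ, ℝ) 𝓘(ℝ, V) (f · x.2) x.1 (1 : ℝ)⟩ : TangentBundle 𝓘(ℝ, V) V)) D ↔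
      ContinuousOn (fun x : ℝ × ℝ => (f x.1 x.2, deriv (f · x.2) x.1)) D := by
    rw [← (tangentBundleModelSpaceHomeomorph 𝓘(ℝ, V)).comp_continuousOn_iff]
    refine continuousOn_congr fun x hx => ?_
    simp only [tangentBundleModelSpaceHomeomorph_coe]
    exact Prod.ext rfl (key x)
  constructor
  · intro h
    have := hc.1 h.continuousOn_partial
    exact ⟨fun x hx => (h.mdifferentiableAt x hx).differentiableAt,
      continuous_fst.comp_continuousOn this, continuous_snd.comp_continuousOn this⟩
  · intro h
    exact ⟨fun x hx => (h.differentiableAt x hx).mdifferentiableAt,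
      hc.2 (h.continuousOn.prodMk h.continuousOn_deriv)⟩

end Manifold

section Vector

variable {V : Type*} [NormedAddCommGroup V] [NormedSpace ℝ V]
  {V' : Type*} [NormedAddCommGroup V'] [NormedSpace ℝ V']
  {D : Set (ℝ × ℝ)}

theorem C1FamilyOn.hasDerivAt {f : ℝ → ℝ → V} (h : C1FamilyOn D f) {ε t : ℝ} (hx : (ε, t) ∈ D) :
    HasDerivAt (f · t) (deriv (f · t) ε) ε :=
  (h.differentiableAt (ε, t) hx).hasDerivAt

theorem C1FamilyOn.mono {D' : Set (ℝ × ℝ)} {f : ℝ → ℝ → V} (h : C1FamilyOn D f)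
    (hD : D' ⊆ D) : C1FamilyOn D' f :=
  mc1FamilyOn_iff_c1FamilyOn.1 ((mc1FamilyOn_iff_c1FamilyOn.2 h).mono hD)

theorem C1FamilyOn.congr {f g : ℝ → ℝ → V} (h : C1FamilyOn D f) (hD : IsParamOpen D)
    (hfg : ∀ x ∈ D, g x.1 x.2 = f x.1 x.2) : C1FamilyOn D g :=
  mc1FamilyOn_iff_c1FamilyOn.1 ((mc1FamilyOn_iff_c1FamilyOn.2 h).congr hD hfg)

theorem C1FamilyOn.of_local {f : ℝ → ℝ → V}
    (h : ∀ x ∈ D, ∃ D', D' ∈ 𝓝[D] x ∧ x ∈ D' ∧ C1FamilyOn D' f) : C1FamilyOn D f :=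
  mc1FamilyOn_iff_c1FamilyOn.1 <| MC1FamilyOn.of_local fun x hx => by
    obtain ⟨D', h1, h2, h3⟩ := h x hx
    exact ⟨D', h1, h2, mc1FamilyOn_iff_c1FamilyOn.2 h3⟩

theorem C1FamilyOn.comp {f : ℝ → ℝ → V} (h : C1FamilyOn D f) {Φ : V → V'} {O : Set V}
    (hO : IsOpen O) (hΦ : ContDiffOn ℝ 1 Φ O) (hfO : ∀ x ∈ D, f x.1 x.2 ∈ O) :
    C1FamilyOn D (fun ε t => Φ (f ε t)) :=
  mc1FamilyOn_iff_c1FamilyOn.1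
    ((mc1FamilyOn_iff_c1FamilyOn.2 h).comp hO hΦ.contMDiffOn hfO)

theorem C1FamilyOn.comp_contDiff {f : ℝ → ℝ → V} (h : C1FamilyOn D f) {Φ : V → V'}
    (hΦ : ContDiff ℝ 1 Φ) : C1FamilyOn D (fun ε t => Φ (f ε t)) :=
  h.comp isOpen_univ hΦ.contDiffOn fun _ _ => mem_univ _

theorem C1FamilyOn.prodMk {f : ℝ → ℝ → V} {g : ℝ → ℝ → V'} (hf : C1FamilyOn D f)
    (hg : C1FamilyOn D g) : C1FamilyOn D (fun ε t => (f ε t, g ε t)) := by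
  refine ⟨fun x hx => (hf.differentiableAt x hx).prodMk (hg.differentiableAt x hx),
    hf.continuousOn.prodMk hg.continuousOn, ?_⟩
  refine (hf.continuousOn_deriv.prodMk hg.continuousOn_deriv).congr fun x hx => ?_
  exact ((hf.differentiableAt x hx).hasDerivAt.prodMk (hg.differentiableAt x hx).hasDerivAt).deriv

theorem hasDerivAt_affine (x η : V) (ε : ℝ) : HasDerivAt (fun ε : ℝ => x + ε • η) η ε := by
  simpa using ((hasDerivAt_id ε).smul_const η).const_add x

/-- The affine family `x + ε η`. -/
theorem c1FamilyOn_affine {T : Set ℝ} {x η : ℝ → V} (hx : ContinuousOn x T)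
    (hη : ContinuousOn η T) (hD : ∀ y ∈ D, y.2 ∈ T) :
    C1FamilyOn D (fun ε t => x t + ε • η t) := by
  have hd : ∀ y : ℝ × ℝ, HasDerivAt (fun ε : ℝ => x y.2 + ε • η y.2) (η y.2) y.1 := fun y =>
    hasDerivAt_affine _ _ _
  have hx' : ContinuousOn (fun y : ℝ × ℝ => x y.2) D := hx.comp continuousOn_snd hD
  have hη' : ContinuousOn (fun y : ℝ × ℝ => η y.2) D := hη.comp continuousOn_snd hD
  exact ⟨fun y _ => (hd y).differentiableAt, hx'.add (continuousOn_fst.smul hη'),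
    hη'.congr fun y _ => (hd y).deriv⟩

/-- At the parameter value `0` the curves of a `C¹` family are continuous in `t`. -/
theorem C1FamilyOn.continuousOn_zero {δ a b : ℝ} (hδ : 0 < δ) {f : ℝ → ℝ → V}
    (h : C1FamilyOn (Ioo (-δ) δ ×ˢ Icc a b) f) :
    ContinuousOn (f 0) (Icc a b) ∧ ContinuousOn (fun t => deriv (f · t) 0) (Icc a b) := by
  have hm : MapsTo (fun t : ℝ => ((0 : ℝ), t)) (Icc a b) (Ioo (-δ) δ ×ˢ Icc a b) :=
    fun t ht => ⟨⟨by simpa using hδ, hδ⟩, ht⟩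
  exact ⟨h.continuousOn.comp (Continuous.prodMk_right 0).continuousOn hm,
    h.continuousOn_deriv.comp (Continuous.prodMk_right 0).continuousOn hm⟩

/-- Differentiation under the integral sign for a `C¹` family. -/
theorem C1FamilyOn.hasDerivAt_integral [CompleteSpace V] {δ a b : ℝ} (hδ : 0 < δ)
    {f : ℝ → ℝ → V} (h : C1FamilyOn (Ioo (-δ) δ ×ˢ Icc a b) f) {s t : ℝ} (hs : a ≤ s)
    (hst : s ≤ t) (ht : t ≤ b) :
    HasDerivAt (fun ε => ∫ τ in s..t, f ε τ) (∫ τ in s..t, deriv (f · τ) 0) 0 := by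
  have hsub : Icc s t ⊆ Icc a b := Icc_subset_Icc hs ht
  have hsub' : Set.uIoc s t ⊆ Icc s t := by rw [uIoc_of_le hst]; exact Ioc_subset_Icc_self
  have hK : Icc (-(δ / 2)) (δ / 2) ×ˢ Icc a b ⊆ Ioo (-δ) δ ×ˢ Icc a b :=
    prod_mono (fun x hx => ⟨by linarith [hx.1], by linarith [hx.2]⟩) subset_rfl
  obtain ⟨C, hC⟩ := (isCompact_Icc.prod isCompact_Icc).exists_bound_of_continuousOn
    (h.continuousOn_deriv.mono hK)
  have hcont : ∀ ε ∈ Ioo (-δ) δ, ContinuousOn (f ε) (Icc s t) := fun ε hε =>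
    h.continuousOn.comp (Continuous.prodMk_right ε).continuousOn fun τ hτ => ⟨hε, hsub hτ⟩
  have hnhds : Icc (-(δ / 2)) (δ / 2) ∈ 𝓝 (0 : ℝ) := Icc_mem_nhds (by linarith) (by linarith)
  refine (intervalIntegral.hasDerivAt_integral_of_dominated_loc_of_deriv_le
    (F := f) (F' := fun ε τ => deriv (f · τ) ε) (bound := fun _ => C) hnhds ?_ ?_ ?_ ?_ ?_ ?_).2
  · filter_upwards [hnhds] with ε hε
    refine ((hcont ε ⟨by linarith [hε.1], by linarith [hε.2]⟩).mono
      hsub').aestronglyMeasurable measurableSet_uIoc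
  · exact ContinuousOn.intervalIntegrable (by
      rw [uIcc_of_le hst]; exact hcont 0 ⟨by linarith, hδ⟩)
  · exact ((h.continuousOn_zero hδ).2.mono (hsub'.trans hsub)).aestronglyMeasurable
      measurableSet_uIoc
  · exact Eventually.of_forall fun τ hτ ε hε => hC (ε, τ) ⟨hε, hsub (hsub' hτ)⟩
  · exact intervalIntegrable_const
  · exact Eventually.of_forall fun τ hτ ε hε => h.hasDerivAt (hK ⟨hε, hsub (hsub' hτ)⟩)

end Vector

/-! ### Lemmas of the calculus of variations -/

/-- A function with increments `∫ h` has derivative `h`. -/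
theorem hasDerivAt_of_sub_eq_integral {V : Type*} [NormedAddCommGroup V] [NormedSpace ℝ V]
    [CompleteSpace V] {s t : ℝ} (hst : s ≤ t) {g h : ℝ → V} (hh : ContinuousOn h (Icc s t))
    (H : ∀ τ ∈ Icc s t, g τ - g s = ∫ r in s..τ, h r) :
    ContinuousOn g (Icc s t) ∧ ∀ τ ∈ Ioo s t, HasDerivAt g (h τ) τ := by
  have hi : IntervalIntegrable h volume s t :=
    ContinuousOn.intervalIntegrable (by rwa [uIcc_of_le hst])
  have hg : ∀ τ ∈ Icc s t, g τ = g s + ∫ r in s..τ, h r := fun τ hτ => by rw [← H τ hτ]; abel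
  constructor
  · have := intervalIntegral.continuousOn_primitive_interval'
      (hi : IntervalIntegrable h volume s t) left_mem_uIcc
    rw [uIcc_of_le hst] at this
    exact (this.const_add (g s)).congr hg
  · intro τ hτ
    have hmem : Icc s t ∈ 𝓝 τ := Icc_mem_nhds hτ.1 hτ.2
    have h1 : HasDerivAt (fun τ => ∫ r in s..τ, h r) (h τ) τ := by
      refine intervalIntegral.integral_hasDerivAt_right ?_ ?_ (hh.continuousAt hmem)
      · exact hi.mono_set (by
          rw [uIcc_of_le hst, uIcc_of_le hτ.1.le]; exact Icc_subset_Icc_right hτ.2.le)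
      · exact hh.stronglyMeasurableAtFilter_nhdsWithin measurableSet_Icc τ |>.filter_mono
          (le_of_eq (nhdsWithin_eq_nhds.2 hmem).symm)
    refine (h1.const_add (g s)).congr_of_eventuallyEq ?_
    filter_upwards [hmem] with r hr using hg r hr

/-- Integration by parts for a pairing of a curve of covectors and a curve of vectors. -/
theorem integral_clm_apply_by_parts {V : Type*} [NormedAddCommGroup V] [NormedSpace ℝ V]
    [CompleteSpace V] {s t : ℝ} (hst : s ≤ t) {P f : ℝ → V →L[ℝ] ℝ} {x y : ℝ → V}
    (hf : ContinuousOn f (Icc s t)) (hy : ContinuousOn y (Icc s t))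
    (hP : ∀ τ ∈ Icc s t, ∀ ξ, P τ ξ - P s ξ = ∫ r in s..τ, f r ξ)
    (hx : ∀ τ ∈ Icc s t, x τ - x s = ∫ r in s..τ, y r) :
    ∫ τ in s..t, (f τ (x τ) + P τ (y τ)) = P t (x t) - P s (x s) := by
  have hP' : ∀ τ ∈ Icc s t, P τ - P s = ∫ r in s..τ, f r := fun τ hτ => by
    have hi : IntervalIntegrable f volume s τ := ContinuousOn.intervalIntegrable (by
      rw [uIcc_of_le hτ.1]; exact hf.mono (Icc_subset_Icc_right hτ.2))
    ext ξ
    rw [ContinuousLinearMap.intervalIntegral_apply hi, sub_apply, hP τ hτ]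
  obtain ⟨cP, dP⟩ := hasDerivAt_of_sub_eq_integral hst hf hP'
  obtain ⟨cx, dx⟩ := hasDerivAt_of_sub_eq_integral hst hy hx
  exact intervalIntegral.integral_eq_sub_of_hasDerivAt_of_le hst (cP.clm_apply cx)
    (fun τ hτ => (dP τ hτ).clm_apply (dx τ hτ)) (ContinuousOn.intervalIntegrable (by
      rw [uIcc_of_le hst]; exact (hf.clm_apply cx).add (cP.clm_apply hy)))

/-- The weight `max 0 ((τ - s) * (t - τ))` is continuous on the line, positive inside `(s, t)` and
zero outside. Multiplied by it, a continuous function becomes a test function that vanishes outside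
`(s, t)`. -/
theorem weight_eq_zero {s t τ : ℝ} (hst : s ≤ t) (hτ : τ ∉ Ioo s t) :
    max 0 ((τ - s) * (t - τ)) = 0 := by
  refine max_eq_left ?_
  rcases le_or_gt τ s with h | h
  · exact mul_nonpos_of_nonpos_of_nonneg (by linarith) (by linarith)
  · have : t ≤ τ := by by_contra h'; exact hτ ⟨h, not_le.1 h'⟩
    exact mul_nonpos_of_nonneg_of_nonpos (by linarith) (by linarith)

theorem eq_zero_of_integral_weight_mul_sq_eq_zero {s t : ℝ} (hst : s < t) {f : ℝ → ℝ}
    (hf : ContinuousOn f (Icc s t))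
    (h : ∫ τ in s..t, max 0 ((τ - s) * (t - τ)) * f τ * f τ = 0) : ∀ τ ∈ Icc s t, f τ = 0 := by
  have hw : Continuous fun τ : ℝ => max 0 ((τ - s) * (t - τ)) := by fun_prop
  have h1 : EqOn f 0 (Ioo s t) := fun c hc => by
    by_contra hne
    have hpos : 0 < (c - s) * (t - c) := mul_pos (sub_pos.2 hc.1) (sub_pos.2 hc.2)
    refine (intervalIntegral.integral_pos hst ((hw.continuousOn.fun_mul hf).fun_mul hf)
      (fun τ _ => ?_) ⟨c, Ioo_subset_Icc_self hc, ?_⟩).ne' h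
    · rw [mul_assoc]
      exact mul_nonneg (le_max_left _ _) (mul_self_nonneg _)
    · rw [mul_assoc, max_eq_right hpos.le]
      exact mul_pos hpos (mul_self_pos.2 hne)
  exact h1.of_subset_closure hf continuousOn_const Ioo_subset_Icc_self
    (closure_Ioo hst.ne).symm.subset

/-- The fundamental lemma of the calculus of variations, for test functions that vanish outside an
interval. -/
theorem eq_zero_of_forall_integral_mul_eq_zero {s t : ℝ} (hst : s < t) {f : ℝ → ℝ}
    (hf : ContinuousOn f (Icc s t))
    (h : ∀ ψ : ℝ → ℝ, Continuous ψ → (∀ τ ∉ Ioo s t, ψ τ = 0) →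
      ∫ τ in s..t, ψ τ * f τ = 0) : ∀ τ ∈ Icc s t, f τ = 0 := by
  have hfe : Continuous (IccExtend hst.le ((Icc s t).domRestrict f)) :=
    (continuousOn_iff_continuous_domRestrict.1 hf).Icc_extend'
  refine eq_zero_of_integral_weight_mul_sq_eq_zero hst hf ?_
  refine Eq.trans ?_ (h
    (fun τ => max 0 ((τ - s) * (t - τ)) * IccExtend hst.le ((Icc s t).domRestrict f) τ)
    (by fun_prop) fun τ hτ => ?_)
  · refine intervalIntegral.integral_congr fun τ hτ => ?_
    rw [uIcc_of_le hst.le] at hτ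
    simp only [IccExtend_of_mem hst.le _ hτ, domRestrict_apply]
  · simp only [weight_eq_zero hst.le hτ, zero_mul]

/-- The lemma of du Bois-Reymond, for test functions that vanish outside an interval. -/
theorem sub_eq_integral_of_forall_integral_eq_zero {s t : ℝ} (hst : s < t) {f P : ℝ → ℝ}
    (hf : ContinuousOn f (Icc s t)) (hP : ContinuousOn P (Icc s t))
    (h : ∀ η η' : ℝ → ℝ, (∀ τ, HasDerivAt η (η' τ) τ) → Continuous η' → (∀ τ ∉ Ioo s t, η τ = 0) →
      (∀ τ ∉ Ioo s t, η' τ = 0) → ∫ τ in s..t, (f τ * η τ + P τ * η' τ) = 0) :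
    P t - P s = ∫ τ in s..t, f τ := by
  set w : ℝ → ℝ := fun τ => max 0 ((τ - s) * (t - τ)) with hwdef
  have hw : Continuous w := by fun_prop
  -- As `F` is a primitive of `f`, the function `P` is tested in the combination `P - F` only.
  set F : ℝ → ℝ := fun τ => ∫ r in s..τ, f r with hF
  obtain ⟨hFc, hFd⟩ : ContinuousOn F (Icc s t) ∧ ∀ τ ∈ Ioo s t, HasDerivAt F (f τ) τ :=
    hasDerivAt_of_sub_eq_integral hst.le hf fun τ _ => by simp [hF]
  -- `H` is constant if and only if the conclusion holds; `c` is its weighted mean.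
  set H : ℝ → ℝ := fun τ => P τ - F τ with hH
  have hHc : ContinuousOn H (Icc s t) := hP.sub hFc
  set He := IccExtend hst.le ((Icc s t).domRestrict H) with hHe
  have hHec : Continuous He := (continuousOn_iff_continuous_domRestrict.1 hHc).Icc_extend'
  have hHeq : ∀ τ ∈ Icc s t, He τ = H τ := fun τ hτ => by
    rw [hHe, IccExtend_of_mem hst.le _ hτ, domRestrict_apply]
  have hwpos : 0 < ∫ τ in s..t, w τ := by
    refine intervalIntegral.integral_pos hst hw.continuousOn (fun τ _ => le_max_left _ _)
      ⟨(s + t) / 2, ⟨by linarith, by linarith⟩, ?_⟩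
    exact lt_max_of_lt_right (mul_pos (by linarith) (by linarith))
  set c := (∫ τ in s..t, w τ * He τ) / ∫ τ in s..t, w τ with hc
  -- `η'` is weighted so as to vanish outside `(s, t)`, and has mean zero, so that its primitive `η`
  -- vanishes there too.
  set η' : ℝ → ℝ := fun τ => w τ * (He τ - c) with hη'
  have hη'c : Continuous η' := by fun_prop
  set η : ℝ → ℝ := fun τ => ∫ r in s..τ, η' r with hη
  have hηd : ∀ τ, HasDerivAt η (η' τ) τ := fun τ => hη'c.integral_hasStrictDerivAt s τ |>.hasDerivAt
  have hη'0 : ∀ τ ∉ Ioo s t, η' τ = 0 := fun τ hτ => by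
    simp only [hη', hwdef, weight_eq_zero hst.le hτ, zero_mul]
  have hmean : ∫ τ in s..t, η' τ = 0 := by
    have : ∀ τ, η' τ = w τ * He τ - c * w τ := fun τ => by simp only [hη']; ring
    simp_rw [this]
    rw [intervalIntegral.integral_sub ((hw.fun_mul hHec).intervalIntegrable _ _)
      ((hw.const_mul c).intervalIntegrable _ _), intervalIntegral.integral_const_mul, hc,
      div_mul_cancel₀ _ hwpos.ne', sub_self]
  have hη0 : ∀ τ ∉ Ioo s t, η τ = 0 := fun τ hτ => by
    rcases lt_or_ge s τ with h1 | h1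
    · have h2 : t ≤ τ := by by_contra h3; exact hτ ⟨h1, not_le.1 h3⟩
      have h3 : ∫ r in t..τ, η' r = 0 := by
        rw [intervalIntegral.integral_congr (g := fun _ => (0 : ℝ)) fun r hr => ?_]
        · simp
        · rw [uIcc_of_le h2] at hr
          exact hη'0 r fun h => (h.2.trans_le hr.1).false
      simp only [hη]
      rw [← intervalIntegral.integral_add_adjacent_intervals
        (hη'c.intervalIntegrable s t) (hη'c.intervalIntegrable t τ), hmean, h3, add_zero]
    · simp only [hη]
      rw [intervalIntegral.integral_congr (g := fun _ => (0 : ℝ)) fun r hr => ?_]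
      · simp
      · rw [uIcc_of_ge h1] at hr
        exact hη'0 r fun h => (h.1.trans_le hr.2).false
  have hηc : Continuous η := continuous_iff_continuousAt.2 fun τ => (hηd τ).continuousAt
  have hs0 : η s = 0 := hη0 s fun h => h.1.false
  have ht0 : η t = 0 := hη0 t fun h => h.2.false
  have ii : ∀ {u : ℝ → ℝ}, ContinuousOn u (Icc s t) → IntervalIntegrable u volume s t :=
    fun hu => ContinuousOn.intervalIntegrable (by rwa [uIcc_of_le hst.le])
  have hFη : ∫ τ in s..t, (f τ * η τ + F τ * η' τ) = 0 := by
    rw [intervalIntegral.integral_eq_sub_of_hasDerivAt_of_le hst.le (hFc.mul hηc.continuousOn)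
      (fun τ hτ => (hFd τ hτ).mul (hηd τ))
      (ii ((hf.mul hηc.continuousOn).add (hFc.mul hη'c.continuousOn)))]
    simp [hs0, ht0]
  have hHη : ∫ τ in s..t, (H τ - c) * η' τ = 0 := by
    have h1 := h η η' hηd hη'c hη0 hη'0
    have h2 : ∀ τ, (H τ - c) * η' τ =
        (f τ * η τ + P τ * η' τ) - (f τ * η τ + F τ * η' τ) - c * η' τ := fun τ => by
      simp only [hH]; ring
    simp_rw [h2]
    have i1 := ii ((hf.fun_mul hηc.continuousOn).fun_add (hP.fun_mul hη'c.continuousOn))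
    have i2 := ii ((hf.fun_mul hηc.continuousOn).fun_add (hFc.fun_mul hη'c.continuousOn))
    rw [intervalIntegral.integral_sub (i1.sub i2) ((hη'c.const_mul c).intervalIntegrable _ _),
      intervalIntegral.integral_sub i1 i2, intervalIntegral.integral_const_mul, h1, hFη, hmean]
    simp
  have hfin := eq_zero_of_integral_weight_mul_sq_eq_zero hst
    (hHc.fun_sub (continuousOn_const (c := c))) (by
    refine Eq.trans (intervalIntegral.integral_congr fun τ hτ => ?_) hHη
    rw [uIcc_of_le hst.le] at hτ
    simp only [hη', hHeq τ hτ, hwdef]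
    ring)
  have e1 := hfin s (left_mem_Icc.2 hst.le)
  have e2 := hfin t (right_mem_Icc.2 hst.le)
  simp only [hH, hF, intervalIntegral.integral_same] at e1 e2
  linarith

/-! ### Coordinates on the tangent and Pontryagin bundles induced by a chart -/

section Coordinates

open scoped ContDiff

variable {E : Type*} [NormedAddCommGroup E] [NormedSpace ℝ E]
  {M : Type*} [TopologicalSpace M] [ChartedSpace E M]
  {e : OpenPartialHomeomorph M E}

theorem one_add_one_le_infty : (1 : WithTop ℕ∞) + 1 ≤ ∞ := by
  rw [one_add_one_eq_two]; exact ENat.LEInfty.out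

theorem mdifferentiable_of_mem_maximalAtlas (he : e ∈ IsManifold.maximalAtlas 𝓘(ℝ, E) ∞ M) :
    e.MDifferentiable 𝓘(ℝ, E) 𝓘(ℝ, E) :=
  ⟨(contMDiffOn_of_mem_maximalAtlas he).mdifferentiableOn (by simp),
    (contMDiffOn_symm_of_mem_maximalAtlas he).mdifferentiableOn (by simp)⟩

variable (e) in
/-- The differential of the chart `e` at `q`, as an endomorphism of the model space. -/
noncomputable def chartDiff (q : M) : E →L[ℝ] E := mfderiv 𝓘(ℝ, E) 𝓘(ℝ, E) e q

variable (e) in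
/-- The differential of the inverse of the chart `e` at `x`, as an endomorphism of the model
space. -/
noncomputable def chartSymmDiff (x : E) : E →L[ℝ] E := mfderiv 𝓘(ℝ, E) 𝓘(ℝ, E) e.symm x

theorem chartSymmDiff_chartDiff (he : e ∈ IsManifold.maximalAtlas 𝓘(ℝ, E) ∞ M) {q : M}
    (hq : q ∈ e.source) (v : E) :
    chartSymmDiff e (e q) (chartDiff e q v) = v :=
  DFunLike.congr_fun ((mdifferentiable_of_mem_maximalAtlas he).symm_comp_deriv hq) v

theorem chartDiff_chartSymmDiff (he : e ∈ IsManifold.maximalAtlas 𝓘(ℝ, E) ∞ M) {q : M}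
    (hq : q ∈ e.source) (v : E) :
    chartDiff e q (chartSymmDiff e (e q) v) = v := by
  have := DFunLike.congr_fun
    ((mdifferentiable_of_mem_maximalAtlas he).comp_symm_deriv (e.map_source hq)) v
  rw [e.left_inv hq] at this
  exact this

theorem inverse_chartDiff (he : e ∈ IsManifold.maximalAtlas 𝓘(ℝ, E) ∞ M) {q : M}
    (hq : q ∈ e.source) :
    (chartDiff e q).inverse = chartSymmDiff e (e q) :=
  ContinuousLinearMap.inverse_eq (ContinuousLinearMap.ext (chartDiff_chartSymmDiff he hq))
    (ContinuousLinearMap.ext (chartSymmDiff_chartDiff he hq))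

variable (e) in
/-- The coordinates `(x, u)` of a tangent vector induced by the chart `e`. -/
noncomputable def tangentCoord (z : TangentBundle 𝓘(ℝ, E) M) : E × E :=
  (e z.proj, (chartDiff e z.proj z.2 : E))

variable (e) in
/-- The tangent vector with coordinates `(x, u)` in the chart `e`. -/
noncomputable def tangentOfCoord (c : E × E) : TangentBundle 𝓘(ℝ, E) M :=
  ⟨e.symm c.1, (chartSymmDiff e c.1 c.2 : E)⟩

variable (e) in
/-- The coordinates `(x, u, π)` of a point of the Pontryagin bundle induced by the chart `e`. -/
noncomputable def pontryaginCoord (z : PontryaginBundle E M) : E × E × (E →L[ℝ] ℝ) :=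
  (e z.proj, (chartDiff e z.proj z.2.1 : E), (z.2.2 : E →L[ℝ] ℝ).comp (chartDiff e z.proj).inverse)

variable (e) in
/-- The point of the Pontryagin bundle with coordinates `(x, u, π)` in the chart `e`. -/
noncomputable def pontryaginOfCoord (c : E × E × (E →L[ℝ] ℝ)) : PontryaginBundle E M :=
  ⟨e.symm c.1, ((chartSymmDiff e c.1 c.2.1 : E),
    (c.2.2.comp (chartDiff e (e.symm c.1)) : E →L[ℝ] ℝ))⟩

theorem tangentOfCoord_tangentCoord (he : e ∈ IsManifold.maximalAtlas 𝓘(ℝ, E) ∞ M)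
    {z : TangentBundle 𝓘(ℝ, E) M} (hz : z.proj ∈ e.source) :
    tangentOfCoord e (tangentCoord e z) = z := by
  obtain ⟨q, v⟩ := z
  have h1 : e.symm (e q) = q := e.left_inv hz
  have h2 := chartSymmDiff_chartDiff he hz v
  refine TotalSpace.ext h1 (heq_of_eq ?_)
  exact h2

theorem pontryaginOfCoord_pontryaginCoord (he : e ∈ IsManifold.maximalAtlas 𝓘(ℝ, E) ∞ M)
    {z : PontryaginBundle E M} (hz : z.proj ∈ e.source) :
    pontryaginOfCoord e (pontryaginCoord e z) = z := by
  obtain ⟨q, v, p⟩ := z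
  have h1 : e.symm (e q) = q := e.left_inv hz
  have h2 := chartSymmDiff_chartDiff he hz v
  have h3 : ((p : E →L[ℝ] ℝ).comp (chartDiff e q).inverse).comp
      (chartDiff e (e.symm (e q))) = p := by
    ext ξ
    rw [h1, inverse_chartDiff he hz]
    exact congrArg p (chartSymmDiff_chartDiff he hz ξ)
  refine TotalSpace.ext h1 (heq_of_eq (Prod.ext h2 h3))

theorem pontryaginCoord_pontryaginOfCoord (he : e ∈ IsManifold.maximalAtlas 𝓘(ℝ, E) ∞ M)
    {c : E × E × (E →L[ℝ] ℝ)} (hc : c.1 ∈ e.target) :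
    pontryaginCoord e (pontryaginOfCoord e c) = c := by
  obtain ⟨x, u, p⟩ := c
  have h1 : e (e.symm x) = x := e.right_inv hc
  have h2 := chartDiff_chartSymmDiff he (e.map_target hc) u
  rw [h1] at h2
  refine Prod.ext h1 (Prod.ext h2 ?_)
  change (p.comp (chartDiff e (e.symm x))).comp
    (chartDiff e (e.symm x)).inverse = p
  rw [inverse_chartDiff he (e.map_target hc)]
  ext ξ
  exact congrArg p (chartDiff_chartSymmDiff he (e.map_target hc) ξ)

variable [IsManifold 𝓘(ℝ, E) ∞ M]

variable (E) in
/-- The trivialization of `TM` at `q₀`, on the fiber over `q`. -/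
noncomputable def fiberTriv (q₀ q : M) : E →L[ℝ] E :=
  (trivializationAt E (TangentSpace 𝓘(ℝ, E) : M → Type _) q₀).continuousLinearMapAt ℝ q

variable (E) in
/-- The inverse of the trivialization of `TM` at `q₀`, on the fiber over `q`. -/
noncomputable def fiberTrivSymm (q₀ q : M) : E →L[ℝ] E :=
  (trivializationAt E (TangentSpace 𝓘(ℝ, E) : M → Type _) q₀).symmL ℝ q

theorem fiberTrivSymm_fiberTriv {q₀ q : M} (hq : q ∈ (chartAt E q₀).source) (v : E) :
    fiberTrivSymm E q₀ q (fiberTriv E q₀ q v) = v :=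
  (trivializationAt E (TangentSpace 𝓘(ℝ, E) : M → Type _) q₀).symmL_continuousLinearMapAt
    (by simpa using hq) v

theorem fiberTriv_apply {q₀ : M} {z : TangentBundle 𝓘(ℝ, E) M}
    (hq : z.proj ∈ (chartAt E q₀).source) :
    (trivializationAt E (TangentSpace 𝓘(ℝ, E) : M → Type _) q₀ z).2 =
      fiberTriv E q₀ z.proj z.2 := by
  have h : z.proj ∈ (trivializationAt E (TangentSpace 𝓘(ℝ, E) : M → Type _) q₀).baseSet := by
    simpa using hq
  exact (congrFun (Trivialization.coe_linearMapAt_of_mem (R := ℝ) _ h) z.2).symm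

theorem pontryagin_trivializationAt_apply {q₀ : M} {z : PontryaginBundle E M}
    (hq : z.proj ∈ (chartAt E q₀).source) :
    (trivializationAt (E × (E →L[ℝ] ℝ)) ((fun x : M => TangentSpace 𝓘(ℝ, E) x) ×ᵇ
      (fun x : M => TangentSpace 𝓘(ℝ, E) x →L[ℝ] Bundle.Trivial M ℝ x)) q₀ z).2 =
      (fiberTriv E q₀ z.proj z.2.1, (z.2.2 : E →L[ℝ] ℝ).comp (fiberTrivSymm E q₀ z.proj)) := by
  refine Prod.ext (fiberTriv_apply (z := ⟨z.proj, z.2.1⟩) hq) ?_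
  ext ξ
  change ContinuousLinearMap.inCoordinates E (TangentSpace 𝓘(ℝ, E)) ℝ (Bundle.Trivial M ℝ)
    q₀ z.proj q₀ z.proj z.2.2 ξ = _
  simp [ContinuousLinearMap.inCoordinates]
  rfl

/-- The differential of a chart, in the trivialization of the tangent bundle at a point. -/
theorem contMDiffAt_chartDiff (he : e ∈ IsManifold.maximalAtlas 𝓘(ℝ, E) ∞ M) {q : M}
    (hq : q ∈ e.source) : ContMDiffAt 𝓘(ℝ, E) 𝓘(ℝ, E →L[ℝ] E) 1
      (fun q' => (chartDiff e q').comp (fiberTrivSymm E q q')) q := by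
  have := (contMDiffAt_of_mem_maximalAtlas he hq).mfderiv_const (m := 1) one_add_one_le_infty
  refine this.congr_of_eventuallyEq (Eventually.of_forall fun q' => ?_)
  ext v
  simp [inTangentCoordinates, ContinuousLinearMap.inCoordinates]
  rfl

/-- The differential of the inverse of a chart, in the trivialization of the tangent bundle at a
point. -/
theorem contMDiffAt_chartSymmDiff (he : e ∈ IsManifold.maximalAtlas 𝓘(ℝ, E) ∞ M) {x : E}
    (hx : x ∈ e.target) : ContMDiffAt 𝓘(ℝ, E) 𝓘(ℝ, E →L[ℝ] E) 1
      (fun x' => (fiberTriv E (e.symm x) (e.symm x')).comp (chartSymmDiff e x')) x := by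
  have := (contMDiffAt_symm_of_mem_maximalAtlas he hx).mfderiv_const (m := 1) one_add_one_le_infty
  refine this.congr_of_eventuallyEq (Eventually.of_forall fun q' => ?_)
  ext v
  simp [inTangentCoordinates, ContinuousLinearMap.inCoordinates]
  rfl

theorem contMDiffAt_chartSymmDiff_comp (he : e ∈ IsManifold.maximalAtlas 𝓘(ℝ, E) ∞ M) {q : M}
    (hq : q ∈ e.source) : ContMDiffAt 𝓘(ℝ, E) 𝓘(ℝ, E →L[ℝ] E) 1
      (fun q' => (fiberTriv E q q').comp (chartSymmDiff e (e q'))) q := by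
  have h := (contMDiffAt_chartSymmDiff he (e.map_source hq)).comp q
    ((contMDiffAt_of_mem_maximalAtlas he hq).of_le (by simp : (1 : WithTop ℕ∞) ≤ ∞))
  refine h.congr_of_eventuallyEq ?_
  filter_upwards [e.open_source.mem_nhds hq] with q' hq'
  simp only [Function.comp_apply, e.left_inv hq, e.left_inv hq']

theorem contMDiffAt_chartDiff_comp_symm (he : e ∈ IsManifold.maximalAtlas 𝓘(ℝ, E) ∞ M) {x : E}
    (hx : x ∈ e.target) : ContMDiffAt 𝓘(ℝ, E) 𝓘(ℝ, E →L[ℝ] E) 1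
      (fun x' => (chartDiff e (e.symm x')).comp (fiberTrivSymm E (e.symm x) (e.symm x'))) x :=
  (contMDiffAt_chartDiff he (e.map_target hx)).comp x
    ((contMDiffAt_symm_of_mem_maximalAtlas he hx).of_le (by simp : (1 : WithTop ℕ∞) ≤ ∞))

/-- A tangent vector is read in the trivialization of `TM` at its base point first: in this form
`mfderiv` of the chart is known to depend smoothly on the point. -/
theorem contMDiffOn_tangentCoord (he : e ∈ IsManifold.maximalAtlas 𝓘(ℝ, E) ∞ M) :
    ContMDiffOn 𝓘(ℝ, E).tangent 𝓘(ℝ, E × E) 1 (tangentCoord e)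
      ((fun z : TangentBundle 𝓘(ℝ, E) M => z.proj) ⁻¹' e.source) := by
  intro z₀ hz₀
  refine ContMDiffAt.contMDiffWithinAt ?_
  have hp : ContMDiffAt 𝓘(ℝ, E).tangent 𝓘(ℝ, E) 1 (fun z : TangentBundle 𝓘(ℝ, E) M => z.proj) z₀ :=
    contMDiffAt_proj _
  have h1 := ((contMDiffAt_of_mem_maximalAtlas he hz₀).of_le
    (by simp : (1 : WithTop ℕ∞) ≤ ∞)).comp z₀ hp
  have h2 := (contMDiffAt_chartDiff he hz₀).comp z₀ hp
  have h3 := (contMDiffAt_totalSpace.1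
    (contMDiffAt_id (I := 𝓘(ℝ, E).tangent) (n := 1) (x := z₀))).2
  refine (h1.prodMk_space (h2.clm_apply h3)).congr_of_eventuallyEq ?_
  have hb : ∀ᶠ z : TangentBundle 𝓘(ℝ, E) M in 𝓝 z₀, z.proj ∈ (chartAt E z₀.proj).source :=
    hp.continuousAt ((chartAt E z₀.proj).open_source.mem_nhds (mem_chart_source E z₀.proj))
  filter_upwards [hb] with z hz
  refine Prod.ext rfl ?_
  simp only [id, fiberTriv_apply hz, Function.comp_apply, ContinuousLinearMap.comp_apply]
  exact congrArg (chartDiff e z.proj) (fiberTrivSymm_fiberTriv hz z.2).symm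

theorem contMDiffOn_tangentOfCoord (he : e ∈ IsManifold.maximalAtlas 𝓘(ℝ, E) ∞ M) :
    ContMDiffOn 𝓘(ℝ, E × E) 𝓘(ℝ, E).tangent 1 (tangentOfCoord e)
      ((fun c : E × E => c.1) ⁻¹' e.target) := by
  intro c₀ hc₀
  refine ContMDiffAt.contMDiffWithinAt ?_
  have hp : ContMDiffAt 𝓘(ℝ, E × E) 𝓘(ℝ, E) 1 (fun c : E × E => c.1) c₀ :=
    contDiff_fst.contDiffAt.contMDiffAt
  have hp2 : ContMDiffAt 𝓘(ℝ, E × E) 𝓘(ℝ, E) 1 (fun c : E × E => c.2) c₀ :=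
    contDiff_snd.contDiffAt.contMDiffAt
  have h1 := ((contMDiffAt_symm_of_mem_maximalAtlas he hc₀).of_le
    (by simp : (1 : WithTop ℕ∞) ≤ ∞)).comp c₀ hp
  have h2 := (contMDiffAt_chartSymmDiff he hc₀).comp c₀ hp
  refine contMDiffAt_totalSpace.2 ⟨h1, (h2.clm_apply hp2).congr_of_eventuallyEq ?_⟩
  have hb : ∀ᶠ c : E × E in 𝓝 c₀, e.symm c.1 ∈ (chartAt E (e.symm c₀.1)).source :=
    h1.continuousAt ((chartAt E _).open_source.mem_nhds (mem_chart_source E _))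
  filter_upwards [hb] with c hc
  exact fiberTriv_apply (z := tangentOfCoord e c) hc

theorem contMDiffOn_pontryaginCoord (he : e ∈ IsManifold.maximalAtlas 𝓘(ℝ, E) ∞ M) :
    ContMDiffOn (𝓘(ℝ, E).prod 𝓘(ℝ, E × (E →L[ℝ] ℝ))) 𝓘(ℝ, E × E × (E →L[ℝ] ℝ)) 1
      (pontryaginCoord e) ((fun z : PontryaginBundle E M => z.proj) ⁻¹' e.source) := by
  intro z₀ hz₀
  refine ContMDiffAt.contMDiffWithinAt ?_
  have hp : ContMDiffAt (𝓘(ℝ, E).prod 𝓘(ℝ, E × (E →L[ℝ] ℝ))) 𝓘(ℝ, E) 1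
      (fun z : PontryaginBundle E M => z.proj) z₀ := contMDiffAt_proj _
  have h1 := ((contMDiffAt_of_mem_maximalAtlas he hz₀).of_le
    (by simp : (1 : WithTop ℕ∞) ≤ ∞)).comp z₀ hp
  have h2 := (contMDiffAt_chartDiff he hz₀).comp z₀ hp
  have h2' := (contMDiffAt_chartSymmDiff_comp he hz₀).comp z₀ hp
  have h3 := (contMDiffAt_totalSpace.1
    (contMDiffAt_id (I := 𝓘(ℝ, E).prod 𝓘(ℝ, E × (E →L[ℝ] ℝ))) (n := 1) (x := z₀))).2
  have h4 := contDiff_fst.contMDiff.contMDiffAt.comp z₀ h3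
  have h5 := contDiff_snd.contMDiff.contMDiffAt.comp z₀ h3
  refine (h1.prodMk_space ((h2.clm_apply h4).prodMk_space
    (h5.clm_comp h2'))).congr_of_eventuallyEq ?_
  have hb : ∀ᶠ z : PontryaginBundle E M in 𝓝 z₀, z.proj ∈ (chartAt E z₀.proj).source :=
    hp.continuousAt ((chartAt E z₀.proj).open_source.mem_nhds (mem_chart_source E z₀.proj))
  have hb' : ∀ᶠ z : PontryaginBundle E M in 𝓝 z₀, z.proj ∈ e.source :=
    hp.continuousAt (e.open_source.mem_nhds hz₀)
  filter_upwards [hb, hb'] with z hz hz'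
  refine Prod.ext rfl (Prod.ext ?_ ?_)
  · simp only [Function.comp_apply, id, pontryagin_trivializationAt_apply hz,
      ContinuousLinearMap.comp_apply]
    exact congrArg (chartDiff e z.proj) (fiberTrivSymm_fiberTriv hz z.2.1).symm
  · ext ξ
    simp only [Function.comp_apply, id, pontryagin_trivializationAt_apply hz,
      ContinuousLinearMap.comp_apply, pontryaginCoord, inverse_chartDiff he hz']
    exact congrArg (z.2.2 : E →L[ℝ] ℝ)
      (fiberTrivSymm_fiberTriv hz (chartSymmDiff e (e z.proj) ξ)).symm

theorem contMDiffOn_pontryaginOfCoord (he : e ∈ IsManifold.maximalAtlas 𝓘(ℝ, E) ∞ M) :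
    ContMDiffOn 𝓘(ℝ, E × E × (E →L[ℝ] ℝ)) (𝓘(ℝ, E).prod 𝓘(ℝ, E × (E →L[ℝ] ℝ))) 1
      (pontryaginOfCoord e) ((fun c : E × E × (E →L[ℝ] ℝ) => c.1) ⁻¹' e.target) := by
  intro c₀ hc₀
  refine ContMDiffAt.contMDiffWithinAt ?_
  have hp : ContMDiffAt 𝓘(ℝ, E × E × (E →L[ℝ] ℝ)) 𝓘(ℝ, E) 1
      (fun c : E × E × (E →L[ℝ] ℝ) => c.1) c₀ := contDiff_fst.contDiffAt.contMDiffAt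
  have hp2 : ContMDiffAt 𝓘(ℝ, E × E × (E →L[ℝ] ℝ)) 𝓘(ℝ, E) 1
      (fun c : E × E × (E →L[ℝ] ℝ) => c.2.1) c₀ :=
    (contDiff_fst.comp contDiff_snd).contDiffAt.contMDiffAt
  have hp3 : ContMDiffAt 𝓘(ℝ, E × E × (E →L[ℝ] ℝ)) 𝓘(ℝ, E →L[ℝ] ℝ) 1
      (fun c : E × E × (E →L[ℝ] ℝ) => c.2.2) c₀ :=
    (contDiff_snd.comp contDiff_snd).contDiffAt.contMDiffAt
  have h1 := ((contMDiffAt_symm_of_mem_maximalAtlas he hc₀).of_le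
    (by simp : (1 : WithTop ℕ∞) ≤ ∞)).comp c₀ hp
  have h2 := (contMDiffAt_chartSymmDiff he hc₀).comp c₀ hp
  have h2' := (contMDiffAt_chartDiff_comp_symm he hc₀).comp c₀ hp
  refine contMDiffAt_totalSpace.2 ⟨h1,
    ((h2.clm_apply hp2).prodMk_space (hp3.clm_comp h2')).congr_of_eventuallyEq ?_⟩
  have hb : ∀ᶠ c : E × E × (E →L[ℝ] ℝ) in 𝓝 c₀, e.symm c.1 ∈ (chartAt E (e.symm c₀.1)).source :=
    h1.continuousAt ((chartAt E _).open_source.mem_nhds (mem_chart_source E _))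
  filter_upwards [hb] with c hc
  exact pontryagin_trivializationAt_apply (z := pontryaginOfCoord e c) hc

end Coordinates

/-! ### The first variation of the action -/

section FirstVariation

open scoped ContDiff

variable {E : Type*} [NormedAddCommGroup E] [NormedSpace ℝ E]
  {M : Type*} [TopologicalSpace M] [ChartedSpace E M]
  {F : Type*} [NormedAddCommGroup F] [InnerProductSpace ℝ F]
  {e : OpenPartialHomeomorph M E} {a b : ℝ} {q₁ q₂ : M}
  {L : TangentBundle 𝓘(ℝ, E) M → ℝ} {N : M → F}

theorem localMom_apply_chartDiff (he : e ∈ IsManifold.maximalAtlas 𝓘(ℝ, E) ∞ M)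
    {z : ℝ → PontryaginBundle E M} {t : ℝ} (ht : (z t).proj ∈ e.source) (ξ : E) :
    localMom e z t (chartDiff e (z t).proj ξ) = (z t).2.2 ξ := by
  change ((z t).2.2 : E →L[ℝ] ℝ) ((chartDiff e (z t).proj).inverse (chartDiff e (z t).proj ξ)) = _
  rw [inverse_chartDiff he ht, chartSymmDiff_chartDiff he ht]

theorem contDiffOn_comp_chart_symm {k : WithTop ℕ∞} (hk : k ≤ ∞)
    (he : e ∈ IsManifold.maximalAtlas 𝓘(ℝ, E) ∞ M)
    (hN : ContMDiff 𝓘(ℝ, E) 𝓘(ℝ, F) k N) : ContDiffOn ℝ k (fun x => N (e.symm x)) e.target :=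
  (hN.comp_contMDiffOn ((contMDiffOn_symm_of_mem_maximalAtlas he).of_le hk)).contDiffOn

theorem lagrangian_eq_localLagrangian (he : e ∈ IsManifold.maximalAtlas 𝓘(ℝ, E) ∞ M)
    {z : ℝ → PontryaginBundle E M} {t : ℝ} (hte : (z t).proj ∈ e.source) :
    L ⟨(z t).proj, (z t).2.1⟩ = localLagrangian L e (localPos e z t) (localVel e z t) :=
  congrArg L (tangentOfCoord_tangentCoord he (z := ⟨(z t).proj, (z t).2.1⟩) hte).symm

theorem fderiv_apply_prod {E₁ E₂ G : Type*} [NormedAddCommGroup E₁] [NormedSpace ℝ E₁]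
    [NormedAddCommGroup E₂] [NormedSpace ℝ E₂] [NormedAddCommGroup G] [NormedSpace ℝ G]
    {Φ : E₁ × E₂ → G} {x : E₁} {u : E₂} (h : DifferentiableAt ℝ Φ (x, u)) (ξ : E₁) (η : E₂) :
    fderiv ℝ Φ (x, u) (ξ, η) =
      fderiv ℝ (fun x => Φ (x, u)) x ξ + fderiv ℝ (fun u => Φ (x, u)) u η := by
  have h1 : HasFDerivAt (fun x => Φ (x, u)) _ x :=
    h.hasFDerivAt.comp x (hasFDerivAt_prodMk_left x u)
  have h2 : HasFDerivAt (fun u => Φ (x, u)) _ u :=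
    h.hasFDerivAt.comp u (hasFDerivAt_prodMk_right x u)
  rw [h1.fderiv, h2.fderiv]
  simp [← map_add]

/-- The velocity `dq/dt` of the base curve of `z`, in the coordinates induced by the chart `e`. -/
noncomputable def localVelocity (e : OpenPartialHomeomorph M E) (a b : ℝ)
    (z : ℝ → PontryaginBundle E M) (t : ℝ) : E :=
  chartDiff e (z t).proj (velocity a b (fun r => (z r).proj) t : E)

theorem pairing_eq_local (he : e ∈ IsManifold.maximalAtlas 𝓘(ℝ, E) ∞ M)
    {z : ℝ → PontryaginBundle E M} {t : ℝ} (hte : (z t).proj ∈ e.source) :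
    (z t).2.2 (velocity a b (fun r => (z r).proj) t - (z t).2.1) =
      localMom e z t (localVelocity e a b z t - localVel e z t) := by
  have h : localVelocity e a b z t - localVel e z t = chartDiff e (z t).proj
      (velocity a b (fun r => (z r).proj) t - (z t).2.1 : E) := (map_sub _ _ _).symm
  rw [h, localMom_apply_chartDiff he hte]
  rfl

variable [IsManifold 𝓘(ℝ, E) ∞ M]

/-- The action `∫ L(q, v) dt + ∫ ⟨p, dq/dt - v⟩ dt + ∫ ⟨μ, d/dt N(q)⟩ dt`. With `N = (γ, g)` and
`μ = (-w, ℓ)` it differs from the augmented action by boundary terms. -/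
noncomputable def pairedAction (L : TangentBundle 𝓘(ℝ, E) M → ℝ) (N : M → F) (a b : ℝ)
    (z : ℝ → PontryaginBundle E M) (μ : ℝ → F) : ℝ :=
  (∫ t in a..b, L ⟨(z t).proj, (z t).2.1⟩)
    + (∫ t in a..b, (z t).2.2 (velocity a b (fun r => (z r).proj) t - (z t).2.1))
    + ∫ t in a..b, inner ℝ (μ t) (derivWithin (fun r => N (z r).proj) (Icc a b) t)

theorem IsPath.hasMFDerivWithinAt {z : ℝ → PontryaginBundle E M} (hz : IsPath a b q₁ q₂ z)
    {t : ℝ} (ht : t ∈ Icc a b) :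
    HasMFDerivWithinAt 𝓘(ℝ, ℝ) 𝓘(ℝ, E) (fun r => (z r).proj) (Icc a b) t
      (mfderivWithin 𝓘(ℝ, ℝ) 𝓘(ℝ, E) (fun r => (z r).proj) (Icc a b) t) :=
  ((hz.contMDiffOn t ht).mdifferentiableWithinAt one_ne_zero).hasMFDerivWithinAt

theorem IsPath.hasDerivWithinAt_localPos (he : e ∈ IsManifold.maximalAtlas 𝓘(ℝ, E) ∞ M)
    {z : ℝ → PontryaginBundle E M} (hz : IsPath a b q₁ q₂ z) {t : ℝ} (ht : t ∈ Icc a b)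
    (hte : (z t).proj ∈ e.source) :
    HasDerivWithinAt (localPos e z) (localVelocity e a b z t) (Icc a b) t := by
  have h1 := ((mdifferentiable_of_mem_maximalAtlas he).mdifferentiableAt hte).hasMFDerivAt
  have h2 := h1.comp_hasMFDerivWithinAt t (hz.hasMFDerivWithinAt ht)
  have h3 : HasFDerivWithinAt (localPos e z) ((chartDiff e (z t).proj).comp
      (mfderivWithin 𝓘(ℝ, ℝ) 𝓘(ℝ, E) (fun r => (z r).proj) (Icc a b) t : ℝ →L[ℝ] E))
      (Icc a b) t := hasMFDerivWithinAt_iff_hasFDerivWithinAt.1 h2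
  exact h3.hasDerivWithinAt

theorem contDiffOn_localLagrangian (he : e ∈ IsManifold.maximalAtlas 𝓘(ℝ, E) ∞ M)
    (hL : ContMDiff 𝓘(ℝ, E).tangent 𝓘(ℝ, ℝ) 1 L) :
    ContDiffOn ℝ 1 (fun c : E × E => localLagrangian L e c.1 c.2) (Prod.fst ⁻¹' e.target) :=
  (hL.comp_contMDiffOn (contMDiffOn_tangentOfCoord he)).contDiffOn

theorem IsPath.hasDerivWithinAt_comp (he : e ∈ IsManifold.maximalAtlas 𝓘(ℝ, E) ∞ M)
    (hN : ContMDiff 𝓘(ℝ, E) 𝓘(ℝ, F) 1 N) {z : ℝ → PontryaginBundle E M}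
    (hz : IsPath a b q₁ q₂ z) {t : ℝ} (ht : t ∈ Icc a b) (hte : (z t).proj ∈ e.source) :
    HasDerivWithinAt (fun r => N (z r).proj)
      (fderiv ℝ (fun x => N (e.symm x)) (localPos e z t) (localVelocity e a b z t))
      (Icc a b) t := by
  have hd : DifferentiableAt ℝ (fun x => N (e.symm x)) (localPos e z t) :=
    ((contDiffOn_comp_chart_symm (by simp) he hN).contDiffAt
      (e.open_target.mem_nhds (e.map_source hte))).differentiableAt one_ne_zero
  have h := hd.hasFDerivAt.comp_hasDerivWithinAt t (hz.hasDerivWithinAt_localPos he ht hte)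
  have hq : ContinuousWithinAt (fun r => (z r).proj) (Icc a b) t :=
    (hz.contMDiffOn t ht).continuousWithinAt
  refine h.congr_of_eventuallyEq ?_ ?_
  · filter_upwards [hq (e.open_source.mem_nhds hte)] with r hr
    exact congrArg N (e.left_inv hr).symm
  · exact congrArg N (e.left_inv hte).symm

theorem IsPath.derivWithin_comp (hab : a < b) (he : e ∈ IsManifold.maximalAtlas 𝓘(ℝ, E) ∞ M)
    (hN : ContMDiff 𝓘(ℝ, E) 𝓘(ℝ, F) 1 N) {z : ℝ → PontryaginBundle E M}
    (hz : IsPath a b q₁ q₂ z) {t : ℝ} (ht : t ∈ Icc a b) (hte : (z t).proj ∈ e.source) :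
    derivWithin (fun r => N (z r).proj) (Icc a b) t =
      fderiv ℝ (fun x => N (e.symm x)) (localPos e z t) (localVelocity e a b z t) :=
  (hz.hasDerivWithinAt_comp he hN ht hte).derivWithin (uniqueDiffOn_Icc hab t ht)

variable {z : ℝ → PontryaginBundle E M} {δ : ℝ} {Z : ℝ → ℝ → PontryaginBundle E M}

/-- The pairs `(ε, t)` in the domain of a variation at which the base point lies in the chart
`e`. -/
def chartDomain (δ a b : ℝ) (Z : ℝ → ℝ → PontryaginBundle E M) (e : OpenPartialHomeomorph M E) :
    Set (ℝ × ℝ) :=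
  (Ioo (-δ) δ ×ˢ Icc a b) ∩ (fun x : ℝ × ℝ => (Z x.1 x.2).proj) ⁻¹' e.source

theorem IsVariation.mc1FamilyOn (h : IsVariation a b q₁ q₂ z δ Z) :
    MC1FamilyOn (𝓘(ℝ, E).prod 𝓘(ℝ, E × (E →L[ℝ] ℝ))) (Ioo (-δ) δ ×ˢ Icc a b) Z :=
  isC1Family_iff.1 h.isC1Family

theorem IsVariation.continuousOn_proj (h : IsVariation a b q₁ q₂ z δ Z) :
    ContinuousOn (fun x : ℝ × ℝ => (Z x.1 x.2).proj) (Ioo (-δ) δ ×ˢ Icc a b) :=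
  (FiberBundle.continuous_proj _ _).comp_continuousOn h.mc1FamilyOn.continuousOn

theorem IsVariation.isParamOpen_chartDomain (h : IsVariation a b q₁ q₂ z δ Z) :
    IsParamOpen (chartDomain δ a b Z e) :=
  (isParamOpen_prod δ _).inter_preimage h.continuousOn_proj e.open_source

theorem IsVariation.chartDomain_mem_nhdsWithin (h : IsVariation a b q₁ q₂ z δ Z) {x : ℝ × ℝ}
    (hx : x ∈ chartDomain δ a b Z e) :
    chartDomain δ a b Z e ∈ 𝓝[Ioo (-δ) δ ×ˢ Icc a b] x :=
  inter_mem self_mem_nhdsWithin (h.continuousOn_proj x hx.1 (e.open_source.mem_nhds hx.2))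

theorem IsVariation.c1FamilyOn_coord (he : e ∈ IsManifold.maximalAtlas 𝓘(ℝ, E) ∞ M)
    (h : IsVariation a b q₁ q₂ z δ Z) :
    C1FamilyOn (chartDomain δ a b Z e) (fun ε t => pontryaginCoord e (Z ε t)) :=
  mc1FamilyOn_iff_c1FamilyOn.1 <| (h.mc1FamilyOn.mono inter_subset_left).comp
    (e.open_source.preimage (FiberBundle.continuous_proj _ _)) (contMDiffOn_pontryaginCoord he)
    fun _ hx => hx.2

theorem IsVariation.c1FamilyOn_localPos (he : e ∈ IsManifold.maximalAtlas 𝓘(ℝ, E) ∞ M)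
    (h : IsVariation a b q₁ q₂ z δ Z) :
    C1FamilyOn (chartDomain δ a b Z e) (fun ε => localPos e (Z ε)) :=
  (h.c1FamilyOn_coord he).comp_contDiff (Φ := fun c => c.1) contDiff_fst

theorem IsVariation.c1FamilyOn_localVel (he : e ∈ IsManifold.maximalAtlas 𝓘(ℝ, E) ∞ M)
    (h : IsVariation a b q₁ q₂ z δ Z) :
    C1FamilyOn (chartDomain δ a b Z e) (fun ε => localVel e (Z ε)) :=
  (h.c1FamilyOn_coord he).comp_contDiff (Φ := fun c => c.2.1) (contDiff_fst.comp contDiff_snd)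

theorem IsVariation.c1FamilyOn_localMom (he : e ∈ IsManifold.maximalAtlas 𝓘(ℝ, E) ∞ M)
    (h : IsVariation a b q₁ q₂ z δ Z) :
    C1FamilyOn (chartDomain δ a b Z e) (fun ε => localMom e (Z ε)) :=
  (h.c1FamilyOn_coord he).comp_contDiff (Φ := fun c => c.2.2) (contDiff_snd.comp contDiff_snd)

theorem IsVariation.c1FamilyOn_localVelocity (he : e ∈ IsManifold.maximalAtlas 𝓘(ℝ, E) ∞ M)
    (h : IsVariation a b q₁ q₂ z δ Z) :
    C1FamilyOn (chartDomain δ a b Z e) (fun ε => localVelocity e a b (Z ε)) := by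
  have h1 := mc1FamilyOn_iff_c1FamilyOn.1 <|
    ((isC1Family_iff.1 h.isC1Family_velocity).mono (inter_subset_left (t :=
      (fun x : ℝ × ℝ => (Z x.1 x.2).proj) ⁻¹' e.source))).comp
      (e.open_source.preimage (FiberBundle.continuous_proj _ _)) (contMDiffOn_tangentCoord he)
      fun _ hx => hx.2
  exact h1.comp_contDiff (Φ := fun c => c.2) contDiff_snd

theorem c1FamilyOn_lagrangian_chart (hL : ContMDiff 𝓘(ℝ, E).tangent 𝓘(ℝ, ℝ) 1 L)
    (he : e ∈ IsManifold.maximalAtlas 𝓘(ℝ, E) ∞ M) (h : IsVariation a b q₁ q₂ z δ Z) :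
    C1FamilyOn (chartDomain δ a b Z e) (fun ε t => L ⟨(Z ε t).proj, (Z ε t).2.1⟩) := by
  have h1 := ((h.c1FamilyOn_localPos he).prodMk (h.c1FamilyOn_localVel he)).comp
    (e.open_target.preimage continuous_fst) (contDiffOn_localLagrangian he hL)
    fun _ hx => e.map_source hx.2
  exact h1.congr h.isParamOpen_chartDomain fun x hx => lagrangian_eq_localLagrangian he hx.2

theorem c1FamilyOn_pairing_chart
    (he : e ∈ IsManifold.maximalAtlas 𝓘(ℝ, E) ∞ M) (h : IsVariation a b q₁ q₂ z δ Z) :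
    C1FamilyOn (chartDomain δ a b Z e) (fun ε t =>
      ((Z ε t).2.2 (velocity a b (fun r => (Z ε r).proj) t - (Z ε t).2.1) : ℝ)) := by
  have h1 := ((h.c1FamilyOn_localMom he).prodMk
    ((h.c1FamilyOn_localVelocity he).prodMk (h.c1FamilyOn_localVel he))).comp_contDiff
    (Φ := fun c => c.1 (c.2.1 - c.2.2)) (by fun_prop)
  exact h1.congr h.isParamOpen_chartDomain fun x hx => pairing_eq_local he hx.2

theorem c1FamilyOn_constraint_chart (hab : a < b) (hN : ContMDiff 𝓘(ℝ, E) 𝓘(ℝ, F) 2 N)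
    (he : e ∈ IsManifold.maximalAtlas 𝓘(ℝ, E) ∞ M) (h : IsVariation a b q₁ q₂ z δ Z)
    {μ : ℝ → ℝ → F} (hμ : C1FamilyOn (Ioo (-δ) δ ×ˢ Icc a b) μ) :
    C1FamilyOn (chartDomain δ a b Z e) (fun ε t =>
      (inner ℝ (μ ε t) (derivWithin (fun r => N (Z ε r).proj) (Icc a b) t) : ℝ)) := by
  have hN2 := contDiffOn_comp_chart_symm (k := 2) ENat.LEInfty.out he hN
  have h1 := ((h.c1FamilyOn_localPos he).comp e.open_target
    (hN2.fderiv_of_isOpen e.open_target one_add_one_eq_two.le) fun x hx => e.map_source hx.2)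
  have h2 := ((hμ.mono inter_subset_left).prodMk
    (h1.prodMk (h.c1FamilyOn_localVelocity he))).comp_contDiff
    (Φ := fun c => (inner ℝ c.1 (c.2.1 c.2.2) : ℝ))
    (contDiff_fst.inner ℝ ((contDiff_fst.comp contDiff_snd).clm_apply
      (contDiff_snd.comp contDiff_snd)))
  refine h2.congr h.isParamOpen_chartDomain fun x hx => ?_
  rw [(h.isPath x.1 hx.1.1).derivWithin_comp hab he (hN.of_le one_le_two) hx.1.2 hx.2]

/-- To be a `C¹` family along a variation can be checked in charts. -/
theorem IsVariation.c1FamilyOn_of_chart {V : Type*} [NormedAddCommGroup V] [NormedSpace ℝ V]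
    (h : IsVariation a b q₁ q₂ z δ Z) {f : ℝ → ℝ → V}
    (hf : ∀ e ∈ IsManifold.maximalAtlas 𝓘(ℝ, E) ∞ M, C1FamilyOn (chartDomain δ a b Z e) f) :
    C1FamilyOn (Ioo (-δ) δ ×ˢ Icc a b) f := by
  refine C1FamilyOn.of_local fun x hx => ?_
  have hx' : x ∈ chartDomain δ a b Z (chartAt E (Z x.1 x.2).proj) :=
    ⟨hx, mem_chart_source E _⟩
  exact ⟨_, h.chartDomain_mem_nhdsWithin hx', hx',
    hf _ (IsManifold.chart_mem_maximalAtlas _)⟩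

/-- The integrand of the first variation of the action along a variation `Z`, `μ`. -/
noncomputable def firstVariation (L : TangentBundle 𝓘(ℝ, E) M → ℝ) (N : M → F) (a b : ℝ)
    (Z : ℝ → ℝ → PontryaginBundle E M) (μ : ℝ → ℝ → F) (t : ℝ) : ℝ :=
  deriv (fun ε => L ⟨(Z ε t).proj, (Z ε t).2.1⟩) 0
    + deriv (fun ε => ((Z ε t).2.2 (velocity a b (fun r => (Z ε r).proj) t - (Z ε t).2.1) : ℝ)) 0
    + deriv (fun ε => (inner ℝ (μ ε t) (derivWithin (fun r => N (Z ε r).proj) (Icc a b) t) : ℝ)) 0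

/-- The derivative of the action along a variation is the integral of the first variation, whose
integrand is continuous. -/
theorem hasDerivAt_pairedAction (hab : a < b) (hL : ContMDiff 𝓘(ℝ, E).tangent 𝓘(ℝ, ℝ) 1 L)
    (hN : ContMDiff 𝓘(ℝ, E) 𝓘(ℝ, F) 2 N) (h : IsVariation a b q₁ q₂ z δ Z)
    {μ : ℝ → ℝ → F} (hμ : C1FamilyOn (Ioo (-δ) δ ×ˢ Icc a b) μ) :
    ContinuousOn (firstVariation L N a b Z μ) (Icc a b) ∧
    HasDerivAt (fun ε => pairedAction L N a b (Z ε) (μ ε))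
      (∫ t in a..b, firstVariation L N a b Z μ t) 0 := by
  have h1 := h.c1FamilyOn_of_chart fun e he => c1FamilyOn_lagrangian_chart hL he h
  have h2 := h.c1FamilyOn_of_chart fun e he => c1FamilyOn_pairing_chart he h
  have h3 := h.c1FamilyOn_of_chart fun e he => c1FamilyOn_constraint_chart hab hN he h hμ
  have c1 := (h1.continuousOn_zero h.pos).2
  have c2 := (h2.continuousOn_zero h.pos).2
  have c3 := (h3.continuousOn_zero h.pos).2
  refine ⟨(c1.fun_add c2).fun_add c3, ?_⟩
  have ii : ∀ {u : ℝ → ℝ}, ContinuousOn u (Icc a b) → IntervalIntegrable u volume a b :=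
    fun hu => ContinuousOn.intervalIntegrable (by rwa [uIcc_of_le hab.le])
  have key : ∫ t in a..b, firstVariation L N a b Z μ t = _ :=
    (intervalIntegral.integral_add ((ii c1).add (ii c2)) (ii c3)).trans
      (congrArg (· + _) (intervalIntegral.integral_add (ii c1) (ii c2)))
  rw [key]
  exact ((h1.hasDerivAt_integral h.pos le_rfl hab.le le_rfl).add
    (h2.hasDerivAt_integral h.pos le_rfl hab.le le_rfl)).add
    (h3.hasDerivAt_integral h.pos le_rfl hab.le le_rfl)

theorem deriv_lagrangian (hL : ContMDiff 𝓘(ℝ, E).tangent 𝓘(ℝ, ℝ) 1 L)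
    (he : e ∈ IsManifold.maximalAtlas 𝓘(ℝ, E) ∞ M)
    (h : IsVariation a b q₁ q₂ z δ Z) {t : ℝ} (h0 : ((0 : ℝ), t) ∈ chartDomain δ a b Z e)
    {x' u' : E} (hx' : HasDerivAt (fun ε => localPos e (Z ε) t) x' 0)
    (hu' : HasDerivAt (fun ε => localVel e (Z ε) t) u' 0) :
    deriv (fun ε => L ⟨(Z ε t).proj, (Z ε t).2.1⟩) 0 =
      fderiv ℝ (fun x => localLagrangian L e x (localVel e (Z 0) t)) (localPos e (Z 0) t) x'
      + fderiv ℝ (fun u => localLagrangian L e (localPos e (Z 0) t) u) (localVel e (Z 0) t) u' := by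
  have hLd : DifferentiableAt ℝ (fun c : E × E => localLagrangian L e c.1 c.2)
      (localPos e (Z 0) t, localVel e (Z 0) t) :=
    ((contDiffOn_localLagrangian he hL).contDiffAt ((e.open_target.preimage
      continuous_fst).mem_nhds (e.map_source h0.2))).differentiableAt one_ne_zero
  have v1 : (fun ε => L ⟨(Z ε t).proj, (Z ε t).2.1⟩) =ᶠ[𝓝 0]
      fun ε => localLagrangian L e (localPos e (Z ε) t) (localVel e (Z ε) t) := by
    filter_upwards [h.isParamOpen_chartDomain (e := e) _ h0] with ε hε
      using lagrangian_eq_localLagrangian he hε.2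
  rw [← fderiv_apply_prod hLd]
  exact (HasDerivAt.congr_of_eventuallyEq
    (hLd.hasFDerivAt.comp_hasDerivAt (0 : ℝ) (hx'.prodMk hu')) v1).deriv

theorem deriv_pairing
    (he : e ∈ IsManifold.maximalAtlas 𝓘(ℝ, E) ∞ M)
    (h : IsVariation a b q₁ q₂ z δ Z) {t : ℝ} (h0 : ((0 : ℝ), t) ∈ chartDomain δ a b Z e)
    {u' y' : E} {p' : E →L[ℝ] ℝ}
    (hu' : HasDerivAt (fun ε => localVel e (Z ε) t) u' 0)
    (hp' : HasDerivAt (fun ε => localMom e (Z ε) t) p' 0)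
    (hy' : HasDerivAt (fun ε => localVelocity e a b (Z ε) t) y' 0) :
    deriv (fun ε =>
        ((Z ε t).2.2 (velocity a b (fun r => (Z ε r).proj) t - (Z ε t).2.1) : ℝ)) 0 =
      p' (localVelocity e a b (Z 0) t - localVel e (Z 0) t) + localMom e (Z 0) t (y' - u') := by
  have v2 : (fun ε =>
      ((Z ε t).2.2 (velocity a b (fun r => (Z ε r).proj) t - (Z ε t).2.1) : ℝ)) =ᶠ[𝓝 0]
      fun ε => localMom e (Z ε) t (localVelocity e a b (Z ε) t - localVel e (Z ε) t) := by
    filter_upwards [h.isParamOpen_chartDomain (e := e) _ h0] with ε hε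
      using pairing_eq_local he hε.2
  exact (HasDerivAt.congr_of_eventuallyEq (hp'.clm_apply (hy'.fun_sub hu')) v2).deriv

theorem deriv_constraint (hab : a < b)
    (hN : ContMDiff 𝓘(ℝ, E) 𝓘(ℝ, F) 2 N) (he : e ∈ IsManifold.maximalAtlas 𝓘(ℝ, E) ∞ M)
    (h : IsVariation a b q₁ q₂ z δ Z)
    {μ : ℝ → ℝ → F} {t : ℝ} (h0 : ((0 : ℝ), t) ∈ chartDomain δ a b Z e) {x' y' : E} {μ' : F}
    (hx' : HasDerivAt (fun ε => localPos e (Z ε) t) x' 0)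
    (hy' : HasDerivAt (fun ε => localVelocity e a b (Z ε) t) y' 0)
    (hμ' : HasDerivAt (fun ε => μ ε t) μ' 0) :
    deriv (fun ε => (inner ℝ (μ ε t) (derivWithin (fun r => N (Z ε r).proj) (Icc a b) t) : ℝ)) 0 =
      inner ℝ (μ 0 t) (fderiv ℝ (fderiv ℝ (fun x => N (e.symm x))) (localPos e (Z 0) t) x'
            (localVelocity e a b (Z 0) t)
          + fderiv ℝ (fun x => N (e.symm x)) (localPos e (Z 0) t) y')
      + inner ℝ μ' (fderiv ℝ (fun x => N (e.symm x)) (localPos e (Z 0) t)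
          (localVelocity e a b (Z 0) t)) := by
  have hN2 := (contDiffOn_comp_chart_symm (k := 2) ENat.LEInfty.out he hN).fderiv_of_isOpen
    e.open_target one_add_one_eq_two.le
  have hNd := ((hN2.contDiffAt (e.open_target.mem_nhds (e.map_source h0.2))).differentiableAt
    one_ne_zero).hasFDerivAt
  have v3 : (fun ε =>
      (inner ℝ (μ ε t) (derivWithin (fun r => N (Z ε r).proj) (Icc a b) t) : ℝ)) =ᶠ[𝓝 0]
      fun ε => inner ℝ (μ ε t) (fderiv ℝ (fun x => N (e.symm x)) (localPos e (Z ε) t)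
        (localVelocity e a b (Z ε) t)) := by
    filter_upwards [h.isParamOpen_chartDomain (e := e) _ h0] with ε hε
    rw [(h.isPath ε hε.1.1).derivWithin_comp hab he (hN.of_le one_le_two) hε.1.2 hε.2]
  have h1 : HasDerivAt (fun ε => fderiv ℝ (fun x => N (e.symm x)) (localPos e (Z ε) t)) _ 0 :=
    hNd.comp_hasDerivAt (0 : ℝ) hx'
  exact (HasDerivAt.congr_of_eventuallyEq (hμ'.inner ℝ (h1.clm_apply hy')) v3).deriv

/-- The first variation in the coordinates induced by a chart. -/
theorem firstVariation_eq (hab : a < b) (hL : ContMDiff 𝓘(ℝ, E).tangent 𝓘(ℝ, ℝ) 1 L)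
    (hN : ContMDiff 𝓘(ℝ, E) 𝓘(ℝ, F) 2 N) (he : e ∈ IsManifold.maximalAtlas 𝓘(ℝ, E) ∞ M)
    (h : IsVariation a b q₁ q₂ z δ Z)
    {μ : ℝ → ℝ → F} {t : ℝ} (ht : t ∈ Icc a b)
    (hte : (Z 0 t).proj ∈ e.source) {x' u' y' : E} {p' : E →L[ℝ] ℝ} {μ' : F}
    (hx' : HasDerivAt (fun ε => localPos e (Z ε) t) x' 0)
    (hu' : HasDerivAt (fun ε => localVel e (Z ε) t) u' 0)
    (hp' : HasDerivAt (fun ε => localMom e (Z ε) t) p' 0)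
    (hy' : HasDerivAt (fun ε => localVelocity e a b (Z ε) t) y' 0)
    (hμ' : HasDerivAt (fun ε => μ ε t) μ' 0) :
    firstVariation L N a b Z μ t =
      (fderiv ℝ (fun x => localLagrangian L e x (localVel e (Z 0) t)) (localPos e (Z 0) t) x'
      + fderiv ℝ (fun u => localLagrangian L e (localPos e (Z 0) t) u) (localVel e (Z 0) t) u')
      + (p' (localVelocity e a b (Z 0) t - localVel e (Z 0) t)
        + localMom e (Z 0) t (y' - u'))
      + (inner ℝ (μ 0 t) (fderiv ℝ (fderiv ℝ (fun x => N (e.symm x))) (localPos e (Z 0) t) x'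
            (localVelocity e a b (Z 0) t)
          + fderiv ℝ (fun x => N (e.symm x)) (localPos e (Z 0) t) y')
        + inner ℝ μ' (fderiv ℝ (fun x => N (e.symm x)) (localPos e (Z 0) t)
          (localVelocity e a b (Z 0) t))) := by
  have h0 : ((0 : ℝ), t) ∈ chartDomain δ a b Z e := ⟨⟨⟨by linarith [h.pos], h.pos⟩, ht⟩, hte⟩
  rw [firstVariation, deriv_lagrangian hL he h h0 hx' hu', deriv_pairing he h h0 hu' hp' hy',
    deriv_constraint hab hN he h h0 hx' hy' hμ']

end FirstVariation

/-! ### The momentum balance implies criticality -/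

section Sufficiency

open scoped ContDiff

variable {E : Type*} [NormedAddCommGroup E] [NormedSpace ℝ E]
  {M : Type*} [TopologicalSpace M] [ChartedSpace E M]
  {F : Type*} [NormedAddCommGroup F] [InnerProductSpace ℝ F]
  {e : OpenPartialHomeomorph M E} {a b : ℝ} {q₁ q₂ : M}
  {L : TangentBundle 𝓘(ℝ, E) M → ℝ} {N : M → F} {z : ℝ → PontryaginBundle E M} {μ : ℝ → F}

/-- The covector `p + ⟨μ, ∂N/∂q⟩` in the coordinates induced by the chart `e`. -/
noncomputable def totalMomentum (e : OpenPartialHomeomorph M E) (N : M → F)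
    (z : ℝ → PontryaginBundle E M) (μ : ℝ → F) (t : ℝ) : E →L[ℝ] ℝ :=
  localMom e z t + (innerSL ℝ (μ t)).comp (fderiv ℝ (fun x => N (e.symm x)) (localPos e z t))

/-- The covector `∂L/∂q + ⟨μ, ∂²N/∂q² dq/dt⟩` in the coordinates induced by the chart `e`. -/
noncomputable def totalForce (e : OpenPartialHomeomorph M E) (L : TangentBundle 𝓘(ℝ, E) M → ℝ)
    (N : M → F) (a b : ℝ) (z : ℝ → PontryaginBundle E M) (μ : ℝ → F) (t : ℝ) : E →L[ℝ] ℝ :=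
  fderiv ℝ (fun x => localLagrangian L e x (localVel e z t)) (localPos e z t)
    + (innerSL ℝ (μ t)).comp
      (fderiv ℝ (fderiv ℝ (fun x => N (e.symm x))) (localPos e z t) (localVelocity e a b z t))

/-- The momentum equation on `[s, t]` in the chart `e`, in the form
`d(p + ⟨μ, ∂N/∂q⟩) = (∂L/∂q + ⟨μ, ∂²N/∂q² dq/dt⟩) dt` free of stochastic integrals. -/
def MomentumBalance (e : OpenPartialHomeomorph M E) (L : TangentBundle 𝓘(ℝ, E) M → ℝ)
    (N : M → F) (a b : ℝ) (z : ℝ → PontryaginBundle E M) (μ : ℝ → F) (s t : ℝ) : Prop :=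
  ∀ ξ : E, totalMomentum e N z μ t ξ - totalMomentum e N z μ s ξ =
    ∫ τ in s..t, totalForce e L N a b z μ τ ξ

/-- The times at which the base curve of `z` lies in the chart `e`. -/
def chartTimes (a b : ℝ) (z : ℝ → PontryaginBundle E M) (e : OpenPartialHomeomorph M E) : Set ℝ :=
  Icc a b ∩ {t | (z t).proj ∈ e.source}

theorem localPos_congr {z' : ℝ → PontryaginBundle E M} {t : ℝ} (h : z' t = z t) :
    localPos e z' t = localPos e z t := congrArg (fun c => (pontryaginCoord e c).1) h

theorem localVel_congr {z' : ℝ → PontryaginBundle E M} {t : ℝ} (h : z' t = z t) :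
    localVel e z' t = localVel e z t := congrArg (fun c => (pontryaginCoord e c).2.1) h

theorem localMom_congr {z' : ℝ → PontryaginBundle E M} {t : ℝ} (h : z' t = z t) :
    localMom e z' t = localMom e z t := congrArg (fun c => (pontryaginCoord e c).2.2) h

theorem localVelocity_congr {z' : ℝ → PontryaginBundle E M} (h : ∀ t ∈ Icc a b, z' t = z t)
    {t : ℝ} (ht : t ∈ Icc a b) : localVelocity e a b z' t = localVelocity e a b z t := by
  have h1 : (mfderivWithin 𝓘(ℝ, ℝ) 𝓘(ℝ, E) (fun r => (z' r).proj) (Icc a b) t : ℝ →L[ℝ] E) =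
      mfderivWithin 𝓘(ℝ, ℝ) 𝓘(ℝ, E) (fun r => (z r).proj) (Icc a b) t :=
    mfderivWithin_congr (fun r hr => congrArg (·.proj) (h r hr)) (congrArg (·.proj) (h t ht))
  have h2 : (z' t).proj = (z t).proj := congrArg (·.proj) (h t ht)
  have h3 := DFunLike.congr_fun h1 (1 : ℝ)
  change chartDiff e (z' t).proj _ = chartDiff e (z t).proj _
  rw [h2]
  exact congrArg (chartDiff e (z t).proj) h3

theorem localVelocity_eq_localVel_iff (he : e ∈ IsManifold.maximalAtlas 𝓘(ℝ, E) ∞ M) {t : ℝ}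
    (ht : (z t).proj ∈ e.source) :
    localVelocity e a b z t = localVel e z t ↔
      velocity a b (fun r => (z r).proj) t = (z t).2.1 :=
  ⟨fun h => (chartSymmDiff_chartDiff he ht _).symm.trans
    ((congrArg (chartSymmDiff e (e (z t).proj)) h).trans (chartSymmDiff_chartDiff he ht _)),
    fun h => congrArg (chartDiff e (z t).proj) h⟩

theorem totalMomentum_congr {z' : ℝ → PontryaginBundle E M} {t : ℝ} (h : z' t = z t) :
    totalMomentum e N z' μ t = totalMomentum e N z μ t := by
  simp only [totalMomentum, localMom_congr h, localPos_congr h]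

variable [IsManifold 𝓘(ℝ, E) ∞ M]

theorem IsPath.continuousOn_coord (he : e ∈ IsManifold.maximalAtlas 𝓘(ℝ, E) ∞ M)
    (hz : IsPath a b q₁ q₂ z) :
    ContinuousOn (fun t => pontryaginCoord e (z t)) (chartTimes a b z e) :=
  (contMDiffOn_pontryaginCoord he).continuousOn.comp (hz.continuousOn.mono inter_subset_left)
    fun _ ht => ht.2

theorem IsPath.continuousOn_localPos (he : e ∈ IsManifold.maximalAtlas 𝓘(ℝ, E) ∞ M)
    (hz : IsPath a b q₁ q₂ z) : ContinuousOn (localPos e z) (chartTimes a b z e) :=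
  continuous_fst.comp_continuousOn (hz.continuousOn_coord he)

theorem IsPath.continuousOn_localVel (he : e ∈ IsManifold.maximalAtlas 𝓘(ℝ, E) ∞ M)
    (hz : IsPath a b q₁ q₂ z) : ContinuousOn (localVel e z) (chartTimes a b z e) :=
  (continuous_fst.comp continuous_snd).comp_continuousOn (hz.continuousOn_coord he)

theorem IsPath.continuousOn_localMom (he : e ∈ IsManifold.maximalAtlas 𝓘(ℝ, E) ∞ M)
    (hz : IsPath a b q₁ q₂ z) : ContinuousOn (localMom e z) (chartTimes a b z e) :=
  (continuous_snd.comp continuous_snd).comp_continuousOn (hz.continuousOn_coord he)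

theorem continuousOn_velocity (hab : a < b) {q : ℝ → M}
    (hq : ContMDiffOn 𝓘(ℝ, ℝ) 𝓘(ℝ, E) 1 q (Icc a b)) :
    ContinuousOn (fun t => (⟨q t, velocity a b q t⟩ : TangentBundle 𝓘(ℝ, E) M)) (Icc a b) := by
  have h1 : Continuous (fun t : ℝ => (⟨t, (1 : ℝ)⟩ : TangentBundle 𝓘(ℝ, ℝ) ℝ)) :=
    (tangentBundleModelSpaceHomeomorph 𝓘(ℝ, ℝ)).symm.continuous.comp
      (Continuous.prodMk_left (1 : ℝ))
  exact (hq.continuousOn_tangentMapWithin le_rfl (uniqueDiffOn_Icc hab).uniqueMDiffOn).comp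
    h1.continuousOn fun t ht => ht

theorem IsPath.continuousOn_localVelocity (hab : a < b)
    (he : e ∈ IsManifold.maximalAtlas 𝓘(ℝ, E) ∞ M)
    (hz : IsPath a b q₁ q₂ z) : ContinuousOn (localVelocity e a b z) (chartTimes a b z e) :=
  continuous_snd.comp_continuousOn <| (contMDiffOn_tangentCoord he).continuousOn.comp
    ((continuousOn_velocity hab hz.contMDiffOn).mono inter_subset_left) fun _ ht => ht.2

theorem IsPath.continuousOn_totalMomentum (he : e ∈ IsManifold.maximalAtlas 𝓘(ℝ, E) ∞ M)
    (hN : ContMDiff 𝓘(ℝ, E) 𝓘(ℝ, F) 2 N) (hz : IsPath a b q₁ q₂ z)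
    (hμ : ContinuousOn μ (Icc a b)) :
    ContinuousOn (totalMomentum e N z μ) (chartTimes a b z e) := by
  have h1 := (contDiffOn_comp_chart_symm (k := 2) ENat.LEInfty.out he hN).fderiv_of_isOpen
    e.open_target one_add_one_eq_two.le
  exact (hz.continuousOn_localMom he).add (((innerSL ℝ).continuous.comp_continuousOn
    (hμ.mono inter_subset_left)).clm_comp (h1.continuousOn.comp (hz.continuousOn_localPos he)
      fun t ht => e.map_source ht.2))

theorem fderiv_left_eq {E₁ E₂ G : Type*} [NormedAddCommGroup E₁] [NormedSpace ℝ E₁]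
    [NormedAddCommGroup E₂] [NormedSpace ℝ E₂] [NormedAddCommGroup G] [NormedSpace ℝ G]
    {Φ : E₁ × E₂ → G} {x : E₁} {u : E₂} (h : DifferentiableAt ℝ Φ (x, u)) :
    fderiv ℝ (fun x => Φ (x, u)) x = (fderiv ℝ Φ (x, u)).comp (ContinuousLinearMap.inl ℝ E₁ E₂) :=
  HasFDerivAt.fderiv (h.hasFDerivAt.comp x (hasFDerivAt_prodMk_left x u))

theorem IsPath.continuousOn_force (he : e ∈ IsManifold.maximalAtlas 𝓘(ℝ, E) ∞ M)
    (hL : ContMDiff 𝓘(ℝ, E).tangent 𝓘(ℝ, ℝ) 1 L) (hz : IsPath a b q₁ q₂ z) :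
    ContinuousOn (fun t => fderiv ℝ (fun x => localLagrangian L e x (localVel e z t))
      (localPos e z t)) (chartTimes a b z e) := by
  have ho : IsOpen (Prod.fst ⁻¹' e.target : Set (E × E)) := e.open_target.preimage continuous_fst
  have h1 := ((contDiffOn_localLagrangian he hL).continuousOn_fderiv_of_isOpen ho le_rfl).comp
    ((hz.continuousOn_localPos he).prodMk (hz.continuousOn_localVel he))
    fun t ht => e.map_source ht.2
  refine (h1.clm_comp (continuousOn_const (c := ContinuousLinearMap.inl ℝ E E))).congr
    fun t ht => ?_
  exact fderiv_left_eq (Φ := fun c : E × E => localLagrangian L e c.1 c.2)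
    (((contDiffOn_localLagrangian he hL).contDiffAt
      (ho.mem_nhds (e.map_source ht.2))).differentiableAt one_ne_zero)

theorem fderiv_right_eq {E₁ E₂ G : Type*} [NormedAddCommGroup E₁] [NormedSpace ℝ E₁]
    [NormedAddCommGroup E₂] [NormedSpace ℝ E₂] [NormedAddCommGroup G] [NormedSpace ℝ G]
    {Φ : E₁ × E₂ → G} {x : E₁} {u : E₂} (h : DifferentiableAt ℝ Φ (x, u)) :
    fderiv ℝ (fun u => Φ (x, u)) u = (fderiv ℝ Φ (x, u)).comp (ContinuousLinearMap.inr ℝ E₁ E₂) :=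
  HasFDerivAt.fderiv (h.hasFDerivAt.comp u (hasFDerivAt_prodMk_right x u))

theorem continuousOn_fderiv_localLagrangian_right (he : e ∈ IsManifold.maximalAtlas 𝓘(ℝ, E) ∞ M)
    (hL : ContMDiff 𝓘(ℝ, E).tangent 𝓘(ℝ, ℝ) 1 L) {x u : ℝ → E} {T : Set ℝ}
    (hx : ContinuousOn x T) (hu : ContinuousOn u T) (hxT : ∀ t ∈ T, x t ∈ e.target) :
    ContinuousOn (fun t => fderiv ℝ (fun u => localLagrangian L e (x t) u) (u t)) T := by
  have ho : IsOpen (Prod.fst ⁻¹' e.target : Set (E × E)) := e.open_target.preimage continuous_fst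
  have h1 := ((contDiffOn_localLagrangian he hL).continuousOn_fderiv_of_isOpen ho le_rfl).comp
    (hx.prodMk hu) fun t ht => hxT t ht
  refine (h1.clm_comp (continuousOn_const (c := ContinuousLinearMap.inr ℝ E E))).congr
    fun t ht => ?_
  exact fderiv_right_eq (Φ := fun c : E × E => localLagrangian L e c.1 c.2)
    (((contDiffOn_localLagrangian he hL).contDiffAt
      (ho.mem_nhds (hxT t ht))).differentiableAt one_ne_zero)

theorem IsPath.continuousOn_fiberForce (he : e ∈ IsManifold.maximalAtlas 𝓘(ℝ, E) ∞ M)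
    (hL : ContMDiff 𝓘(ℝ, E).tangent 𝓘(ℝ, ℝ) 1 L) (hz : IsPath a b q₁ q₂ z) :
    ContinuousOn (fun t => fderiv ℝ (fun u => localLagrangian L e (localPos e z t) u)
      (localVel e z t)) (chartTimes a b z e) :=
  continuousOn_fderiv_localLagrangian_right he hL (hz.continuousOn_localPos he)
    (hz.continuousOn_localVel he) fun _ ht => e.map_source ht.2

theorem IsPath.continuousOn_totalForce (hab : a < b)
    (he : e ∈ IsManifold.maximalAtlas 𝓘(ℝ, E) ∞ M)
    (hL : ContMDiff 𝓘(ℝ, E).tangent 𝓘(ℝ, ℝ) 1 L)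
    (hN : ContMDiff 𝓘(ℝ, E) 𝓘(ℝ, F) 2 N) (hz : IsPath a b q₁ q₂ z)
    (hμ : ContinuousOn μ (Icc a b)) :
    ContinuousOn (totalForce e L N a b z μ) (chartTimes a b z e) := by
  have h1 := ((contDiffOn_comp_chart_symm (k := 2) ENat.LEInfty.out he hN).fderiv_of_isOpen
    e.open_target one_add_one_eq_two.le).continuousOn_fderiv_of_isOpen e.open_target le_rfl
  exact (hz.continuousOn_force he hL).add (((innerSL ℝ).continuous.comp_continuousOn
    (hμ.mono inter_subset_left)).clm_comp ((h1.comp (hz.continuousOn_localPos he)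
      fun t ht => e.map_source ht.2).clm_apply (hz.continuousOn_localVelocity hab he)))

/-- The fiber derivative is natural: in the coordinates induced by a chart it is the partial
derivative of the local Lagrangian in the velocity. -/
theorem fderiv_localLagrangian_chartDiff (he : e ∈ IsManifold.maximalAtlas 𝓘(ℝ, E) ∞ M)
    (hL : ContMDiff 𝓘(ℝ, E).tangent 𝓘(ℝ, ℝ) 1 L) {q : M} (hq : q ∈ e.source) (v ξ : E) :
    fderiv ℝ (fun u => localLagrangian L e (e q) u) (chartDiff e q v) (chartDiff e q ξ) =
      (fiberDeriv L q v ξ : ℝ) := by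
  have h1 : (fun u : E => L ⟨q, u⟩) =
      (fun u => localLagrangian L e (e q) u) ∘ (chartDiff e q) := by
    funext u
    exact congrArg L (tangentOfCoord_tangentCoord he (z := ⟨q, u⟩) hq).symm
  have h2 : DifferentiableAt ℝ (fun u => localLagrangian L e (e q) u) (chartDiff e q v) :=
    (((contDiffOn_localLagrangian he hL).contDiffAt (x := (e q, chartDiff e q v))
      ((e.open_target.preimage continuous_fst).mem_nhds (e.map_source hq))).differentiableAt
      one_ne_zero).comp _ (by fun_prop : DifferentiableAt ℝ (fun u : E => (e q, u)) _)
  have h3 : fderiv ℝ (fun u : E => L ⟨q, u⟩) v =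
      (fderiv ℝ (fun u => localLagrangian L e (e q) u) (chartDiff e q v)).comp
        (chartDiff e q) := by
    rw [h1]
    exact (h2.hasFDerivAt.comp v (chartDiff e q).hasFDerivAt).fderiv
  exact (DFunLike.congr_fun h3 ξ).symm

/-- The Legendre transform `p = ∂L/∂v` in the coordinates induced by a chart. -/
theorem localMom_eq_fderiv_iff (he : e ∈ IsManifold.maximalAtlas 𝓘(ℝ, E) ∞ M)
    (hL : ContMDiff 𝓘(ℝ, E).tangent 𝓘(ℝ, ℝ) 1 L) {t : ℝ} (ht : (z t).proj ∈ e.source) :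
    localMom e z t = fderiv ℝ (fun u => localLagrangian L e (localPos e z t) u) (localVel e z t) ↔
      (z t).2.2 = fiberDeriv L (z t).proj (z t).2.1 := by
  constructor
  · intro h
    refine ContinuousLinearMap.ext fun ξ => ?_
    exact (localMom_apply_chartDiff he ht ξ).symm.trans ((DFunLike.congr_fun h _).trans
      (fderiv_localLagrangian_chartDiff he hL ht (z t).2.1 ξ))
  · intro h
    ext ξ
    rw [← chartDiff_chartSymmDiff he ht ξ]
    exact (localMom_apply_chartDiff he ht _).trans ((DFunLike.congr_fun h _).trans
      (fderiv_localLagrangian_chartDiff he hL ht (z t).2.1 _).symm)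

theorem IsPath.localPos_sub_eq_integral [CompleteSpace E] (hab : a < b)
    (he : e ∈ IsManifold.maximalAtlas 𝓘(ℝ, E) ∞ M) (hz : IsPath a b q₁ q₂ z)
    {s t : ℝ} (hst : s ≤ t) (hsub : Icc s t ⊆ chartTimes a b z e) :
    localPos e z t - localPos e z s = ∫ τ in s..t, localVelocity e a b z τ := by
  refine (intervalIntegral.integral_eq_sub_of_hasDerivAt_of_le hst
    ((hz.continuousOn_localPos he).mono hsub) (fun τ hτ => ?_)
    (ContinuousOn.intervalIntegrable (by
      rw [uIcc_of_le hst]; exact (hz.continuousOn_localVelocity hab he).mono hsub))).symm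
  have h1 := hsub (Ioo_subset_Icc_self hτ)
  exact ((hz.hasDerivWithinAt_localPos he h1.1 h1.2).mono
    (hsub.trans inter_subset_left)).hasDerivAt (Icc_mem_nhds hτ.1 hτ.2)

/-- While the base curve stays in a chart, so do the nearby curves of a variation. -/
theorem IsVariation.exists_prod_subset_chartDomain {δ : ℝ} {Z : ℝ → ℝ → PontryaginBundle E M}
    (h : IsVariation a b q₁ q₂ z δ Z) {s t : ℝ} (hsub : Icc s t ⊆ chartTimes a b z e) :
    ∃ δ' > 0, Ioo (-δ') δ' ×ˢ Icc s t ⊆ chartDomain δ a b Z e := by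
  obtain ⟨u, hu, hu'⟩ := continuousOn_iff'.1 h.continuousOn_proj e.source e.open_source
  have h0 : ({0} : Set ℝ) ×ˢ Icc s t ⊆ u := by
    rintro ⟨ε, τ⟩ ⟨hε, hτ⟩
    obtain rfl : ε = 0 := hε
    refine (hu'.subset ⟨?_, ⟨neg_lt_zero.2 h.pos, h.pos⟩, (hsub hτ).1⟩).1
    simp only [mem_preimage, h.base τ (hsub hτ).1]
    exact (hsub hτ).2
  obtain ⟨v, w, hv, -, h0v, hw, hvw⟩ :=
    generalized_tube_lemma isCompact_singleton isCompact_Icc hu h0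
  obtain ⟨r, hr, hrv⟩ := Metric.isOpen_iff.1 hv 0 (h0v rfl)
  refine ⟨min r δ, lt_min hr h.pos, fun x hx => ?_⟩
  have h1 : x.1 ∈ Ioo (-δ) δ :=
    ⟨by linarith [hx.1.1, min_le_right r δ], hx.1.2.trans_le (min_le_right _ _)⟩
  have h2 : x.1 ∈ v := hrv (by
    rw [Real.ball_eq_Ioo]
    exact ⟨by linarith [hx.1.1, min_le_left r δ], by linarith [hx.1.2, min_le_left r δ]⟩)
  have h3 : x ∈ Ioo (-δ) δ ×ˢ Icc a b := ⟨h1, (hsub hx.2).1⟩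
  exact ⟨h3, (hu'.symm.subset ⟨hvw ⟨h2, hw hx.2⟩, h3⟩).1⟩

/-- The first variation along a chart, when the kinematic and Legendre equations hold and the
multiplier varies orthogonally to `d/dt N(q)`. -/
theorem firstVariation_eq_totalForce_add_totalMomentum (hab : a < b)
    (hL : ContMDiff 𝓘(ℝ, E).tangent 𝓘(ℝ, ℝ) 1 L)
    (hN : ContMDiff 𝓘(ℝ, E) 𝓘(ℝ, F) 2 N) (he : e ∈ IsManifold.maximalAtlas 𝓘(ℝ, E) ∞ M)
    (hz : IsPath a b q₁ q₂ z)
    {δ : ℝ} {Z : ℝ → ℝ → PontryaginBundle E M} (h : IsVariation a b q₁ q₂ z δ Z)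
    {Λ : ℝ → ℝ → F} (hΛ : C1FamilyOn (Ioo (-δ) δ ×ˢ Icc a b) Λ)
    {t : ℝ} (ht : t ∈ Icc a b) (hte : (z t).proj ∈ e.source) (hΛ0 : Λ 0 t = μ t)
    (hkin : velocity a b (fun r => (z r).proj) t = (z t).2.1)
    (hleg : (z t).2.2 = fiberDeriv L (z t).proj (z t).2.1)
    (hcon : inner ℝ (deriv (Λ · t) 0) (derivWithin (fun r => N (z r).proj) (Icc a b) t) = 0) :
    firstVariation L N a b Z Λ t =
      totalForce e L N a b z μ t (deriv (fun ε => localPos e (Z ε) t) 0)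
        + totalMomentum e N z μ t (deriv (fun ε => localVelocity e a b (Z ε) t) 0) := by
  have hb := h.base t ht
  have hte0 : (Z 0 t).proj ∈ e.source := hb ▸ hte
  have hε : (0 : ℝ) ∈ Ioo (-δ) δ := ⟨neg_lt_zero.2 h.pos, h.pos⟩
  have hD : ((0 : ℝ), t) ∈ chartDomain δ a b Z e := ⟨⟨hε, ht⟩, hte0⟩
  rw [firstVariation_eq hab hL hN he h ht hte0 ((h.c1FamilyOn_localPos he).hasDerivAt hD)
    ((h.c1FamilyOn_localVel he).hasDerivAt hD) ((h.c1FamilyOn_localMom he).hasDerivAt hD)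
    ((h.c1FamilyOn_localVelocity he).hasDerivAt hD) (hΛ.hasDerivAt ⟨hε, ht⟩)]
  have p1 : localPos e (Z 0) t = localPos e z t := localPos_congr hb
  have p2 : localVel e (Z 0) t = localVel e z t := localVel_congr hb
  have p3 : localMom e (Z 0) t = localMom e z t := localMom_congr hb
  have p4 : localVelocity e a b (Z 0) t = localVelocity e a b z t := localVelocity_congr h.base ht
  have p5 : localVelocity e a b z t = localVel e z t :=
    congrArg (chartDiff e (z t).proj) hkin
  rw [hz.derivWithin_comp hab he (hN.of_le one_le_two) ht hte] at hcon
  have hsym : IsSymmSndFDerivAt ℝ (fun x => N (e.symm x)) (localPos e z t) :=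
    ((contDiffOn_comp_chart_symm (k := 2) ENat.LEInfty.out he hN).contDiffAt
      (e.open_target.mem_nhds (e.map_source hte))).isSymmSndFDerivAt (by simp)
  -- By the kinematic and Legendre equations the terms with the variations of `v` and `p` cancel.
  rw [p1, p2, p3, p4, hΛ0, hcon, ← (localMom_eq_fderiv_iff he hL hte).2 hleg, p5, sub_self,
    map_zero, map_sub, hsym.eq]
  simp only [totalForce, totalMomentum, add_apply, ContinuousLinearMap.comp_apply,
    innerSL_apply_apply, p5, inner_add_right]
  ring

/-- Along an interval on which the base curve stays in one chart, the integral of the first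
variation consists of the boundary terms only. -/
theorem integral_firstVariation_chart [CompleteSpace E] (hab : a < b)
    (hL : ContMDiff 𝓘(ℝ, E).tangent 𝓘(ℝ, ℝ) 1 L)
    (hN : ContMDiff 𝓘(ℝ, E) 𝓘(ℝ, F) 2 N) (he : e ∈ IsManifold.maximalAtlas 𝓘(ℝ, E) ∞ M)
    (hz : IsPath a b q₁ q₂ z) (hμc : ContinuousOn μ (Icc a b))
    (hkin : ∀ t ∈ Icc a b, velocity a b (fun r => (z r).proj) t = (z t).2.1)
    (hleg : ∀ t ∈ Icc a b, (z t).2.2 = fiberDeriv L (z t).proj (z t).2.1)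
    {δ : ℝ} {Z : ℝ → ℝ → PontryaginBundle E M} (h : IsVariation a b q₁ q₂ z δ Z)
    {Λ : ℝ → ℝ → F} (hΛ : C1FamilyOn (Ioo (-δ) δ ×ˢ Icc a b) Λ)
    (hΛ0 : ∀ t ∈ Icc a b, Λ 0 t = μ t)
    (hcon : ∀ t ∈ Icc a b, inner ℝ (deriv (Λ · t) 0)
      (derivWithin (fun r => N (z r).proj) (Icc a b) t) = 0)
    {s t : ℝ} (hs : a ≤ s) (hst : s ≤ t) (ht : t ≤ b)
    (hq : ∀ τ ∈ Icc s t, (z τ).proj ∈ e.source)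
    (hbal : ∀ τ ∈ Icc s t, MomentumBalance e L N a b z μ s τ) :
    ∫ τ in s..t, firstVariation L N a b Z Λ τ =
      totalMomentum e N z μ t (deriv (fun ε => localPos e (Z ε) t) 0)
        - totalMomentum e N z μ s (deriv (fun ε => localPos e (Z ε) s) 0) := by
  have hsub : Icc s t ⊆ chartTimes a b z e := fun τ hτ =>
    ⟨⟨hs.trans hτ.1, hτ.2.trans ht⟩, hq τ hτ⟩
  obtain ⟨δ', hδ', hD⟩ := h.exists_prod_subset_chartDomain hsub
  have cx := (h.c1FamilyOn_localPos he).mono hD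
  have cy := (h.c1FamilyOn_localVelocity he).mono hD
  have h1 : ∫ τ in s..t, firstVariation L N a b Z Λ τ =
      ∫ τ in s..t, (totalForce e L N a b z μ τ (deriv (fun ε => localPos e (Z ε) τ) 0)
        + totalMomentum e N z μ τ (deriv (fun ε => localVelocity e a b (Z ε) τ) 0)) := by
    refine intervalIntegral.integral_congr fun τ hτ => ?_
    rw [uIcc_of_le hst] at hτ
    have hτ' := (hsub hτ).1
    exact firstVariation_eq_totalForce_add_totalMomentum hab hL hN he hz h hΛ hτ' (hq τ hτ)
      (hΛ0 τ hτ') (hkin τ hτ') (hleg τ hτ') (hcon τ hτ')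
  rw [h1]
  refine integral_clm_apply_by_parts hst ((hz.continuousOn_totalForce hab he hL hN hμc).mono hsub)
    (cy.continuousOn_zero hδ').2 hbal fun τ hτ => ?_
  have h2 := cy.hasDerivAt_integral hδ' le_rfl hτ.1 hτ.2
  have h0 : (0 : ℝ) ∈ Ioo (-δ') δ' := ⟨neg_lt_zero.2 hδ', hδ'⟩
  have h3 : HasDerivAt (fun ε => localPos e (Z ε) τ - localPos e (Z ε) s) _ 0 :=
    (cx.hasDerivAt ⟨h0, hτ⟩).sub (cx.hasDerivAt ⟨h0, left_mem_Icc.2 hst⟩)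
  refine h3.unique (h2.congr_of_eventuallyEq ?_)
  filter_upwards [isOpen_Ioo.mem_nhds h0] with ε hε
  have hD' : ∀ r ∈ Icc s t, (ε, r) ∈ chartDomain δ a b Z e := fun r hr => hD ⟨hε, hr⟩
  exact (h.isPath ε (hD' s (left_mem_Icc.2 hst)).1.1).localPos_sub_eq_integral hab he hτ.1
    fun r hr => ⟨(hD' r ⟨hr.1, hr.2.trans hτ.2⟩).1.2, (hD' r ⟨hr.1, hr.2.trans hτ.2⟩).2⟩

/-- The boundary terms of the first variation do not depend on the chart. -/
theorem totalMomentum_apply_deriv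
    (hN : ContMDiff 𝓘(ℝ, E) 𝓘(ℝ, F) 2 N) (he : e ∈ IsManifold.maximalAtlas 𝓘(ℝ, E) ∞ M)
    {δ : ℝ} {Z : ℝ → ℝ → PontryaginBundle E M} (h : IsVariation a b q₁ q₂ z δ Z)
    {t : ℝ} (ht : t ∈ Icc a b) (hq : (z t).proj ∈ e.source) :
    totalMomentum e N z μ t (deriv (fun ε => localPos e (Z ε) t) 0) =
      ((Z 0 t).2.2 (mfderiv 𝓘(ℝ, ℝ) 𝓘(ℝ, E) (fun ε => (Z ε t).proj) 0 (1 : ℝ)) : ℝ)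
        + inner ℝ (μ t) (deriv (fun ε => N (Z ε t).proj) 0) := by
  have hb := h.base t ht
  have hε : (0 : ℝ) ∈ Ioo (-δ) δ := ⟨neg_lt_zero.2 h.pos, h.pos⟩
  have hte : (Z 0 t).proj ∈ e.source := hb ▸ hq
  have hD : ((0 : ℝ), t) ∈ chartDomain δ a b Z e := ⟨⟨hε, ht⟩, hte⟩
  have hx := (h.c1FamilyOn_localPos he).hasDerivAt hD
  have hp : MDifferentiableAt 𝓘(ℝ, ℝ) 𝓘(ℝ, E) (fun ε => (Z ε t).proj) 0 :=
    ((Bundle.contMDiff_proj (n := 1) (IB := 𝓘(ℝ, E)) (F := E × (E →L[ℝ] ℝ))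
      ((fun x : M => TangentSpace 𝓘(ℝ, E) x) ×ᵇ
      (fun x : M => TangentSpace 𝓘(ℝ, E) x →L[ℝ] Bundle.Trivial M ℝ x))).mdifferentiable
      one_ne_zero _).comp (0 : ℝ) (h.isC1Family.mdifferentiableAt 0 hε t ht)
  have h1 : HasFDerivAt (fun ε => localPos e (Z ε) t) ((chartDiff e (Z 0 t).proj).comp
      (mfderiv 𝓘(ℝ, ℝ) 𝓘(ℝ, E) (fun ε => (Z ε t).proj) 0 : ℝ →L[ℝ] E)) 0 :=
    (((mdifferentiable_of_mem_maximalAtlas he).mdifferentiableAt hte).hasMFDerivAt.comp (0 : ℝ)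
      hp.hasMFDerivAt).hasFDerivAt
  have hd : DifferentiableAt ℝ (fun x => N (e.symm x)) (localPos e (Z 0) t) :=
    ((contDiffOn_comp_chart_symm (k := 2) ENat.LEInfty.out he hN).contDiffAt
      (e.open_target.mem_nhds (e.map_source hte))).differentiableAt two_ne_zero
  have h2 : HasDerivAt (fun ε => N (Z ε t).proj) (fderiv ℝ (fun x => N (e.symm x))
      (localPos e (Z 0) t) (deriv (fun ε => localPos e (Z ε) t) 0)) 0 := by
    refine (hd.hasFDerivAt.comp_hasDerivAt (0 : ℝ) hx).congr_of_eventuallyEq ?_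
    filter_upwards [h.isParamOpen_chartDomain (e := e) _ hD] with ε hε
      using congrArg N (e.left_inv hε.2).symm
  rw [h2.deriv, ← totalMomentum_congr hb]
  refine congrArg₂ (fun c d : ℝ => c + d) ?_ rfl
  rw [h1.hasDerivAt.deriv]
  exact localMom_apply_chartDiff he hte _

/-- If the momentum balance holds on the pieces of a partition of `[a, b]`, for one chart on
each piece, then the derivative of the action vanishes along every variation that preserves the
constraint. -/
theorem hasDerivAt_pairedAction_zero [CompleteSpace E] (hab : a < b)
    (hL : ContMDiff 𝓘(ℝ, E).tangent 𝓘(ℝ, ℝ) 1 L)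
    (hN : ContMDiff 𝓘(ℝ, E) 𝓘(ℝ, F) 2 N)
    (hz : IsPath a b q₁ q₂ z) (hμc : ContinuousOn μ (Icc a b))
    (hkin : ∀ t ∈ Icc a b, velocity a b (fun r => (z r).proj) t = (z t).2.1)
    (hleg : ∀ t ∈ Icc a b, (z t).2.2 = fiberDeriv L (z t).proj (z t).2.1)
    {T : ℕ → ℝ} (hT : Monotone T) (hT0 : T 0 = a) {m : ℕ} (hTm : T m = b)
    (hbal : ∀ n < m, ∃ e ∈ IsManifold.maximalAtlas 𝓘(ℝ, E) ∞ M,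
      (∀ τ ∈ Icc (T n) (T (n + 1)), (z τ).proj ∈ e.source) ∧
      ∀ τ ∈ Icc (T n) (T (n + 1)), MomentumBalance e L N a b z μ (T n) τ)
    {δ : ℝ} {Z : ℝ → ℝ → PontryaginBundle E M} (h : IsVariation a b q₁ q₂ z δ Z)
    {Λ : ℝ → ℝ → F} (hΛ : C1FamilyOn (Ioo (-δ) δ ×ˢ Icc a b) Λ)
    (hΛ0 : ∀ t ∈ Icc a b, Λ 0 t = μ t)
    (hcon : ∀ t ∈ Icc a b, inner ℝ (deriv (Λ · t) 0)
      (derivWithin (fun r => N (z r).proj) (Icc a b) t) = 0) :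
    HasDerivAt (fun ε => pairedAction L N a b (Z ε) (Λ ε)) 0 0 := by
  obtain ⟨hc, hd⟩ := hasDerivAt_pairedAction hab hL hN h hΛ
  -- `B` is the boundary term `⟨p, δq⟩ + ⟨μ, δN(q)⟩`. As no chart enters, it telescopes over the
  -- partition.
  set B : ℝ → ℝ := fun t =>
    ((Z 0 t).2.2 (mfderiv 𝓘(ℝ, ℝ) 𝓘(ℝ, E) (fun ε => (Z ε t).proj) 0 (1 : ℝ)) : ℝ)
      + inner ℝ (μ t) (deriv (fun ε => N (Z ε t).proj) 0) with hB
  have hmem : ∀ n ≤ m, T n ∈ Icc a b := fun n hn => ⟨hT0 ▸ hT (Nat.zero_le n), hTm ▸ hT hn⟩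
  have hii : ∀ n ≤ m, ∀ n' ≤ m,
      IntervalIntegrable (firstVariation L N a b Z Λ) volume (T n) (T n') := fun n hn n' hn' =>
    (hc.mono (ordConnected_Icc.uIcc_subset (hmem n hn) (hmem n' hn'))).intervalIntegrable
  have key : ∀ n ≤ m, ∫ t in a..T n, firstVariation L N a b Z Λ t = B (T n) - B a := by
    intro n
    induction n with
    | zero => intro _; simp [hT0]
    | succ n ih =>
      intro hn
      obtain ⟨e, he, hq, hb⟩ := hbal n (by omega)
      have hle : T n ≤ T (n + 1) := hT n.le_succ
      have h1 := integral_firstVariation_chart hab hL hN he hz hμc hkin hleg h hΛ hΛ0 hcon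
        (hmem n (by omega)).1 hle (hmem _ hn).2 hq hb
      rw [totalMomentum_apply_deriv hN he h (hmem _ hn) (hq _ (right_mem_Icc.2 hle)),
        totalMomentum_apply_deriv hN he h (hmem n (by omega)) (hq _ (left_mem_Icc.2 hle))] at h1
      have h2 := ih (by omega)
      rw [← intervalIntegral.integral_add_adjacent_intervals
        (hT0 ▸ hii 0 (by omega) n (by omega)) (hii n (by omega) _ hn), h1, h2]
      simp only [hB]
      ring
  -- The end points are fixed along a variation, so `B` vanishes at `a` and `b`.
  have h0 : ∀ t ∈ Icc a b, (∀ ε ∈ Ioo (-δ) δ, (Z ε t).proj = (Z 0 t).proj) → B t = 0 := by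
    intro t ht hconst
    have hev : (fun ε => (Z ε t).proj) =ᶠ[𝓝 0] fun _ => (Z 0 t).proj := by
      filter_upwards [Ioo_mem_nhds (neg_lt_zero.2 h.pos) h.pos] with ε hε using hconst ε hε
    have hev2 : (fun ε => N (Z ε t).proj) =ᶠ[𝓝 0] fun _ => N (Z 0 t).proj :=
      hev.fun_comp N
    have h1 : (mfderiv 𝓘(ℝ, ℝ) 𝓘(ℝ, E) (fun ε => (Z ε t).proj) 0 : ℝ →L[ℝ] E) = 0 :=
      hev.mfderiv_eq.trans mfderiv_const
    have h2 : ((Z 0 t).2.2 : E →L[ℝ] ℝ)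
        ((mfderiv 𝓘(ℝ, ℝ) 𝓘(ℝ, E) (fun ε => (Z ε t).proj) 0 : ℝ →L[ℝ] E) (1 : ℝ)) = 0 := by
      rw [h1]; exact map_zero ((Z 0 t).2.2 : E →L[ℝ] ℝ)
    have h3 : deriv (fun ε => N (Z ε t).proj) 0 = 0 := hev2.deriv_eq.trans (deriv_const _ _)
    simp only [hB, h3, inner_zero_right, add_zero]
    exact h2
  have hend := key m le_rfl
  rw [hTm] at hend
  rw [hend] at hd
  have hpos0 : (0 : ℝ) ∈ Ioo (-δ) δ := ⟨neg_lt_zero.2 h.pos, h.pos⟩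
  rw [h0 b (right_mem_Icc.2 hab.le) fun ε hε =>
      (h.isPath ε hε).right.trans (h.isPath 0 hpos0).right.symm,
    h0 a (left_mem_Icc.2 hab.le) fun ε hε =>
      (h.isPath ε hε).left.trans (h.isPath 0 hpos0).left.symm, sub_zero] at hd
  exact hd

end Sufficiency

/-! ### Variations in a chart, and the equations that they force -/

section Necessity

open scoped ContDiff

variable {E : Type*} [NormedAddCommGroup E] [NormedSpace ℝ E]
  {M : Type*} [TopologicalSpace M] [ChartedSpace E M]
  {F : Type*} [NormedAddCommGroup F] [InnerProductSpace ℝ F]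
  {e : OpenPartialHomeomorph M E} {a b : ℝ} {q₁ q₂ : M}
  {L : TangentBundle 𝓘(ℝ, E) M → ℝ} {N : M → F} {z : ℝ → PontryaginBundle E M} {μ : ℝ → F}

/-- On the relatively open set `T` of times, the family `Z` is, in the coordinates induced by the
chart `e`, the affine perturbation of `z` in the direction `(η, β, α)`. -/
structure IsAffineOn (e : OpenPartialHomeomorph M E) (a b : ℝ) (z : ℝ → PontryaginBundle E M)
    (δ : ℝ) (Z : ℝ → ℝ → PontryaginBundle E M) (T : Set ℝ) (η η' β : ℝ → E)
    (α : ℝ → E →L[ℝ] ℝ) : Prop where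
  subset : T ⊆ chartTimes a b z e
  mem_nhdsWithin : ∀ τ ∈ T, T ∈ 𝓝[Icc a b] τ
  hasDerivAt : ∀ τ, HasDerivAt η (η' τ) τ
  continuous_deriv : Continuous η'
  continuous_vel : Continuous β
  continuous_mom : Continuous α
  mem_target : ∀ ε ∈ Ioo (-δ) δ, ∀ τ ∈ T, localPos e z τ + ε • η τ ∈ e.target
  eq : ∀ ε ∈ Ioo (-δ) δ, ∀ τ ∈ T,
    Z ε τ = pontryaginOfCoord e (pontryaginCoord e (z τ) + ε • (η τ, β τ, α τ))

variable {δ : ℝ} {Z : ℝ → ℝ → PontryaginBundle E M} {T : Set ℝ} {η η' β : ℝ → E}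
  {α : ℝ → E →L[ℝ] ℝ}

theorem IsAffineOn.continuous (h : IsAffineOn e a b z δ Z T η η' β α) : Continuous η :=
  continuous_iff_continuousAt.2 fun τ => (h.hasDerivAt τ).continuousAt

theorem IsAffineOn.pontryaginCoord_eq (he : e ∈ IsManifold.maximalAtlas 𝓘(ℝ, E) ∞ M)
    (h : IsAffineOn e a b z δ Z T η η' β α) {ε : ℝ} (hε : ε ∈ Ioo (-δ) δ) {τ : ℝ} (hτ : τ ∈ T) :
    pontryaginCoord e (Z ε τ) = pontryaginCoord e (z τ) + ε • (η τ, β τ, α τ) := by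
  rw [h.eq ε hε τ hτ]
  exact pontryaginCoord_pontryaginOfCoord he (h.mem_target ε hε τ hτ)

theorem IsAffineOn.localPos_eq (he : e ∈ IsManifold.maximalAtlas 𝓘(ℝ, E) ∞ M)
    (h : IsAffineOn e a b z δ Z T η η' β α) {ε : ℝ} (hε : ε ∈ Ioo (-δ) δ) {τ : ℝ} (hτ : τ ∈ T) :
    localPos e (Z ε) τ = localPos e z τ + ε • η τ :=
  congrArg (fun c => c.1) (h.pontryaginCoord_eq he hε hτ)

theorem IsAffineOn.localVel_eq (he : e ∈ IsManifold.maximalAtlas 𝓘(ℝ, E) ∞ M)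
    (h : IsAffineOn e a b z δ Z T η η' β α) {ε : ℝ} (hε : ε ∈ Ioo (-δ) δ) {τ : ℝ} (hτ : τ ∈ T) :
    localVel e (Z ε) τ = localVel e z τ + ε • β τ :=
  congrArg (fun c => c.2.1) (h.pontryaginCoord_eq he hε hτ)

theorem IsAffineOn.localMom_eq (he : e ∈ IsManifold.maximalAtlas 𝓘(ℝ, E) ∞ M)
    (h : IsAffineOn e a b z δ Z T η η' β α) {ε : ℝ} (hε : ε ∈ Ioo (-δ) δ) {τ : ℝ} (hτ : τ ∈ T) :
    localMom e (Z ε) τ = localMom e z τ + ε • α τ :=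
  congrArg (fun c => c.2.2) (h.pontryaginCoord_eq he hε hτ)

theorem IsAffineOn.proj_eq (h : IsAffineOn e a b z δ Z T η η' β α) {ε : ℝ} (hε : ε ∈ Ioo (-δ) δ)
    {τ : ℝ} (hτ : τ ∈ T) : (Z ε τ).proj = e.symm (localPos e z τ + ε • η τ) :=
  congrArg (·.proj) (h.eq ε hε τ hτ)

theorem IsAffineOn.proj_mem (h : IsAffineOn e a b z δ Z T η η' β α) {ε : ℝ}
    (hε : ε ∈ Ioo (-δ) δ) {τ : ℝ} (hτ : τ ∈ T) : (Z ε τ).proj ∈ e.source := by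
  rw [h.proj_eq hε hτ]
  exact e.map_target (h.mem_target ε hε τ hτ)

/-- The perturbation of `z` in the coordinates induced by the chart `e`, in the direction
`(η, β, α)`. Outside the domain of the chart, where the direction is meant to vanish, it is `z`. -/
noncomputable def chartPerturbation (e : OpenPartialHomeomorph M E)
    (z : ℝ → PontryaginBundle E M) (η β : ℝ → E) (α : ℝ → E →L[ℝ] ℝ) (ε τ : ℝ) :
    PontryaginBundle E M :=
  open Classical in
  if (z τ).proj ∈ e.source then pontryaginOfCoord e (pontryaginCoord e (z τ) + ε • (η τ, β τ, α τ))
  else z τ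

theorem chartPerturbation_of_eq_zero (he : e ∈ IsManifold.maximalAtlas 𝓘(ℝ, E) ∞ M) {τ : ℝ}
    (hη : η τ = 0) (hβ : β τ = 0) (hα : α τ = 0) (ε : ℝ) :
    chartPerturbation e z η β α ε τ = z τ := by
  unfold chartPerturbation
  split_ifs with h
  · have h0 : ε • ((η τ, β τ, α τ) : E × E × (E →L[ℝ] ℝ)) = 0 := by simp [hη, hβ, hα]
    rw [h0, add_zero, pontryaginOfCoord_pontryaginCoord he h]
  · rfl

variable [IsManifold 𝓘(ℝ, E) ∞ M]

theorem IsAffineOn.continuousOn (he : e ∈ IsManifold.maximalAtlas 𝓘(ℝ, E) ∞ M)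
    (hz : IsPath a b q₁ q₂ z) (h : IsAffineOn e a b z δ Z T η η' β α) {ε : ℝ}
    (hε : ε ∈ Ioo (-δ) δ) : ContinuousOn (Z ε) T := by
  have h1 : ContinuousOn (fun τ => pontryaginCoord e (z τ) + ε • (η τ, β τ, α τ)) T :=
    ((hz.continuousOn_coord he).mono h.subset).add ((h.continuous.prodMk
      (h.continuous_vel.prodMk h.continuous_mom)).const_smul ε).continuousOn
  exact ((contMDiffOn_pontryaginOfCoord he).continuousOn.comp h1
    fun τ hτ => h.mem_target ε hε τ hτ).congr fun τ hτ => h.eq ε hε τ hτ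

theorem IsAffineOn.contMDiffOn (he : e ∈ IsManifold.maximalAtlas 𝓘(ℝ, E) ∞ M)
    (hz : IsPath a b q₁ q₂ z) (h : IsAffineOn e a b z δ Z T η η' β α) {ε : ℝ}
    (hε : ε ∈ Ioo (-δ) δ) : ContMDiffOn 𝓘(ℝ, ℝ) 𝓘(ℝ, E) 1 (fun τ => (Z ε τ).proj) T := by
  have h1 : ContMDiffOn 𝓘(ℝ, ℝ) 𝓘(ℝ, E) 1 (localPos e z) T :=
    ((contMDiffOn_of_mem_maximalAtlas he).of_le (by simp : (1 : WithTop ℕ∞) ≤ ∞)).comp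
      (hz.contMDiffOn.mono (h.subset.trans inter_subset_left)) fun τ hτ => (h.subset hτ).2
  have h2 : ContDiff ℝ 1 η := contDiff_one_iff_deriv.2
    ⟨fun τ => (h.hasDerivAt τ).differentiableAt, by
      rw [show deriv η = η' from funext fun τ => (h.hasDerivAt τ).deriv]
      exact h.continuous_deriv⟩
  have h3 : ContMDiffOn 𝓘(ℝ, ℝ) 𝓘(ℝ, E) 1 (fun τ => localPos e z τ + ε • η τ) T :=
    (h1.contDiffOn.add (h2.const_smul ε).contDiffOn).contMDiffOn
  exact (((contMDiffOn_symm_of_mem_maximalAtlas he).of_le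
    (by simp : (1 : WithTop ℕ∞) ≤ ∞)).comp h3 fun τ hτ => h.mem_target ε hε τ hτ).congr
    fun τ hτ => h.proj_eq hε hτ

theorem IsAffineOn.mc1FamilyOn (he : e ∈ IsManifold.maximalAtlas 𝓘(ℝ, E) ∞ M)
    (hz : IsPath a b q₁ q₂ z) (h : IsAffineOn e a b z δ Z T η η' β α) :
    MC1FamilyOn (𝓘(ℝ, E).prod 𝓘(ℝ, E × (E →L[ℝ] ℝ))) (Ioo (-δ) δ ×ˢ T) Z := by
  have h1 : C1FamilyOn (Ioo (-δ) δ ×ˢ T)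
      (fun ε τ => pontryaginCoord e (z τ) + ε • (η τ, β τ, α τ)) :=
    c1FamilyOn_affine ((hz.continuousOn_coord he).mono h.subset)
      (h.continuous.prodMk (h.continuous_vel.prodMk h.continuous_mom)).continuousOn
      fun y hy => hy.2
  exact ((mc1FamilyOn_iff_c1FamilyOn.2 h1).comp (e.open_target.preimage continuous_fst)
    (contMDiffOn_pontryaginOfCoord he) fun x hx => h.mem_target x.1 hx.1 x.2 hx.2).congr
    (isParamOpen_prod δ T) fun x hx => h.eq x.1 hx.1 x.2 hx.2

theorem IsAffineOn.localVelocity_eq (hab : a < b) (he : e ∈ IsManifold.maximalAtlas 𝓘(ℝ, E) ∞ M)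
    (hz : IsPath a b q₁ q₂ z) (h : IsAffineOn e a b z δ Z T η η' β α) {ε : ℝ}
    (hε : ε ∈ Ioo (-δ) δ) (hZ : IsPath a b q₁ q₂ (Z ε)) {τ : ℝ} (hτ : τ ∈ T) :
    localVelocity e a b (Z ε) τ = localVelocity e a b z τ + ε • η' τ := by
  have hτ' := h.subset hτ
  have h1 := hZ.hasDerivWithinAt_localPos he hτ'.1 (h.proj_mem hε hτ)
  have h2 : HasDerivWithinAt (fun τ => localPos e z τ + ε • η τ) _ (Icc a b) τ :=
    (hz.hasDerivWithinAt_localPos he hτ'.1 hτ'.2).add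
      ((h.hasDerivAt τ).hasDerivWithinAt.const_smul ε)
  refine (uniqueDiffOn_Icc hab τ hτ'.1).eq_deriv _ h1 (h2.congr_of_eventuallyEq ?_
    (h.localPos_eq he hε hτ))
  filter_upwards [h.mem_nhdsWithin τ hτ] with r hr using h.localPos_eq he hε hr

theorem IsAffineOn.mc1FamilyOn_velocity (hab : a < b)
    (he : e ∈ IsManifold.maximalAtlas 𝓘(ℝ, E) ∞ M)
    (hz : IsPath a b q₁ q₂ z) (h : IsAffineOn e a b z δ Z T η η' β α)
    (hZ : ∀ ε ∈ Ioo (-δ) δ, IsPath a b q₁ q₂ (Z ε)) :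
    MC1FamilyOn 𝓘(ℝ, E).tangent (Ioo (-δ) δ ×ˢ T)
      (fun ε t => (⟨(Z ε t).proj, velocity a b (fun r => (Z ε r).proj) t⟩ :
        TangentBundle 𝓘(ℝ, E) M)) := by
  have h1 : C1FamilyOn (Ioo (-δ) δ ×ˢ T)
      (fun ε τ => (localPos e z τ, localVelocity e a b z τ) + ε • (η τ, η' τ)) :=
    c1FamilyOn_affine (((hz.continuousOn_localPos he).prodMk
      (hz.continuousOn_localVelocity hab he)).mono h.subset)
      (h.continuous.prodMk h.continuous_deriv).continuousOn fun y hy => hy.2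
  refine ((mc1FamilyOn_iff_c1FamilyOn.2 h1).comp (e.open_target.preimage continuous_fst)
    (contMDiffOn_tangentOfCoord he) fun x hx => h.mem_target x.1 hx.1 x.2 hx.2).congr
    (isParamOpen_prod δ T) fun x hx => ?_
  have h2 := tangentOfCoord_tangentCoord he (z := ⟨(Z x.1 x.2).proj,
    velocity a b (fun r => (Z x.1 r).proj) x.2⟩) (h.proj_mem hx.1 hx.2)
  rw [← h2]
  refine congrArg (tangentOfCoord e) (Prod.ext (h.localPos_eq he hx.1 hx.2) ?_)
  exact h.localVelocity_eq hab he hz hx.1 (hZ _ hx.1) hx.2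

/-- A family that is locally an affine perturbation of `z` in some chart is a variation of `z`. -/
theorem isVariation_of_isAffineOn (hab : a < b) (hδ : 0 < δ) (hz : IsPath a b q₁ q₂ z)
    (hZa : ∀ ε, (Z ε a).proj = q₁) (hZb : ∀ ε, (Z ε b).proj = q₂)
    (hloc : ∀ τ ∈ Icc a b, ∃ e ∈ IsManifold.maximalAtlas 𝓘(ℝ, E) ∞ M, ∃ T η η' β α,
      τ ∈ T ∧ IsAffineOn e a b z δ Z T η η' β α) : IsVariation a b q₁ q₂ z δ Z := by
  have hpath : ∀ ε ∈ Ioo (-δ) δ, IsPath a b q₁ q₂ (Z ε) := by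
    refine fun ε hε => ⟨fun τ hτ => ?_, fun τ hτ => ?_, hZa ε, hZb ε⟩
    · obtain ⟨e, he, T, η, η', β, α, hT, h⟩ := hloc τ hτ
      exact (h.continuousOn he hz hε τ hT).mono_of_mem_nhdsWithin (h.mem_nhdsWithin τ hT)
    · obtain ⟨e, he, T, η, η', β, α, hT, h⟩ := hloc τ hτ
      exact (h.contMDiffOn he hz hε τ hT).mono_of_mem_nhdsWithin (h.mem_nhdsWithin τ hT)
  have hnhds : ∀ (x : ℝ × ℝ) (T : Set ℝ), x ∈ Ioo (-δ) δ ×ˢ Icc a b → T ∈ 𝓝[Icc a b] x.2 →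
      Ioo (-δ) δ ×ˢ T ∈ 𝓝[Ioo (-δ) δ ×ˢ Icc a b] x := fun x T _ hT => by
    rw [← Prod.mk.eta (p := x), nhdsWithin_prod_eq]
    exact prod_mem_prod self_mem_nhdsWithin hT
  refine ⟨hδ, fun τ hτ => ?_, hpath, isC1Family_iff.2 (MC1FamilyOn.of_local fun x hx => ?_),
    isC1Family_iff.2 (MC1FamilyOn.of_local fun x hx => ?_)⟩
  · obtain ⟨e, he, T, η, η', β, α, hT, h⟩ := hloc τ hτ
    rw [h.eq 0 ⟨neg_lt_zero.2 hδ, hδ⟩ τ hT, zero_smul, add_zero]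
    exact pontryaginOfCoord_pontryaginCoord he (h.subset hT).2
  · obtain ⟨e, he, T, η, η', β, α, hT, h⟩ := hloc x.2 hx.2
    exact ⟨_, hnhds x T hx (h.mem_nhdsWithin _ hT), ⟨hx.1, hT⟩, h.mc1FamilyOn he hz⟩
  · obtain ⟨e, he, T, η, η', β, α, hT, h⟩ := hloc x.2 hx.2
    exact ⟨_, hnhds x T hx (h.mem_nhdsWithin _ hT), ⟨hx.1, hT⟩,
      h.mc1FamilyOn_velocity hab he hz hpath⟩

/-- The first variation along an affine perturbation in a chart. -/
theorem IsAffineOn.firstVariation_eq (hab : a < b) (hL : ContMDiff 𝓘(ℝ, E).tangent 𝓘(ℝ, ℝ) 1 L)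
    (hN : ContMDiff 𝓘(ℝ, E) 𝓘(ℝ, F) 2 N) (he : e ∈ IsManifold.maximalAtlas 𝓘(ℝ, E) ∞ M)
    (hz : IsPath a b q₁ q₂ z) (hZ : IsVariation a b q₁ q₂ z δ Z)
    (h : IsAffineOn e a b z δ Z T η η' β α) (ψ : ℝ → F) {t : ℝ} (ht : t ∈ T) :
    firstVariation L N a b Z (fun ε t => μ t + ε • ψ t) t =
      totalForce e L N a b z μ t (η t) + totalMomentum e N z μ t (η' t)
        + (fderiv ℝ (fun u => localLagrangian L e (localPos e z t) u) (localVel e z t)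
          - localMom e z t) (β t)
        + α t (localVelocity e a b z t - localVel e z t)
        + inner ℝ (ψ t) (fderiv ℝ (fun x => N (e.symm x)) (localPos e z t)
            (localVelocity e a b z t)) := by
  have ht' := (h.subset ht).1
  have hb := hZ.base t ht'
  have hte := (h.subset ht).2
  have hε : (0 : ℝ) ∈ Ioo (-δ) δ := ⟨neg_lt_zero.2 hZ.pos, hZ.pos⟩
  have hev : ∀ᶠ ε in 𝓝 (0 : ℝ), ε ∈ Ioo (-δ) δ := isOpen_Ioo.mem_nhds hε
  have h1 : HasDerivAt (fun ε => localPos e (Z ε) t) (η t) 0 :=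
    (hasDerivAt_affine _ _ _).congr_of_eventuallyEq (hev.mono fun ε hε => h.localPos_eq he hε ht)
  have h2 : HasDerivAt (fun ε => localVel e (Z ε) t) (β t) 0 :=
    (hasDerivAt_affine _ _ _).congr_of_eventuallyEq (hev.mono fun ε hε => h.localVel_eq he hε ht)
  have h3 : HasDerivAt (fun ε => localMom e (Z ε) t) (α t) 0 :=
    (hasDerivAt_affine _ _ _).congr_of_eventuallyEq (hev.mono fun ε hε => h.localMom_eq he hε ht)
  have h4 : HasDerivAt (fun ε => localVelocity e a b (Z ε) t) (η' t) 0 :=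
    (hasDerivAt_affine _ _ _).congr_of_eventuallyEq
      (hev.mono fun ε hε => h.localVelocity_eq hab he hz hε (hZ.isPath ε hε) ht)
  have h5 : HasDerivAt (fun ε : ℝ => μ t + ε • ψ t) (ψ t) 0 := hasDerivAt_affine _ _ _
  rw [StochasticHP.firstVariation_eq hab hL hN he hZ ht' (hb ▸ hte) h1 h2 h3 h4 h5,
    localPos_congr hb, localVel_congr hb, localMom_congr hb, localVelocity_congr hZ.base ht',
    zero_smul, add_zero]
  have hsym : IsSymmSndFDerivAt ℝ (fun x => N (e.symm x)) (localPos e z t) :=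
    ((contDiffOn_comp_chart_symm (k := 2) ENat.LEInfty.out he hN).contDiffAt
      (e.open_target.mem_nhds (e.map_source hte))).isSymmSndFDerivAt (by simp)
  rw [hsym.eq]
  simp only [totalForce, totalMomentum, add_apply, sub_apply, ContinuousLinearMap.comp_apply,
    innerSL_apply_apply, inner_add_right, map_sub]
  ring

/-- A perturbation of `z` in the chart `e` that vanishes outside the interval `(s, t)` is a
variation of `z`. -/
theorem exists_isVariation_chartPerturbation (hab : a < b)
    (he : e ∈ IsManifold.maximalAtlas 𝓘(ℝ, E) ∞ M) (hz : IsPath a b q₁ q₂ z) {s t : ℝ}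
    (hs : a ≤ s) (ht : t ≤ b) (hsub : Icc s t ⊆ chartTimes a b z e)
    (hη : ∀ τ, HasDerivAt η (η' τ) τ) (hη' : Continuous η') (hβ : Continuous β)
    (hα : Continuous α) (hη0 : ∀ τ ∉ Ioo s t, η τ = 0)
    (hβ0 : ∀ τ ∉ Ioo s t, β τ = 0) (hα0 : ∀ τ ∉ Ioo s t, α τ = 0) :
    ∃ δ, IsVariation a b q₁ q₂ z δ (chartPerturbation e z η β α) ∧
      IsAffineOn e a b z δ (chartPerturbation e z η β α) (chartTimes a b z e) η η' β α ∧
      ∀ τ ∈ Icc a b, τ ∉ Icc s t → ∃ e₀ ∈ IsManifold.maximalAtlas 𝓘(ℝ, E) ∞ M, ∃ T, τ ∈ T ∧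
        IsAffineOn e₀ a b z δ (chartPerturbation e z η β α) T (fun _ => 0) (fun _ => 0)
          (fun _ => 0) (fun _ => 0) := by
  have hηc : Continuous η := continuous_iff_continuousAt.2 fun τ => (hη τ).continuousAt
  have hq : ContinuousOn (fun r => (z r).proj) (Icc a b) := hz.contMDiffOn.continuousOn
  have hK : IsCompact (localPos e z '' Icc s t) :=
    isCompact_Icc.image_of_continuousOn ((hz.continuousOn_localPos he).mono hsub)
  obtain ⟨r, hr, hrK⟩ := hK.exists_thickening_subset_open e.open_target (by
    rintro _ ⟨τ, hτ, rfl⟩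
    exact e.map_source (hsub hτ).2)
  obtain ⟨C, hC⟩ := isCompact_Icc.exists_bound_of_continuousOn (hηc.continuousOn (s := Icc s t))
  have hC1 : 0 < max C 0 + 1 := by positivity
  -- For `|ε| < δ` the term `ε • η` is shorter than the distance `r` that the coordinate curve keeps
  -- from the complement of the target of the chart.
  set δ := r / (max C 0 + 1) with hδdef
  have hδ : 0 < δ := div_pos hr hC1
  have hopen : ∀ (e' : OpenPartialHomeomorph M E), ∀ τ ∈ chartTimes a b z e',
      chartTimes a b z e' ∈ 𝓝[Icc a b] τ := fun e' τ hτ =>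
    inter_mem self_mem_nhdsWithin (hq τ hτ.1 (e'.open_source.mem_nhds hτ.2))
  have hout : ∀ τ ∉ Ioo s t, ∀ ε, chartPerturbation e z η β α ε τ = z τ := fun τ hτ ε =>
    chartPerturbation_of_eq_zero he (hη0 τ hτ) (hβ0 τ hτ) (hα0 τ hτ) ε
  have haff : IsAffineOn e a b z δ (chartPerturbation e z η β α) (chartTimes a b z e) η η' β α := by
    refine ⟨subset_rfl, hopen e, hη, hη', hβ, hα, fun ε hε τ hτ => ?_, fun ε hε τ hτ => if_pos hτ.2⟩
    by_cases hτ' : τ ∈ Icc s t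
    · refine hrK (Metric.mem_thickening_iff.2 ⟨_, ⟨τ, hτ', rfl⟩, ?_⟩)
      rw [dist_eq_norm, add_sub_cancel_left, norm_smul, Real.norm_eq_abs]
      calc |ε| * ‖η τ‖ ≤ |ε| * max C 0 := by
            gcongr; exact (hC τ hτ').trans (le_max_left _ _)
        _ ≤ |ε| * (max C 0 + 1) := by gcongr; linarith
        _ < δ * (max C 0 + 1) := by gcongr; exact abs_lt.2 hε
        _ = r := div_mul_cancel₀ _ hC1.ne'
    · rw [hη0 τ fun h => hτ' (Ioo_subset_Icc_self h), smul_zero, add_zero]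
      exact e.map_source hτ.2
  have haff0 : ∀ τ ∈ Icc a b, τ ∉ Icc s t → ∃ e₀ ∈ IsManifold.maximalAtlas 𝓘(ℝ, E) ∞ M, ∃ T,
      τ ∈ T ∧ IsAffineOn e₀ a b z δ (chartPerturbation e z η β α) T (fun _ => 0) (fun _ => 0)
          (fun _ => 0) (fun _ => 0) := by
    intro τ hτ hτ'
    refine ⟨chartAt E (z τ).proj, IsManifold.chart_mem_maximalAtlas _,
      chartTimes a b z (chartAt E (z τ).proj) ∩ (Icc s t)ᶜ, ⟨⟨hτ, mem_chart_source _ _⟩, hτ'⟩,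
      inter_subset_left, fun τ' h => inter_mem (hopen _ τ' h.1)
        (mem_nhdsWithin_of_mem_nhds (isClosed_Icc.isOpen_compl.mem_nhds h.2)),
      fun _ => hasDerivAt_const _ _, continuous_const, continuous_const, continuous_const,
      fun ε _ τ' h => ?_, fun ε _ τ' h => ?_⟩
    · rw [smul_zero, add_zero]
      exact OpenPartialHomeomorph.map_source _ h.1.2
    · rw [hout τ' fun h' => h.2 (Ioo_subset_Icc_self h')]
      have h0 : ε • ((0, 0, 0) : E × E × (E →L[ℝ] ℝ)) = 0 := by simp
      rw [h0, add_zero,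
        pontryaginOfCoord_pontryaginCoord (IsManifold.chart_mem_maximalAtlas _) h.1.2]
  refine ⟨δ, isVariation_of_isAffineOn hab hδ hz (fun ε => ?_) (fun ε => ?_) fun τ hτ => ?_,
    haff, haff0⟩
  · rw [hout a fun h => (h.1.trans_le hs).false, hz.left]
  · rw [hout b fun h => (h.2.trans_le ht).false, hz.right]
  · by_cases hτ' : τ ∈ Icc s t
    · exact ⟨e, he, _, η, η', β, α, hsub hτ', haff⟩
    · obtain ⟨e₀, he₀, T, hT, h⟩ := haff0 τ hτ hτ'
      exact ⟨e₀, he₀, T, _, _, _, _, hT, h⟩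

variable {G : Type*} [NormedAddCommGroup G] [InnerProductSpace ℝ G] {ι : G →L[ℝ] F}

/-- The derivative of the paired action vanishes along every variation of `z` and every affine
variation of the multiplier in the directions of the range of `ι`. -/
def IsPairedCritical (L : TangentBundle 𝓘(ℝ, E) M → ℝ) (N : M → F) (a b : ℝ) (q₁ q₂ : M)
    (z : ℝ → PontryaginBundle E M) (μ : ℝ → F) (ι : G →L[ℝ] F) : Prop :=
  ∀ δ Z, IsVariation a b q₁ q₂ z δ Z → ∀ ψ : ℝ → G, Continuous ψ →
    HasDerivAt (fun ε => pairedAction L N a b (Z ε) (fun t => μ t + ε • ι (ψ t))) 0 0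

/-- The weak form of the equations of motion in a chart. -/
theorem IsPairedCritical.integral_eq_zero (hab : a < b)
    (hL : ContMDiff 𝓘(ℝ, E).tangent 𝓘(ℝ, ℝ) 1 L)
    (hN : ContMDiff 𝓘(ℝ, E) 𝓘(ℝ, F) 2 N) (hz : IsPath a b q₁ q₂ z)
    (hμ : ContinuousOn μ (Icc a b)) (hcrit : IsPairedCritical L N a b q₁ q₂ z μ ι)
    (he : e ∈ IsManifold.maximalAtlas 𝓘(ℝ, E) ∞ M)
    {s t : ℝ} (hs : a ≤ s) (hst : s ≤ t) (ht : t ≤ b) (hsub : Icc s t ⊆ chartTimes a b z e)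
    (hη : ∀ τ, HasDerivAt η (η' τ) τ) (hη' : Continuous η') (hβ : Continuous β)
    (hα : Continuous α) (hη0 : ∀ τ ∉ Ioo s t, η τ = 0) (hη'0 : ∀ τ ∉ Ioo s t, η' τ = 0)
    (hβ0 : ∀ τ ∉ Ioo s t, β τ = 0) (hα0 : ∀ τ ∉ Ioo s t, α τ = 0)
    {ψ : ℝ → G} (hψ : Continuous ψ) (hψ0 : ∀ τ ∉ Ioo s t, ψ τ = 0) :
    ∫ τ in s..t, (totalForce e L N a b z μ τ (η τ) + totalMomentum e N z μ τ (η' τ)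
        + (fderiv ℝ (fun u => localLagrangian L e (localPos e z τ) u) (localVel e z τ)
          - localMom e z τ) (β τ)
        + α τ (localVelocity e a b z τ - localVel e z τ)
        + inner ℝ (ι (ψ τ)) (fderiv ℝ (fun x => N (e.symm x)) (localPos e z τ)
            (localVelocity e a b z τ))) = 0 := by
  obtain ⟨δ, hZ, haff, haff0⟩ := exists_isVariation_chartPerturbation hab he hz hs ht hsub hη hη'
    hβ hα hη0 hβ0 hα0
  set Z := chartPerturbation e z η β α
  have hΛ : C1FamilyOn (Ioo (-δ) δ ×ˢ Icc a b) (fun ε τ => μ τ + ε • ι (ψ τ)) :=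
    c1FamilyOn_affine hμ (ι.continuous.comp hψ).continuousOn fun y hy => hy.2
  obtain ⟨hc, hd⟩ := hasDerivAt_pairedAction hab hL hN hZ hΛ
  have h0 := hd.unique (hcrit δ Z hZ ψ hψ)
  set φ := firstVariation L N a b Z (fun ε τ => μ τ + ε • ι (ψ τ)) with hφ
  -- The first variation is supported in `[s, t]`.
  have hout : ∀ τ ∈ Icc a b, τ ∉ Ioo s t → φ τ = 0 := by
    intro τ hτ hτ'
    have hψτ : ι (ψ τ) = 0 := by rw [hψ0 τ hτ', map_zero]
    by_cases hmem : τ ∈ Icc s t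
    · rw [hφ, haff.firstVariation_eq hab hL hN he hz hZ _ (hsub hmem), hη0 τ hτ', hη'0 τ hτ',
        hβ0 τ hτ', hα0 τ hτ', hψτ]
      simp
    · obtain ⟨e₀, he₀, T, hT, h⟩ := haff0 τ hτ hmem
      rw [hφ, h.firstVariation_eq hab hL hN he₀ hz hZ _ hT, hψτ]
      simp
  have hzero : ∀ s' t', s' ≤ t' → Icc s' t' ⊆ Icc a b → (∀ τ ∈ Icc s' t', τ ∉ Ioo s t) →
      ∫ τ in s'..t', φ τ = 0 := fun s' t' hst' h1 h2 => by
    rw [intervalIntegral.integral_congr (g := fun _ => (0 : ℝ)) fun τ hτ => ?_]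
    · simp
    · rw [uIcc_of_le hst'] at hτ
      exact hout τ (h1 hτ) (h2 τ hτ)
  have hii : ∀ s' ∈ Icc a b, ∀ t' ∈ Icc a b, IntervalIntegrable φ volume s' t' :=
    fun s' hs' t' ht' => (hc.mono (ordConnected_Icc.uIcc_subset hs' ht')).intervalIntegrable
  have ma : a ∈ Icc a b := left_mem_Icc.2 hab.le
  have mb : b ∈ Icc a b := right_mem_Icc.2 hab.le
  have ms : s ∈ Icc a b := ⟨hs, hst.trans ht⟩
  have mt : t ∈ Icc a b := ⟨hs.trans hst, ht⟩
  rw [← intervalIntegral.integral_add_adjacent_intervals (hii a ma s ms) (hii s ms b mb),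
    ← intervalIntegral.integral_add_adjacent_intervals (hii s ms t mt) (hii t mt b mb),
    hzero a s hs (Icc_subset_Icc_right ms.2) fun τ hτ h => (h.1.trans_le hτ.2).false,
    hzero t b ht (Icc_subset_Icc_left mt.1) fun τ hτ h => (h.2.trans_le hτ.1).false,
    zero_add, add_zero] at h0
  rw [← h0]
  refine intervalIntegral.integral_congr fun τ hτ => ?_
  rw [uIcc_of_le hst] at hτ
  exact (haff.firstVariation_eq hab hL hN he hz hZ (fun τ => ι (ψ τ)) (hsub hτ)).symm

/-- Varying the momentum gives `dq/dt = v`. -/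
theorem IsPairedCritical.kinematic_chart (hab : a < b)
    (hL : ContMDiff 𝓘(ℝ, E).tangent 𝓘(ℝ, ℝ) 1 L)
    (hN : ContMDiff 𝓘(ℝ, E) 𝓘(ℝ, F) 2 N) (hz : IsPath a b q₁ q₂ z)
    (hμ : ContinuousOn μ (Icc a b)) (hcrit : IsPairedCritical L N a b q₁ q₂ z μ ι)
    (he : e ∈ IsManifold.maximalAtlas 𝓘(ℝ, E) ∞ M)
    {s t : ℝ} (hs : a ≤ s) (hst : s < t) (ht : t ≤ b) (hsub : Icc s t ⊆ chartTimes a b z e) :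
    ∀ τ ∈ Icc s t, localVelocity e a b z τ = localVel e z τ := by
  intro τ hτ
  refine sub_eq_zero.1 (SeparatingDual.eq_zero_of_forall_dual_eq_zero (R := ℝ) fun p => ?_)
  refine eq_zero_of_forall_integral_mul_eq_zero hst
    (f := fun τ => p (localVelocity e a b z τ - localVel e z τ))
    (p.continuous.comp_continuousOn (((hz.continuousOn_localVelocity hab he).fun_sub
      (hz.continuousOn_localVel he)).mono hsub)) (fun ψ hψ hψ0 => ?_) τ hτ
  have h := hcrit.integral_eq_zero hab hL hN hz hμ he hs hst.le ht hsub
    (η := fun _ => 0) (η' := fun _ => 0) (β := fun _ => 0) (α := fun τ => ψ τ • p)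
    (ψ := fun _ => 0) (fun _ => hasDerivAt_const _ _) continuous_const continuous_const
    (hψ.smul continuous_const) (fun _ _ => rfl) (fun _ _ => rfl) (fun _ _ => rfl)
    (fun τ h => by rw [hψ0 τ h, zero_smul]) continuous_const (fun _ _ => rfl)
  simpa using h

/-- Varying the velocity component gives `p = ∂L/∂v`. -/
theorem IsPairedCritical.legendre_chart (hab : a < b)
    (hL : ContMDiff 𝓘(ℝ, E).tangent 𝓘(ℝ, ℝ) 1 L)
    (hN : ContMDiff 𝓘(ℝ, E) 𝓘(ℝ, F) 2 N) (hz : IsPath a b q₁ q₂ z)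
    (hμ : ContinuousOn μ (Icc a b)) (hcrit : IsPairedCritical L N a b q₁ q₂ z μ ι)
    (he : e ∈ IsManifold.maximalAtlas 𝓘(ℝ, E) ∞ M)
    {s t : ℝ} (hs : a ≤ s) (hst : s < t) (ht : t ≤ b) (hsub : Icc s t ⊆ chartTimes a b z e) :
    ∀ τ ∈ Icc s t, localMom e z τ =
      fderiv ℝ (fun u => localLagrangian L e (localPos e z τ) u) (localVel e z τ) := by
  intro τ hτ
  refine (sub_eq_zero.1 (ContinuousLinearMap.ext fun ξ => ?_)).symm
  refine eq_zero_of_forall_integral_mul_eq_zero hst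
    (f := fun τ => (fderiv ℝ (fun u => localLagrangian L e (localPos e z τ) u) (localVel e z τ)
          - localMom e z τ) ξ) ?_ (fun ψ hψ hψ0 => ?_) τ hτ
  · exact (((hz.continuousOn_fiberForce he hL).fun_sub (hz.continuousOn_localMom he)).mono
      hsub).clm_apply continuousOn_const
  · have h := hcrit.integral_eq_zero hab hL hN hz hμ he hs hst.le ht hsub
      (η := fun _ => 0) (η' := fun _ => 0) (β := fun τ => ψ τ • ξ) (α := fun _ => 0)
      (ψ := fun _ => 0) (fun _ => hasDerivAt_const _ _) continuous_const
      (hψ.smul continuous_const) continuous_const (fun _ _ => rfl) (fun _ _ => rfl)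
      (fun τ h => by rw [hψ0 τ h, zero_smul]) (fun _ _ => rfl) continuous_const (fun _ _ => rfl)
    simpa using h

/-- Varying the multiplier gives the constraint, in differentiated form. -/
theorem IsPairedCritical.constraint_chart (hab : a < b)
    (hL : ContMDiff 𝓘(ℝ, E).tangent 𝓘(ℝ, ℝ) 1 L)
    (hN : ContMDiff 𝓘(ℝ, E) 𝓘(ℝ, F) 2 N) (hz : IsPath a b q₁ q₂ z)
    (hμ : ContinuousOn μ (Icc a b)) (hcrit : IsPairedCritical L N a b q₁ q₂ z μ ι)
    (he : e ∈ IsManifold.maximalAtlas 𝓘(ℝ, E) ∞ M)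
    {s t : ℝ} (hs : a ≤ s) (hst : s < t) (ht : t ≤ b) (hsub : Icc s t ⊆ chartTimes a b z e)
    (c : G) : ∀ τ ∈ Icc s t, inner ℝ (ι c) (fderiv ℝ (fun x => N (e.symm x)) (localPos e z τ)
      (localVelocity e a b z τ)) = 0 := by
  have h1 := (contDiffOn_comp_chart_symm (k := 2) ENat.LEInfty.out he
    hN).continuousOn_fderiv_of_isOpen e.open_target one_le_two
  refine eq_zero_of_forall_integral_mul_eq_zero hst ?_ (fun ψ hψ hψ0 => ?_)
  · exact continuousOn_const.inner ((h1.comp ((hz.continuousOn_localPos he).mono hsub)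
      fun τ hτ => e.map_source (hsub hτ).2).clm_apply
        ((hz.continuousOn_localVelocity hab he).mono hsub))
  · have h := hcrit.integral_eq_zero hab hL hN hz hμ he hs hst.le ht hsub
      (η := fun _ => 0) (η' := fun _ => 0) (β := fun _ => 0) (α := fun _ => 0)
      (ψ := fun τ => ψ τ • c) (fun _ => hasDerivAt_const _ _) continuous_const
      continuous_const continuous_const (fun _ _ => rfl) (fun _ _ => rfl)
      (fun _ _ => rfl) (fun _ _ => rfl) (hψ.smul continuous_const)
      (fun τ h => by rw [hψ0 τ h, zero_smul])
    simpa [inner_smul_left] using h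

/-- Varying the position gives, by the lemma of du Bois-Reymond, the momentum balance. -/
theorem IsPairedCritical.momentumBalance (hab : a < b)
    (hL : ContMDiff 𝓘(ℝ, E).tangent 𝓘(ℝ, ℝ) 1 L)
    (hN : ContMDiff 𝓘(ℝ, E) 𝓘(ℝ, F) 2 N) (hz : IsPath a b q₁ q₂ z)
    (hμ : ContinuousOn μ (Icc a b)) (hcrit : IsPairedCritical L N a b q₁ q₂ z μ ι)
    (he : e ∈ IsManifold.maximalAtlas 𝓘(ℝ, E) ∞ M)
    {s t : ℝ} (hs : a ≤ s) (hst : s ≤ t) (ht : t ≤ b) (hsub : Icc s t ⊆ chartTimes a b z e) :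
    MomentumBalance e L N a b z μ s t := by
  intro ξ
  rcases hst.eq_or_lt with rfl | hlt
  · simp
  refine sub_eq_integral_of_forall_integral_eq_zero hlt
    (((hz.continuousOn_totalForce hab he hL hN hμ).mono hsub).clm_apply continuousOn_const)
    (((hz.continuousOn_totalMomentum he hN hμ).mono hsub).clm_apply continuousOn_const)
    fun η η' hη hη' hη0 hη'0 => ?_
  have h := hcrit.integral_eq_zero hab hL hN hz hμ he hs hst ht hsub
    (η := fun τ => η τ • ξ) (η' := fun τ => η' τ • ξ) (β := fun _ => 0) (α := fun _ => 0)
    (ψ := fun _ => 0) (fun τ => (hη τ).smul_const ξ) (hη'.smul continuous_const)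
    continuous_const continuous_const (fun τ h => by rw [hη0 τ h, zero_smul])
    (fun τ h => by rw [hη'0 τ h, zero_smul])
    (fun _ _ => rfl) (fun _ _ => rfl) continuous_const (fun _ _ => rfl)
  simpa [mul_comm] using h

end Necessity

/-! ### From Stratonovich integrals to the paired action -/

section Conversion

open scoped ContDiff

/-- The space of the values `(γ, g)` of the noise potentials and of the constraint. -/
abbrev PairSpace (m k : ℕ) : Type := EuclideanSpace ℝ (Fin m ⊕ Fin k)

/-- The multiplier `(-w, ℓ)`: the noise enters the paired action like a prescribed multiplier. -/
noncomputable def pairedMultiplier {m k : ℕ} (w : Fin m → ℝ → ℝ) (ℓ : ℝ → EuclideanSpace ℝ (Fin k))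
    (t : ℝ) : PairSpace m k :=
  WithLp.toLp 2 (Sum.elim (fun i => -w i t) (ℓ t))

/-- The map `(γ, g)`. -/
noncomputable def pairedPotential {M : Type*} {m k : ℕ} (γ : Fin m → M → ℝ)
    (g : M → EuclideanSpace ℝ (Fin k)) (x : M) : PairSpace m k :=
  WithLp.toLp 2 (Sum.elim (fun i => γ i x) (g x))

/-- The inclusion `c ↦ (0, c)` of the values of the constraint. -/
noncomputable def constraintIncl (m k : ℕ) : EuclideanSpace ℝ (Fin k) →L[ℝ] PairSpace m k :=
  (EuclideanSpace.equiv (Fin m ⊕ Fin k) ℝ).symm.toContinuousLinearMap.comp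
    (ContinuousLinearMap.pi (Sum.elim (fun _ => 0) fun j => EuclideanSpace.proj j))

/-- The `i`-th noise component of a pair. -/
noncomputable def noiseProj (m k : ℕ) (i : Fin m) : PairSpace m k →L[ℝ] ℝ :=
  EuclideanSpace.proj (Sum.inl i)

/-- The constraint component of a pair. -/
noncomputable def constraintProj (m k : ℕ) : PairSpace m k →L[ℝ] EuclideanSpace ℝ (Fin k) :=
  (EuclideanSpace.equiv (Fin k) ℝ).symm.toContinuousLinearMap.comp
    (ContinuousLinearMap.pi fun j => EuclideanSpace.proj (Sum.inr j))

variable {m k : ℕ} {w : Fin m → ℝ → ℝ} {ℓ : ℝ → EuclideanSpace ℝ (Fin k)}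

theorem inner_pairedMultiplier (t : ℝ) (c : PairSpace m k) :
    inner ℝ (pairedMultiplier w ℓ t) c =
      -∑ i, w i t * noiseProj m k i c + inner ℝ (ℓ t) (constraintProj m k c) := by
  rw [PiLp.inner_apply, PiLp.inner_apply, Fintype.sum_sum_type, ← Finset.sum_neg_distrib]
  refine congrArg₂ (fun x y : ℝ => x + y) (Finset.sum_congr rfl fun i _ => ?_) rfl
  simp [pairedMultiplier, noiseProj]
  ring

theorem inner_constraintIncl (d : EuclideanSpace ℝ (Fin k)) (c : PairSpace m k) :
    inner ℝ (constraintIncl m k d) c = inner ℝ d (constraintProj m k c) := by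
  rw [PiLp.inner_apply, PiLp.inner_apply, Fintype.sum_sum_type]
  simp [constraintIncl, constraintProj]

theorem pairedMultiplier_add_smul (ψ : ℝ → EuclideanSpace ℝ (Fin k)) (ε t : ℝ) :
    pairedMultiplier w (fun t => ℓ t + ε • ψ t) t =
      pairedMultiplier w ℓ t + ε • constraintIncl m k (ψ t) := by
  refine ext_inner_right ℝ fun c => ?_
  rw [inner_add_left, inner_smul_left, inner_constraintIncl, inner_pairedMultiplier,
    inner_pairedMultiplier, inner_add_left, inner_smul_left]
  ring

theorem pairedMultiplier_eq_add (t : ℝ) :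
    pairedMultiplier w ℓ t = pairedMultiplier w 0 t + constraintIncl m k (ℓ t) := by
  have := pairedMultiplier_add_smul (w := w) (ℓ := 0) ℓ 1 t
  simpa using this

theorem continuousOn_pairedMultiplier {T : Set ℝ} (hw : ∀ i, ContinuousOn (w i) T)
    (hℓ : ContinuousOn ℓ T) : ContinuousOn (pairedMultiplier w ℓ) T := by
  refine (PiLp.continuous_toLp 2 _).comp_continuousOn (continuousOn_pi.2 fun i => ?_)
  rcases i with i | j
  · exact (hw i).neg
  · exact (EuclideanSpace.proj (𝕜 := ℝ) j).continuous.comp_continuousOn hℓ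

theorem noiseProj_pairedPotential {M : Type*} {γ : Fin m → M → ℝ}
    {g : M → EuclideanSpace ℝ (Fin k)} (i : Fin m) (x : M) :
    noiseProj m k i (pairedPotential γ g x) = γ i x := rfl

theorem constraintProj_pairedPotential {M : Type*} {γ : Fin m → M → ℝ}
    {g : M → EuclideanSpace ℝ (Fin k)} (x : M) :
    constraintProj m k (pairedPotential γ g x) = g x := rfl

section Manifold

variable {E : Type*} [NormedAddCommGroup E] [NormedSpace ℝ E]
  {M : Type*} [TopologicalSpace M] [ChartedSpace E M]
  {γ : Fin m → M → ℝ} {g : M → EuclideanSpace ℝ (Fin k)}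

theorem contMDiff_pairedPotential {r : WithTop ℕ∞} (hγ : ∀ i, ContMDiff 𝓘(ℝ, E) 𝓘(ℝ, ℝ) r (γ i))
    (hg : ContMDiff 𝓘(ℝ, E) 𝓘(ℝ, EuclideanSpace ℝ (Fin k)) r g) :
    ContMDiff 𝓘(ℝ, E) 𝓘(ℝ, PairSpace m k) r (pairedPotential γ g) := by
  have h1 : ContMDiff 𝓘(ℝ, E) 𝓘(ℝ, Fin m ⊕ Fin k → ℝ) r
      (fun x => (Sum.elim (fun i => γ i x) (g x) : Fin m ⊕ Fin k → ℝ)) := by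
    refine contMDiff_pi_space.2 fun i => ?_
    rcases i with i | j
    · exact hγ i
    · exact (EuclideanSpace.proj (𝕜 := ℝ) j).contDiff.contMDiff.comp hg
  exact (EuclideanSpace.equiv (Fin m ⊕ Fin k) ℝ).symm.contDiff.contMDiff.comp h1

end Manifold

theorem stratonovichIntegral_eq {x w : ℝ → ℝ} {s t : ℝ} (hst : s ≤ t)
    (hx : ContDiffOn ℝ 1 x (Icc s t)) (hw : ContinuousOn w (Icc s t)) :
    stratonovichIntegral x w s t =
      x t * w t - x s * w s - ∫ τ in s..t, w τ * derivWithin x (Icc s t) τ :=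
  (isStratonovichIntegral_stratonovichIntegral hst hx hw).unique hst
    (isStratonovichIntegral_of_contDiffOn hst hx hw)

theorem stratonovichIntegral_self (x w : ℝ → ℝ) (s : ℝ) : stratonovichIntegral x w s s = 0 := by
  rw [stratonovichIntegral_eq le_rfl]
  · simp
  · rw [Icc_self]
    exact (contDiffOn_const (c := x s)).congr (by rintro y rfl; rfl)
  · rw [Icc_self]
    exact continuousOn_singleton _ _

/-- Integration by parts turns the Stratonovich integrals into the pairing with `-w`. -/
theorem integral_inner_pairedMultiplier {s t : ℝ} (hst : s < t)
    (hw : ∀ i, ContinuousOn (w i) (Icc s t)) (hℓ : ContinuousOn ℓ (Icc s t))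
    {c : ℝ → PairSpace m k} (hc : ContDiffOn ℝ 1 c (Icc s t)) :
    ∫ τ in s..t, inner ℝ (pairedMultiplier w ℓ τ) (derivWithin c (Icc s t) τ) =
      ∑ i, (stratonovichIntegral (fun τ => noiseProj m k i (c τ)) (w i) s t
        - (noiseProj m k i (c t) * w i t - noiseProj m k i (c s) * w i s))
      + ∫ τ in s..t, inner ℝ (ℓ τ)
          (derivWithin (fun τ => constraintProj m k (c τ)) (Icc s t) τ) := by
  have hu : UniqueDiffOn ℝ (Icc s t) := uniqueDiffOn_Icc hst
  have hc' : ContinuousOn (derivWithin c (Icc s t)) (Icc s t) :=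
    hc.continuousOn_derivWithin hu le_rfl
  have hd : ∀ τ ∈ Icc s t, HasDerivWithinAt c (derivWithin c (Icc s t) τ) (Icc s t) τ :=
    fun τ hτ => (hc.differentiableOn one_ne_zero τ hτ).hasDerivWithinAt
  have h1 : ∀ i, ∀ τ ∈ Icc s t, derivWithin (fun τ => noiseProj m k i (c τ)) (Icc s t) τ =
      noiseProj m k i (derivWithin c (Icc s t) τ) := fun i τ hτ =>
    ((noiseProj m k i).hasFDerivAt.comp_hasDerivWithinAt τ (hd τ hτ)).derivWithin (hu τ hτ)
  have h2 : ∀ τ ∈ Icc s t, derivWithin (fun τ => constraintProj m k (c τ)) (Icc s t) τ =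
      constraintProj m k (derivWithin c (Icc s t) τ) := fun τ hτ =>
    ((constraintProj m k).hasFDerivAt.comp_hasDerivWithinAt τ (hd τ hτ)).derivWithin (hu τ hτ)
  have ii : ∀ {u : ℝ → ℝ}, ContinuousOn u (Icc s t) → IntervalIntegrable u volume s t :=
    fun hu => ContinuousOn.intervalIntegrable (by rwa [uIcc_of_le hst.le])
  have c1 : ∀ i, ContinuousOn (fun τ => w i τ * noiseProj m k i (derivWithin c (Icc s t) τ))
      (Icc s t) := fun i => (hw i).fun_mul ((noiseProj m k i).continuous.comp_continuousOn hc')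
  have c2 : ContinuousOn (fun τ => (inner ℝ (ℓ τ) (constraintProj m k (derivWithin c (Icc s t) τ))
      : ℝ)) (Icc s t) := hℓ.inner ((constraintProj m k).continuous.comp_continuousOn hc')
  have e1 : ∀ i, stratonovichIntegral (fun τ => noiseProj m k i (c τ)) (w i) s t
        - (noiseProj m k i (c t) * w i t - noiseProj m k i (c s) * w i s) =
      -∫ τ in s..t, w i τ * noiseProj m k i (derivWithin c (Icc s t) τ) := fun i => by
    have hx : ContDiffOn ℝ 1 (fun τ => noiseProj m k i (c τ)) (Icc s t) :=
      (noiseProj m k i).contDiff.comp_contDiffOn hc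
    rw [stratonovichIntegral_eq hst.le hx (hw i),
      intervalIntegral.integral_congr (g := fun τ => w i τ *
        noiseProj m k i (derivWithin c (Icc s t) τ)) fun τ hτ => ?_]
    · ring
    · rw [uIcc_of_le hst.le] at hτ
      simp only [h1 i τ hτ]
  have e2 : ∫ τ in s..t, inner ℝ (ℓ τ)
        (derivWithin (fun τ => constraintProj m k (c τ)) (Icc s t) τ) =
      ∫ τ in s..t, inner ℝ (ℓ τ) (constraintProj m k (derivWithin c (Icc s t) τ)) :=
    intervalIntegral.integral_congr fun τ hτ => by
      rw [uIcc_of_le hst.le] at hτ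
      simp only [h2 τ hτ]
  simp_rw [e1, inner_pairedMultiplier]
  rw [e2, intervalIntegral.integral_add
    (ii (ContinuousOn.fun_neg (continuousOn_finsetSum _ fun i _ => c1 i))) (ii c2),
    intervalIntegral.integral_neg, intervalIntegral.integral_finsetSum fun i _ => ii (c1 i),
    Finset.sum_neg_distrib]

section Manifold

variable {E : Type*} [NormedAddCommGroup E] [NormedSpace ℝ E]
  {M : Type*} [TopologicalSpace M] [ChartedSpace E M] [IsManifold 𝓘(ℝ, E) ∞ M]
  {L : TangentBundle 𝓘(ℝ, E) M → ℝ} {γ : Fin m → M → ℝ} {g : M → EuclideanSpace ℝ (Fin k)}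
  {a b : ℝ} {q₁ q₂ : M} {z : ℝ → PontryaginBundle E M} {e : OpenPartialHomeomorph M E}

/-- The augmented action is the paired action up to the boundary terms `γᵢ(q) wᵢ`, which are the
same for all paths with the given end points. -/
theorem augmentedAction_eq_pairedAction_add (hab : a < b)
    (hγ : ∀ i, ContMDiff 𝓘(ℝ, E) 𝓘(ℝ, ℝ) 1 (γ i))
    (hg : ContMDiff 𝓘(ℝ, E) 𝓘(ℝ, EuclideanSpace ℝ (Fin k)) 1 g)
    (hw : ∀ i, ContinuousOn (w i) (Icc a b)) (hℓ : ContinuousOn ℓ (Icc a b))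
    (hz : IsPath a b q₁ q₂ z) :
    augmentedAction L γ g w a b z ℓ =
      pairedAction L (pairedPotential γ g) a b z (pairedMultiplier w ℓ)
        + ∑ i, (γ i q₂ * w i b - γ i q₁ * w i a) := by
  have hc : ContDiffOn ℝ 1 (fun r => pairedPotential γ g (z r).proj) (Icc a b) :=
    ((contMDiff_pairedPotential hγ hg).comp_contMDiffOn hz.contMDiffOn).contDiffOn
  rw [pairedAction, integral_inner_pairedMultiplier hab hw hℓ hc]
  simp only [noiseProj_pairedPotential, constraintProj_pairedPotential, augmentedAction, action,
    Finset.sum_sub_distrib, hz.left, hz.right]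
  ring

/-- The momentum equation of the constrained, stochastic HP equations is the momentum balance. -/
theorem momentum_iff_momentumBalance (hab : a < b)
    (hL : ContMDiff 𝓘(ℝ, E).tangent 𝓘(ℝ, ℝ) 1 L)
    (hγ : ∀ i, ContMDiff 𝓘(ℝ, E) 𝓘(ℝ, ℝ) 2 (γ i))
    (hg : ContMDiff 𝓘(ℝ, E) 𝓘(ℝ, EuclideanSpace ℝ (Fin k)) 2 g)
    (hw : ∀ i, ContinuousOn (w i) (Icc a b)) (hℓ : ContinuousOn ℓ (Icc a b))
    (hz : IsPath a b q₁ q₂ z) (he : e ∈ IsManifold.maximalAtlas 𝓘(ℝ, E) ∞ M)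
    {s t : ℝ} (hs : a ≤ s) (hst : s < t) (ht : t ≤ b) (hsub : Icc s t ⊆ chartTimes a b z e) :
    MomentumBalance e L (pairedPotential γ g) a b z (pairedMultiplier w ℓ) s t ↔
    ∀ ξ : E,
    localMom e z t ξ - localMom e z s ξ =
      (∫ τ in s..t, fderiv ℝ (fun x => localLagrangian L e x (localVel e z τ)) (localPos e z τ) ξ)
      + ∑ i, stratonovichIntegral
          (fun τ => fderiv ℝ (fun x => γ i (e.symm x)) (localPos e z τ) ξ) (w i) s t
      + integralD (fun t => -ℓ t)
          (fun τ => fderiv ℝ (fun x => g (e.symm x)) (localPos e z τ) ξ) s t := by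
  have hN : ContMDiff 𝓘(ℝ, E) 𝓘(ℝ, PairSpace m k) 2 (pairedPotential γ g) :=
    contMDiff_pairedPotential hγ hg
  have hsI : Icc s t ⊆ Icc a b := Icc_subset_Icc hs ht
  have hu : UniqueDiffOn ℝ (Icc s t) := uniqueDiffOn_Icc hst
  have hμ := continuousOn_pairedMultiplier hw hℓ
  have hN1 := contDiffOn_comp_chart_symm (k := 2) ENat.LEInfty.out he hN
  have hN2 := hN1.fderiv_of_isOpen e.open_target one_add_one_eq_two.le
  have hX : ∀ τ ∈ Icc s t, localPos e z τ ∈ e.target := fun τ hτ => e.map_source (hsub hτ).2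
  have cX := (hz.continuousOn_localPos he).mono hsub
  have cV := (hz.continuousOn_localVelocity hab he).mono hsub
  have cD2 : ContinuousOn (fun τ => fderiv ℝ (fderiv ℝ (fun x => pairedPotential γ g (e.symm x)))
      (localPos e z τ) (localVelocity e a b z τ)) (Icc s t) :=
    ((hN2.continuousOn_fderiv_of_isOpen e.open_target le_rfl).comp cX hX).clm_apply cV
  refine forall_congr' fun ξ => ?_
  set c : ℝ → PairSpace m k := fun τ =>
    fderiv ℝ (fun x => pairedPotential γ g (e.symm x)) (localPos e z τ) ξ with hcdef
  have hcd : ∀ τ ∈ Icc s t, HasDerivWithinAt c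
      (fderiv ℝ (fderiv ℝ (fun x => pairedPotential γ g (e.symm x)))
      (localPos e z τ) (localVelocity e a b z τ) ξ) (Icc s t) τ := fun τ hτ => by
    have h1 := ((hN2.contDiffAt (e.open_target.mem_nhds (hX τ hτ))).differentiableAt
      one_ne_zero).hasFDerivAt
    have h2 := h1.comp_hasDerivWithinAt τ
      ((hz.hasDerivWithinAt_localPos he (hsub hτ).1 (hsub hτ).2).mono hsI)
    have h3 := h2.clm_apply (hasDerivWithinAt_const τ (Icc s t) ξ)
    simpa using h3
  have hc' : ∀ τ ∈ Icc s t, derivWithin c (Icc s t) τ =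
      fderiv ℝ (fderiv ℝ (fun x => pairedPotential γ g (e.symm x)))
      (localPos e z τ) (localVelocity e a b z τ) ξ := fun τ hτ => (hcd τ hτ).derivWithin (hu τ hτ)
  have hc : ContDiffOn ℝ 1 c (Icc s t) := by
    rw [show (1 : WithTop ℕ∞) = 0 + 1 by simp, contDiffOn_succ_iff_derivWithin hu]
    refine ⟨fun τ hτ => (hcd τ hτ).differentiableWithinAt, by simp, contDiffOn_zero.2 ?_⟩
    exact (cD2.clm_apply continuousOn_const).congr hc'
  have hNd : ∀ τ ∈ Icc s t, DifferentiableAt ℝ (fun x => pairedPotential γ g (e.symm x))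
      (localPos e z τ) := fun τ hτ =>
    (hN1.contDiffAt (e.open_target.mem_nhds (hX τ hτ))).differentiableAt two_ne_zero
  have pγ : ∀ i, ∀ τ ∈ Icc s t, fderiv ℝ (fun x => γ i (e.symm x)) (localPos e z τ) ξ =
      noiseProj m k i (c τ) := fun i τ hτ => DFunLike.congr_fun
    ((noiseProj m k i).hasFDerivAt.comp _ (hNd τ hτ).hasFDerivAt).fderiv ξ
  have pg : ∀ τ ∈ Icc s t, fderiv ℝ (fun x => g (e.symm x)) (localPos e z τ) ξ =
      constraintProj m k (c τ) := fun τ hτ => DFunLike.congr_fun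
    ((constraintProj m k).hasFDerivAt.comp _ (hNd τ hτ).hasFDerivAt).fderiv ξ
  have ms : s ∈ Icc s t := left_mem_Icc.2 hst.le
  have mt : t ∈ Icc s t := right_mem_Icc.2 hst.le
  have e1 : ∀ i, stratonovichIntegral
      (fun τ => fderiv ℝ (fun x => γ i (e.symm x)) (localPos e z τ) ξ) (w i) s t =
      stratonovichIntegral (fun τ => noiseProj m k i (c τ)) (w i) s t := fun i => by
    have hx : ContDiffOn ℝ 1 (fun τ => noiseProj m k i (c τ)) (Icc s t) :=
      (noiseProj m k i).contDiff.comp_contDiffOn hc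
    have hx' := hx.congr (pγ i)
    rw [stratonovichIntegral_eq hst.le hx' ((hw i).mono hsI),
      stratonovichIntegral_eq hst.le hx ((hw i).mono hsI), pγ i s ms, pγ i t mt]
    refine congrArg _ (intervalIntegral.integral_congr fun τ hτ => ?_)
    rw [uIcc_of_le hst.le] at hτ
    simp only [derivWithin_congr (pγ i) (pγ i τ hτ)]
  have e2 : integralD (fun t => -ℓ t)
      (fun τ => fderiv ℝ (fun x => g (e.symm x)) (localPos e z τ) ξ) s t =
      -(inner ℝ (ℓ t) (constraintProj m k (c t)) - inner ℝ (ℓ s) (constraintProj m k (c s)))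
      + ∫ τ in s..t, inner ℝ (ℓ τ)
          (derivWithin (fun τ => constraintProj m k (c τ)) (Icc s t) τ) := by
    rw [integralD, pg s ms, pg t mt, intervalIntegral.integral_congr (g := fun τ =>
      -inner ℝ (ℓ τ) (derivWithin (fun τ => constraintProj m k (c τ)) (Icc s t) τ)) fun τ hτ => ?_]
    · rw [intervalIntegral.integral_neg, inner_neg_left, inner_neg_left]
      ring
    · rw [uIcc_of_le hst.le] at hτ
      simp only [derivWithin_congr pg (pg τ hτ), inner_neg_left]
  have e3 := integral_inner_pairedMultiplier hst (fun i => (hw i).mono hsI) (hℓ.mono hsI) hc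
  have e4 : ∀ τ, totalMomentum e (pairedPotential γ g) z (pairedMultiplier w ℓ) τ ξ =
      localMom e z τ ξ + inner ℝ (pairedMultiplier w ℓ τ) (c τ) := fun τ => rfl
  have e5 : ∫ τ in s..t, totalForce e L (pairedPotential γ g) a b z (pairedMultiplier w ℓ) τ ξ =
      (∫ τ in s..t, fderiv ℝ (fun x => localLagrangian L e x (localVel e z τ)) (localPos e z τ) ξ)
      + ∫ τ in s..t, inner ℝ (pairedMultiplier w ℓ τ) (derivWithin c (Icc s t) τ) := by
    rw [← intervalIntegral.integral_add]
    · refine intervalIntegral.integral_congr fun τ hτ => ?_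
      rw [uIcc_of_le hst.le] at hτ
      simp only [hc' τ hτ]
      rfl
    · exact ContinuousOn.intervalIntegrable (by
        rw [uIcc_of_le hst.le]
        exact ((hz.continuousOn_force he hL).mono hsub).clm_apply continuousOn_const)
    · exact ContinuousOn.intervalIntegrable (by
        rw [uIcc_of_le hst.le]
        exact (hμ.mono hsI).inner (hc.continuousOn_derivWithin hu le_rfl))
  rw [e4, e4, e5, e3, e2, inner_pairedMultiplier, inner_pairedMultiplier, Finset.sum_congr rfl
    fun i _ => e1 i]
  simp only [Finset.sum_sub_distrib, mul_comm (w _ _)]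
  constructor <;> intro h <;> linarith

end Manifold

end Conversion

/-! ### Critical points of the augmented action -/

section Critical

open scoped ContDiff

variable {m k : ℕ} {w : Fin m → ℝ → ℝ} {ℓ : ℝ → EuclideanSpace ℝ (Fin k)}
  {E : Type*} [NormedAddCommGroup E] [NormedSpace ℝ E]
  {M : Type*} [TopologicalSpace M] [ChartedSpace E M] [IsManifold 𝓘(ℝ, E) ∞ M]
  {L : TangentBundle 𝓘(ℝ, E) M → ℝ} {γ : Fin m → M → ℝ} {g : M → EuclideanSpace ℝ (Fin k)}
  {a b : ℝ} {q₁ q₂ : M} {z : ℝ → PontryaginBundle E M} {e : OpenPartialHomeomorph M E}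

/-- Around each time at which a curve is in a chart it stays there for a nontrivial interval. -/
theorem exists_Icc_subset_chartTimes (hab : a < b) (hz : IsPath a b q₁ q₂ z) {t : ℝ}
    (ht : t ∈ Icc a b) (hte : (z t).proj ∈ e.source) :
    ∃ s u, a ≤ s ∧ s < u ∧ u ≤ b ∧ t ∈ Icc s u ∧ Icc s u ⊆ chartTimes a b z e := by
  have h1 : chartTimes a b z e ∈ 𝓝[Icc a b] t := inter_mem self_mem_nhdsWithin
    (hz.contMDiffOn.continuousOn t ht (e.open_source.mem_nhds hte))
  obtain ⟨r, hr, h2⟩ := Metric.mem_nhdsWithin_iff.1 h1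
  refine ⟨max a (t - r / 2), min b (t + r / 2), le_max_left _ _, ?_, min_le_left _ _,
    ⟨max_le ht.1 (by linarith), le_min ht.2 (by linarith)⟩, fun τ hτ => h2 ⟨?_, ?_⟩⟩
  · refine max_lt (lt_min hab (by linarith [ht.1])) (lt_min (by linarith [ht.2]) (by linarith))
  · rw [Real.ball_eq_Ioo]
    exact ⟨by linarith [hτ.1, le_max_right a (t - r / 2)],
      by linarith [hτ.2, min_le_right b (t + r / 2)]⟩
  · exact ⟨(le_max_left _ _).trans hτ.1, hτ.2.trans (min_le_left _ _)⟩

/-- A path can be cut into finitely many pieces that each lie in a prescribed chart. -/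
theorem IsPath.exists_partition (hab : a < b) (hz : IsPath a b q₁ q₂ z)
    (c : M → OpenPartialHomeomorph M E) (hc : ∀ t ∈ Icc a b, (z t).proj ∈ (c (z t).proj).source) :
    ∃ (T : ℕ → ℝ) (r : ℕ), Monotone T ∧ T 0 = a ∧ T r = b ∧
      ∀ n, ∃ τ ∈ Icc a b, Icc (T n) (T (n + 1)) ⊆ chartTimes a b z (c (z τ).proj) := by
  have hq := continuousOn_iff_continuous_domRestrict.1 hz.contMDiffOn.continuousOn
  obtain ⟨T, hT0, hTm, ⟨r, hr⟩, hT⟩ := exists_monotone_Icc_subset_open_cover_Icc hab.le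
    (c := fun τ : Icc a b => (fun t : Icc a b => (z t).proj) ⁻¹' (c (z τ).proj).source)
    (fun τ => (c (z τ).proj).open_source.preimage hq)
    fun t _ => mem_iUnion.2 ⟨t, hc t t.2⟩
  refine ⟨fun n => T n, r, fun i j hij => hTm hij, hT0, hr r le_rfl, fun n => ?_⟩
  obtain ⟨τ, hτ⟩ := hT n
  refine ⟨τ, τ.2, fun t ht => ?_⟩
  have htI : t ∈ Icc a b := ⟨(T n).2.1.trans ht.1, ht.2.trans (T (n + 1)).2.2⟩
  exact ⟨htI, hτ (show (⟨t, htI⟩ : Icc a b) ∈ Icc (T n) (T (n + 1)) from ht)⟩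

/-- The momentum balance on the pieces of a partition, for one chart on each piece, suffices for
criticality. -/
theorem isAugmentedCritical_of_momentumBalance [CompleteSpace E] (hab : a < b)
    (hL : ContMDiff 𝓘(ℝ, E).tangent 𝓘(ℝ, ℝ) 1 L)
    (hγ : ∀ i, ContMDiff 𝓘(ℝ, E) 𝓘(ℝ, ℝ) 2 (γ i))
    (hg : ContMDiff 𝓘(ℝ, E) 𝓘(ℝ, EuclideanSpace ℝ (Fin k)) 2 g)
    (hw : ∀ i, ContinuousOn (w i) (Icc a b)) (hℓ : ContinuousOn ℓ (Icc a b))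
    (hz : IsPath a b q₁ q₂ z)
    (hkin : ∀ t ∈ Icc a b, velocity a b (fun r => (z r).proj) t = (z t).2.1)
    (hleg : ∀ t ∈ Icc a b, (z t).2.2 = fiberDeriv L (z t).proj (z t).2.1)
    (hcon : ∀ t ∈ Icc a b, g (z t).proj = 0)
    {T : ℕ → ℝ} (hT : Monotone T) (hT0 : T 0 = a) {r : ℕ} (hTr : T r = b)
    (hbal : ∀ n < r, ∃ e ∈ IsManifold.maximalAtlas 𝓘(ℝ, E) ∞ M,
      (∀ τ ∈ Icc (T n) (T (n + 1)), (z τ).proj ∈ e.source) ∧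
      ∀ τ ∈ Icc (T n) (T (n + 1)),
        MomentumBalance e L (pairedPotential γ g) a b z (pairedMultiplier w ℓ) (T n) τ) :
    IsAugmentedCritical L γ g w a b q₁ q₂ z ℓ := by
  refine ⟨hz, hℓ, fun δ Z Λ hZ hΛ hΛ0 => ?_⟩
  have hN : ContMDiff 𝓘(ℝ, E) 𝓘(ℝ, PairSpace m k) 2 (pairedPotential γ g) :=
    contMDiff_pairedPotential hγ hg
  have hΛ1 : C1FamilyOn (Ioo (-δ) δ ×ˢ Icc a b) Λ :=
    mc1FamilyOn_iff_c1FamilyOn.1 (isC1Family_iff.1 hΛ)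
  have hc0 : C1FamilyOn (Ioo (-δ) δ ×ˢ Icc a b)
      (fun _ t => pairedMultiplier w (0 : ℝ → EuclideanSpace ℝ (Fin k)) t) := by
    have := c1FamilyOn_affine (D := Ioo (-δ) δ ×ˢ Icc a b)
      (continuousOn_pairedMultiplier hw (ℓ := (0 : ℝ → EuclideanSpace ℝ (Fin k)))
        continuousOn_const) (continuousOn_const (c := (0 : PairSpace m k))) fun y hy => hy.2
    simpa using this
  have hΛ2 : C1FamilyOn (Ioo (-δ) δ ×ˢ Icc a b) (fun ε => pairedMultiplier w (Λ ε)) :=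
    ((hc0.prodMk hΛ1).comp_contDiff (Φ := fun c => c.1 + constraintIncl m k c.2)
      (by fun_prop)).congr (isParamOpen_prod _ _) fun x _ => pairedMultiplier_eq_add _
  have h0 : (0 : ℝ) ∈ Ioo (-δ) δ := ⟨neg_lt_zero.2 hZ.pos, hZ.pos⟩
  have hdΛ : ∀ t ∈ Icc a b, deriv (fun ε => pairedMultiplier w (Λ ε) t) 0 =
      constraintIncl m k (deriv (Λ · t) 0) := fun t ht => by
    have h1 : (fun ε => pairedMultiplier w (Λ ε) t) = fun ε =>
        pairedMultiplier w 0 t + constraintIncl m k (Λ ε t) :=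
      funext fun ε => pairedMultiplier_eq_add t
    rw [h1]
    exact (((constraintIncl m k).hasFDerivAt.comp_hasDerivAt (0 : ℝ)
      (hΛ1.hasDerivAt ⟨h0, ht⟩)).const_add _).deriv
  have hcon' : ∀ t ∈ Icc a b, constraintProj m k
      (derivWithin (fun r => pairedPotential γ g (z r).proj) (Icc a b) t) = 0 := fun t ht => by
    have hd : DifferentiableOn ℝ (fun r => pairedPotential γ g (z r).proj) (Icc a b) :=
      (((hN.of_le one_le_two).comp_contMDiffOn hz.contMDiffOn).contDiffOn).differentiableOn
        one_ne_zero
    have h1 := (constraintProj m k).hasFDerivAt.comp_hasDerivWithinAt t (hd t ht).hasDerivWithinAt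
    refine (uniqueDiffOn_Icc hab t ht).eq_deriv _ h1 ?_
    exact (hasDerivWithinAt_const t (Icc a b) (0 : EuclideanSpace ℝ (Fin k))).congr hcon (hcon t ht)
  have key := hasDerivAt_pairedAction_zero hab hL hN hz (continuousOn_pairedMultiplier hw hℓ) hkin
    hleg hT hT0 hTr hbal hZ hΛ2
    (fun t ht => by simp only [pairedMultiplier, hΛ0 t ht]) (fun t ht => by
      rw [hdΛ t ht, inner_constraintIncl, hcon' t ht, inner_zero_right])
  refine (key.add_const (∑ i, (γ i q₂ * w i b - γ i q₁ * w i a))).congr_of_eventuallyEq ?_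
  filter_upwards [isOpen_Ioo.mem_nhds h0] with ε hε
  refine augmentedAction_eq_pairedAction_add hab (fun i => (hγ i).of_le one_le_two)
    (hg.of_le one_le_two) hw ?_ (hZ.isPath ε hε)
  exact hΛ1.continuousOn.comp (Continuous.prodMk_right ε).continuousOn fun t ht => ⟨hε, ht⟩

/-- Of the multiplier `(-w, ℓ)` only the component `ℓ` is varied. -/
theorem IsAugmentedCritical.isPairedCritical (hab : a < b)
    (hγ : ∀ i, ContMDiff 𝓘(ℝ, E) 𝓘(ℝ, ℝ) 1 (γ i))
    (hg : ContMDiff 𝓘(ℝ, E) 𝓘(ℝ, EuclideanSpace ℝ (Fin k)) 1 g)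
    (hw : ∀ i, ContinuousOn (w i) (Icc a b))
    (h : IsAugmentedCritical L γ g w a b q₁ q₂ z ℓ) :
    IsPairedCritical L (pairedPotential γ g) a b q₁ q₂ z (pairedMultiplier w ℓ)
      (constraintIncl m k) := by
  intro δ Z hZ ψ hψ
  have h0 : (0 : ℝ) ∈ Ioo (-δ) δ := ⟨neg_lt_zero.2 hZ.pos, hZ.pos⟩
  have h1 := h.2.2 δ Z (fun ε t => ℓ t + ε • ψ t) hZ
    (isC1Family_iff.2 (mc1FamilyOn_iff_c1FamilyOn.2
      (c1FamilyOn_affine h.2.1 hψ.continuousOn fun y hy => hy.2))) (fun t _ => by simp)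
  refine (h1.sub_const (∑ i, (γ i q₂ * w i b - γ i q₁ * w i a))).congr_of_eventuallyEq ?_
  filter_upwards [isOpen_Ioo.mem_nhds h0] with ε hε
  rw [augmentedAction_eq_pairedAction_add (ℓ := fun t => ℓ t + ε • ψ t) hab hγ hg hw
    (h.2.1.add (hψ.const_smul ε).continuousOn) (hZ.isPath ε hε), add_sub_cancel_right]
  exact congrArg _ (funext fun t => (pairedMultiplier_add_smul ψ ε t).symm)

theorem IsAugmentedCritical.momentumBalance (hab : a < b)
    (hL : ContMDiff 𝓘(ℝ, E).tangent 𝓘(ℝ, ℝ) 1 L)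
    (hγ : ∀ i, ContMDiff 𝓘(ℝ, E) 𝓘(ℝ, ℝ) 2 (γ i))
    (hg : ContMDiff 𝓘(ℝ, E) 𝓘(ℝ, EuclideanSpace ℝ (Fin k)) 2 g)
    (hw : ∀ i, ContinuousOn (w i) (Icc a b))
    (h : IsAugmentedCritical L γ g w a b q₁ q₂ z ℓ)
    (he : e ∈ IsManifold.maximalAtlas 𝓘(ℝ, E) ∞ M)
    {s t : ℝ} (hs : a ≤ s) (hst : s ≤ t) (ht : t ≤ b) (hsub : Icc s t ⊆ chartTimes a b z e) :
    MomentumBalance e L (pairedPotential γ g) a b z (pairedMultiplier w ℓ) s t :=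
  (h.isPairedCritical hab (fun i => (hγ i).of_le one_le_two) (hg.of_le one_le_two)
    hw).momentumBalance hab hL (contMDiff_pairedPotential hγ hg) h.1
    (continuousOn_pairedMultiplier hw h.2.1) he hs hst ht hsub

/-- A critical point of the augmented action satisfies the constrained, stochastic HP equations. -/
theorem IsAugmentedCritical.constrainedHPEquations (hab : a < b)
    (hL : ContMDiff 𝓘(ℝ, E).tangent 𝓘(ℝ, ℝ) 1 L)
    (hγ : ∀ i, ContMDiff 𝓘(ℝ, E) 𝓘(ℝ, ℝ) 2 (γ i))
    (hg : ContMDiff 𝓘(ℝ, E) 𝓘(ℝ, EuclideanSpace ℝ (Fin k)) 2 g)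
    (hw : ∀ i, ContinuousOn (w i) (Icc a b)) (hq₁ : g q₁ = 0)
    (h : IsAugmentedCritical L γ g w a b q₁ q₂ z ℓ) :
    ConstrainedHPEquations L γ g w a b z (fun t => -ℓ t) := by
  have hN : ContMDiff 𝓘(ℝ, E) 𝓘(ℝ, PairSpace m k) 2 (pairedPotential γ g) :=
    contMDiff_pairedPotential hγ hg
  have hcrit := h.isPairedCritical hab (fun i => (hγ i).of_le one_le_two) (hg.of_le one_le_two) hw
  have hz := h.1
  have hμ := continuousOn_pairedMultiplier hw h.2.1
  have hat : ∀ t : ℝ, chartAt E (z t).proj ∈ IsManifold.maximalAtlas 𝓘(ℝ, E) ∞ M := fun t =>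
    IsManifold.chart_mem_maximalAtlas _
  refine ⟨fun t ht => ?_, fun e he s t hs hst ht hq => ?_, fun t ht => ?_, ?_⟩
  · obtain ⟨s, u, hs, hsu, hu, htsu, hsub⟩ :=
      exists_Icc_subset_chartTimes hab hz ht (mem_chart_source E (z t).proj)
    have h1 := hcrit.kinematic_chart hab hL hN hz hμ (hat t) hs hsu hu hsub t htsu
    exact (localVelocity_eq_localVel_iff (hat t) (mem_chart_source E _)).1 h1
  · have hsub : Icc s t ⊆ chartTimes a b z e := fun τ hτ =>
      ⟨⟨hs.trans hτ.1, hτ.2.trans ht⟩, hq τ hτ⟩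
    rcases hst.eq_or_lt with rfl | hlt
    · intro ξ
      simp [stratonovichIntegral_self, integralD]
    · exact (momentum_iff_momentumBalance hab hL hγ hg hw h.2.1 hz he hs hlt ht hsub).1
        (h.momentumBalance hab hL hγ hg hw he hs hst ht hsub)
  · obtain ⟨s, u, hs, hsu, hu, htsu, hsub⟩ :=
      exists_Icc_subset_chartTimes hab hz ht (mem_chart_source E (z t).proj)
    exact (localMom_eq_fderiv_iff (hat t) hL (mem_chart_source E _)).1
      (hcrit.legendre_chart hab hL hN hz hμ (hat t) hs hsu hu hsub t htsu)
  · have hd : DifferentiableOn ℝ (fun r => pairedPotential γ g (z r).proj) (Icc a b) :=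
      (((hN.of_le one_le_two).comp_contMDiffOn hz.contMDiffOn).contDiffOn).differentiableOn
        one_ne_zero
    -- Criticality gives `d/dt g(q) = 0` only; the constraint holds because it does at `q₁`.
    have h1 : ∀ t ∈ Icc a b, HasDerivWithinAt (fun r => g (z r).proj) 0 (Icc a b) t := by
      intro t ht
      have h2 : HasDerivWithinAt (fun r => g (z r).proj) _ (Icc a b) t :=
        (constraintProj m k).hasFDerivAt.comp_hasDerivWithinAt t (hd t ht).hasDerivWithinAt
      obtain ⟨s, u, hs, hsu, hu, htsu, hsub⟩ :=
        exists_Icc_subset_chartTimes hab hz ht (mem_chart_source E (z t).proj)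
      have h3 := hz.derivWithin_comp hab (hat t) (hN.of_le one_le_two) ht (mem_chart_source E _)
      have h4 : constraintProj m k
          (derivWithin (fun r => pairedPotential γ g (z r).proj) (Icc a b) t) = 0 := by
        refine ext_inner_left ℝ fun c => ?_
        rw [h3, ← inner_constraintIncl, inner_zero_right]
        exact hcrit.constraint_chart hab hL hN hz hμ (hat t) hs hsu hu hsub c t htsu
      rwa [h4] at h2
    intro t ht
    have h5 := constant_of_derivWithin_zero (fun t ht => (h1 t ht).differentiableWithinAt)
      (fun t ht => (h1 t (Ico_subset_Icc_self ht)).derivWithin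
        (uniqueDiffOn_Icc hab t (Ico_subset_Icc_self ht))) t ht
    rw [h5, hz.left, hq₁]

/-- The momentum equation, for the multiplier `-ℓ`, without stochastic integrals. -/
theorem ConstrainedHPEquations.momentumBalance (hab : a < b)
    (hL : ContMDiff 𝓘(ℝ, E).tangent 𝓘(ℝ, ℝ) 1 L)
    (hγ : ∀ i, ContMDiff 𝓘(ℝ, E) 𝓘(ℝ, ℝ) 2 (γ i))
    (hg : ContMDiff 𝓘(ℝ, E) 𝓘(ℝ, EuclideanSpace ℝ (Fin k)) 2 g)
    (hw : ∀ i, ContinuousOn (w i) (Icc a b)) (hℓ : ContinuousOn ℓ (Icc a b))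
    (hz : IsPath a b q₁ q₂ z) (h : ConstrainedHPEquations L γ g w a b z (fun t => -ℓ t))
    (he : e ∈ IsManifold.maximalAtlas 𝓘(ℝ, E) ∞ M)
    {s t : ℝ} (hs : a ≤ s) (hst : s ≤ t) (ht : t ≤ b) (hsub : Icc s t ⊆ chartTimes a b z e) :
    MomentumBalance e L (pairedPotential γ g) a b z (pairedMultiplier w ℓ) s t := by
  rcases hst.eq_or_lt with rfl | hlt
  · intro ξ
    simp
  · exact (momentum_iff_momentumBalance hab hL hγ hg hw hℓ hz he hs hlt ht hsub).2
      (h.momentum e he s t hs hst ht fun τ hτ => (hsub hτ).2)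

/-- The critical points of the augmented action are the solutions of the constrained, stochastic HP
equations; the multipliers in the two descriptions have opposite signs. -/
theorem isAugmentedCritical_iff [CompleteSpace E] (hab : a < b)
    (hL : ContMDiff 𝓘(ℝ, E).tangent 𝓘(ℝ, ℝ) 1 L)
    (hγ : ∀ i, ContMDiff 𝓘(ℝ, E) 𝓘(ℝ, ℝ) 2 (γ i))
    (hg : ContMDiff 𝓘(ℝ, E) 𝓘(ℝ, EuclideanSpace ℝ (Fin k)) 2 g)
    (hw : ∀ i, ContinuousOn (w i) (Icc a b)) (hq₁ : g q₁ = 0) :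
    IsAugmentedCritical L γ g w a b q₁ q₂ z ℓ ↔ IsPath a b q₁ q₂ z ∧ ContinuousOn ℓ (Icc a b) ∧
      ConstrainedHPEquations L γ g w a b z (fun t => -ℓ t) := by
  refine ⟨fun h => ⟨h.1, h.2.1, h.constrainedHPEquations hab hL hγ hg hw hq₁⟩, ?_⟩
  rintro ⟨hz, hℓ, h⟩
  obtain ⟨T, r, hT, hT0, hTr, hsub⟩ := hz.exists_partition hab (chartAt E)
    fun t _ => mem_chart_source E _
  refine isAugmentedCritical_of_momentumBalance hab hL hγ hg hw hℓ hz h.kinematic h.legendre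
    h.constraint hT hT0 hTr fun n hn => ?_
  obtain ⟨τ, -, hτ⟩ := hsub n
  refine ⟨chartAt E (z τ).proj, IsManifold.chart_mem_maximalAtlas _, fun t ht => (hτ ht).2,
    fun t ht => ?_⟩
  exact h.momentumBalance hab hL hγ hg hw hℓ hz (IsManifold.chart_mem_maximalAtlas _)
    (hT0 ▸ hT (Nat.zero_le n)) ht.1 (ht.2.trans (hTr ▸ hT hn))
    ((Icc_subset_Icc_right ht.2).trans hτ)

/-- When the constraint holds identically, the augmented action is the action, and its critical
points are the critical points of the action together with arbitrary multipliers. -/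
theorem isCriticalPath_iff_isAugmentedCritical (hg : ∀ x, g x = 0) (hℓ : ContinuousOn ℓ (Icc a b)) :
    IsCriticalPath L γ w a b q₁ q₂ z ↔ IsAugmentedCritical L γ g w a b q₁ q₂ z ℓ := by
  have key : ∀ z ℓ, augmentedAction L γ g w a b z ℓ = action L γ w a b z := fun z ℓ => by
    simp [augmentedAction, hg]
  simp only [IsAugmentedCritical, IsCriticalPath, key]
  refine ⟨fun h => ⟨h.1, hℓ, fun δ Z _ hZ _ _ => h.2 δ Z hZ⟩, fun h => ⟨h.1, fun δ Z hZ => ?_⟩⟩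
  have hc : C1FamilyOn (Ioo (-δ) δ ×ˢ Icc a b) (fun _ : ℝ => ℓ) := by
    simpa using c1FamilyOn_affine (D := Ioo (-δ) δ ×ˢ Icc a b) hℓ
      (continuousOn_const (c := (0 : EuclideanSpace ℝ (Fin k)))) fun y hy => hy.2
  exact h.2.2 δ Z (fun _ => ℓ) hZ (isC1Family_iff.2 (mc1FamilyOn_iff_c1FamilyOn.2 hc))
    fun _ _ => rfl

end Critical

/-! ### Slice charts, and restriction to a submanifold -/

section Slice

open scoped ContDiff

variable {E : Type*} [NormedAddCommGroup E] [NormedSpace ℝ E]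
  {M : Type*} [TopologicalSpace M] [ChartedSpace E M]
  {E' : Type*} [NormedAddCommGroup E'] [NormedSpace ℝ E']
  {S : Type*} [TopologicalSpace S] [ChartedSpace E' S]
  {F : Type*} [NormedAddCommGroup F] [InnerProductSpace ℝ F]
  {j : S → M} {φ : OpenPartialHomeomorph S E'} {ψ : OpenPartialHomeomorph M E} {A : E' →L[ℝ] E}

/-- In the charts `φ` and `ψ` the map `j` is the linear map `A`, which has a left inverse. -/
structure IsSliceChart (j : S → M) (φ : OpenPartialHomeomorph S E')
    (ψ : OpenPartialHomeomorph M E) (A : E' →L[ℝ] E) : Prop where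
  mem_left : φ ∈ IsManifold.maximalAtlas 𝓘(ℝ, E') ∞ S
  mem_right : ψ ∈ IsManifold.maximalAtlas 𝓘(ℝ, E) ∞ M
  map_source : ∀ x ∈ φ.source, j x ∈ ψ.source
  eq : ∀ x ∈ φ.source, ψ (j x) = A (φ x)
  exists_retraction : ∃ P : E →L[ℝ] E', ∀ u, P (A u) = u

theorem IsSliceChart.injective (h : IsSliceChart j φ ψ A) : Function.Injective A := by
  obtain ⟨P, hP⟩ := h.exists_retraction
  exact Function.LeftInverse.injective hP

/-- An immersion has slice charts. -/
theorem exists_isSliceChart (hj : IsImmersion 𝓘(ℝ, E') 𝓘(ℝ, E) ∞ j) (x : S) :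
    ∃ φ ψ A, x ∈ φ.source ∧ IsSliceChart (E := E) (E' := E') j φ ψ A := by
  have h := hj.isImmersionAt x
  refine ⟨h.domChart, h.codChart, (h.equiv : E' × h.complement →L[ℝ] E).comp
    (ContinuousLinearMap.inl ℝ E' h.complement), h.mem_domChart_source,
    h.domChart_mem_maximalAtlas, h.codChart_mem_maximalAtlas, h.source_subset_preimage_source,
    fun x hx => ?_, (ContinuousLinearMap.fst ℝ E' h.complement).comp
      (h.equiv.symm : E →L[ℝ] E' × h.complement), fun u => by simp⟩
  have hm : h.domChart x ∈ (h.domChart.extend 𝓘(ℝ, E')).target := by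
    simpa using h.domChart.map_source hx
  have h1 := h.writtenInCharts hm
  simpa [h.domChart.left_inv hx] using h1

variable (j) in
/-- The differential of `j` at `x`, as a linear map between the model spaces. -/
noncomputable def modelDiff (E E' : Type*) [NormedAddCommGroup E] [NormedSpace ℝ E]
    [NormedAddCommGroup E'] [NormedSpace ℝ E'] [ChartedSpace E M] [ChartedSpace E' S] (x : S) :
    E' →L[ℝ] E := mfderiv 𝓘(ℝ, E') 𝓘(ℝ, E) j x

/-- In slice charts the differential of `j` is the linear map `A`. -/
theorem IsSliceChart.chartDiff_modelDiff (hjd : MDifferentiable 𝓘(ℝ, E') 𝓘(ℝ, E) j)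
    (h : IsSliceChart j φ ψ A) {x : S} (hx : x ∈ φ.source) (v : E') :
    chartDiff ψ (j x) (modelDiff j E E' x v) = A (chartDiff φ x v) := by
  have h1 : HasMFDerivAt 𝓘(ℝ, E') 𝓘(ℝ, E) (ψ ∘ j) x
      ((chartDiff ψ (j x) : E →L[ℝ] E).comp (modelDiff j E E' x) : E' →L[ℝ] E) :=
    ((mdifferentiable_of_mem_maximalAtlas h.mem_right).mdifferentiableAt
      (h.map_source x hx)).hasMFDerivAt.comp x (hjd x).hasMFDerivAt
  have hA : HasMFDerivAt 𝓘(ℝ, E') 𝓘(ℝ, E) A (φ x) A := A.hasMFDerivAt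
  have h2 : HasMFDerivAt 𝓘(ℝ, E') 𝓘(ℝ, E) (A ∘ φ) x
      (A.comp (chartDiff φ x : E' →L[ℝ] E') : E' →L[ℝ] E) :=
    hA.comp x
      ((mdifferentiable_of_mem_maximalAtlas h.mem_left).mdifferentiableAt hx).hasMFDerivAt
  have h3 : ψ ∘ j =ᶠ[𝓝 x] A ∘ φ := by
    filter_upwards [φ.open_source.mem_nhds hx] with x' hx' using h.eq x' hx'
  exact DFunLike.congr_fun (hasMFDerivAt_unique h1 (h2.congr_of_eventuallyEq h3)) v

theorem IsSliceChart.map_target (h : IsSliceChart j φ ψ A) {x : E'} (hx : x ∈ φ.target) :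
    A x ∈ ψ.target := by
  have h1 := h.eq _ (φ.map_target hx)
  rw [φ.right_inv hx] at h1
  exact h1 ▸ ψ.map_source (h.map_source _ (φ.map_target hx))

theorem IsSliceChart.symm_eq (h : IsSliceChart j φ ψ A) {x : E'} (hx : x ∈ φ.target) :
    j (φ.symm x) = ψ.symm (A x) := by
  have h1 := h.eq _ (φ.map_target hx)
  rw [φ.right_inv hx] at h1
  rw [← h1, ψ.left_inv (h.map_source _ (φ.map_target hx))]

/-- The restriction of a Lagrangian to a submanifold, in slice charts. -/
theorem IsSliceChart.localLagrangian_eq (hjd : MDifferentiable 𝓘(ℝ, E') 𝓘(ℝ, E) j)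
    (h : IsSliceChart j φ ψ A) (L : TangentBundle 𝓘(ℝ, E) M → ℝ) {x : E'} (hx : x ∈ φ.target)
    (u : E') : localLagrangian (fun v => L (tangentMap 𝓘(ℝ, E') 𝓘(ℝ, E) j v)) φ x u =
      localLagrangian L ψ (A x) (A u) := by
  have hs := φ.map_target hx
  have h0 : tangentCoord ψ (tangentMap 𝓘(ℝ, E') 𝓘(ℝ, E) j (tangentOfCoord φ (x, u))) =
      (A x, A u) := by
    refine Prod.ext ((h.eq _ hs).trans (by rw [φ.right_inv hx])) ?_
    refine (h.chartDiff_modelDiff hjd hs _).trans (congrArg A ?_)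
    have := chartDiff_chartSymmDiff h.mem_left hs u
    rwa [φ.right_inv hx] at this
  have h1 := tangentOfCoord_tangentCoord h.mem_right
    (z := tangentMap 𝓘(ℝ, E') 𝓘(ℝ, E) j (tangentOfCoord φ (x, u))) (h.map_source _ hs)
  rw [h0] at h1
  exact congrArg L h1.symm

section Fderiv

variable {f : E' → F} {g : E → F} {U : Set E'} {V : Set E}

/-- The derivatives along the slice of a function on the ambient space are those of its
restriction. -/
theorem fderiv_of_eqOn_comp (hU : IsOpen U) (hfg : ∀ x ∈ U, f x = g (A x)) {x : E'} (hx : x ∈ U)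
    (hg : DifferentiableAt ℝ g (A x)) : fderiv ℝ f x = (fderiv ℝ g (A x)).comp A :=
  HasFDerivAt.fderiv ((hg.hasFDerivAt.comp x A.hasFDerivAt).congr_of_eventuallyEq (by
    filter_upwards [hU.mem_nhds hx] with y hy using hfg y hy))

theorem fderiv_fderiv_of_eqOn_comp (hU : IsOpen U) (hV : IsOpen V) (hUV : ∀ x ∈ U, A x ∈ V)
    (hfg : ∀ x ∈ U, f x = g (A x)) (hg : ContDiffOn ℝ 2 g V) {x : E'} (hx : x ∈ U) (u v : E') :
    fderiv ℝ (fderiv ℝ f) x u v = fderiv ℝ (fderiv ℝ g) (A x) (A u) (A v) := by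
  have h1 : ∀ y ∈ U, fderiv ℝ f y = (fderiv ℝ g (A y)).comp A := fun y hy =>
    fderiv_of_eqOn_comp hU hfg hy
      ((hg.contDiffAt (hV.mem_nhds (hUV y hy))).differentiableAt two_ne_zero)
  have h2 : DifferentiableAt ℝ (fderiv ℝ g) (A x) :=
    ((hg.fderiv_of_isOpen hV one_add_one_eq_two.le).contDiffAt
      (hV.mem_nhds (hUV x hx))).differentiableAt one_ne_zero
  have h3 : HasFDerivAt (fun y => fderiv ℝ g (A y)) ((fderiv ℝ (fderiv ℝ g) (A x)).comp A) x :=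
    h2.hasFDerivAt.comp x A.hasFDerivAt
  have h4 : HasFDerivAt (fderiv ℝ f) _ x :=
    (h3.clm_comp (hasFDerivAt_const A x)).congr_of_eventuallyEq (by
      filter_upwards [hU.mem_nhds hx] with y hy using h1 y hy)
  rw [h4.fderiv]
  simp

end Fderiv

/-- The fiber derivative of the restricted Lagrangian, in slice charts. -/
theorem IsSliceChart.fderiv_localLagrangian_right [IsManifold 𝓘(ℝ, E) ∞ M]
    (hjd : MDifferentiable 𝓘(ℝ, E') 𝓘(ℝ, E) j)
    (hL : ContMDiff 𝓘(ℝ, E).tangent 𝓘(ℝ, ℝ) 1 L) (h : IsSliceChart j φ ψ A) {x : E'}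
    (hx : x ∈ φ.target) (u : E') :
    fderiv ℝ (fun u => localLagrangian (fun v => L (tangentMap 𝓘(ℝ, E') 𝓘(ℝ, E) j v)) φ x u) u =
      (fderiv ℝ (fun u => localLagrangian L ψ (A x) u) (A u)).comp A := by
  have hLd : DifferentiableAt ℝ (fun u => localLagrangian L ψ (A x) u) (A u) :=
    (((contDiffOn_localLagrangian h.mem_right hL).contDiffAt (x := (A x, A u))
      ((ψ.open_target.preimage continuous_fst).mem_nhds (h.map_target hx))).differentiableAt
      one_ne_zero).comp (f := fun u : E => (A x, u)) (A u) (by fun_prop)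
  exact fderiv_of_eqOn_comp isOpen_univ (fun u _ => h.localLagrangian_eq hjd L hx u)
    (mem_univ u) hLd

variable {a b : ℝ} {y : ℝ → PontryaginBundle E' S} {z : ℝ → PontryaginBundle E M} {μ : ℝ → F}
  {L : TangentBundle 𝓘(ℝ, E) M → ℝ} {N : M → F} {x₁ x₂ : S} {q₁ q₂ : M} {t : ℝ}

variable [IsManifold 𝓘(ℝ, E') ∞ S]

theorem Corresponds.proj_eq (hc : Corresponds j a b y z) (ht : t ∈ Icc a b) :
    (z t).proj = j (y t).proj := by
  obtain ⟨p, hp, -⟩ := hc t ht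
  exact congrArg (·.proj) hp

theorem Corresponds.mem_chartTimes (hc : Corresponds j a b y z) (h : IsSliceChart j φ ψ A)
    (ht : t ∈ chartTimes a b y φ) : t ∈ chartTimes a b z ψ :=
  ⟨ht.1, by
    change (z t).proj ∈ ψ.source
    rw [hc.proj_eq ht.1]
    exact h.map_source _ ht.2⟩

theorem Corresponds.localPos_eq (hc : Corresponds j a b y z) (h : IsSliceChart j φ ψ A)
    (ht : t ∈ chartTimes a b y φ) : localPos ψ z t = A (localPos φ y t) := by
  rw [localPos, hc.proj_eq ht.1]
  exact h.eq _ ht.2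

theorem Corresponds.localVel_eq (hjd : MDifferentiable 𝓘(ℝ, E') 𝓘(ℝ, E) j)
    (hc : Corresponds j a b y z) (h : IsSliceChart j φ ψ A)
    (ht : t ∈ chartTimes a b y φ) : localVel ψ z t = A (localVel φ y t) := by
  obtain ⟨p, hp, -⟩ := hc t ht.1
  exact (congrArg (fun c => (pontryaginCoord ψ c).2.1) hp).trans
    (h.chartDiff_modelDiff hjd ht.2 _)

theorem Corresponds.localMom_apply (hjd : MDifferentiable 𝓘(ℝ, E') 𝓘(ℝ, E) j)
    (hc : Corresponds j a b y z) (h : IsSliceChart j φ ψ A)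
    (ht : t ∈ chartTimes a b y φ) (ζ : E') : localMom φ y t ζ = localMom ψ z t (A ζ) := by
  obtain ⟨p, hp, hp'⟩ := hc t ht.1
  have h1 : localMom ψ z t (A ζ) = ((pontryaginCoord ψ ⟨j (y t).proj,
      (mfderiv 𝓘(ℝ, E') 𝓘(ℝ, E) j (y t).proj (y t).2.1, p)⟩).2.2) (A ζ) :=
    congrArg (fun c => (pontryaginCoord ψ c).2.2 (A ζ)) hp
  obtain ⟨v, rfl⟩ : ∃ v, chartDiff φ (y t).proj v = ζ :=
    ⟨_, chartDiff_chartSymmDiff h.mem_left ht.2 ζ⟩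
  rw [h1, ← h.chartDiff_modelDiff hjd ht.2]
  refine (localMom_apply_chartDiff h.mem_left ht.2 v).trans ((DFunLike.congr_fun hp' v).trans ?_)
  exact (localMom_apply_chartDiff (z := fun _ => ⟨j (y t).proj,
      (mfderiv 𝓘(ℝ, E') 𝓘(ℝ, E) j (y t).proj (y t).2.1, p)⟩) (t := t) h.mem_right
      (h.map_source _ ht.2) _).symm

theorem Corresponds.totalMomentum_apply (hjd : MDifferentiable 𝓘(ℝ, E') 𝓘(ℝ, E) j)
    (hN : ContMDiff 𝓘(ℝ, E) 𝓘(ℝ, F) 2 N)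
    (hc : Corresponds j a b y z) (h : IsSliceChart j φ ψ A)
    (ht : t ∈ chartTimes a b y φ) (ζ : E') :
    totalMomentum φ (fun x => N (j x)) y μ t ζ = totalMomentum ψ N z μ t (A ζ) := by
  have hX := φ.map_source ht.2
  have h1 : fderiv ℝ (fun x => N (j (φ.symm x))) (localPos φ y t) = _ :=
    fderiv_of_eqOn_comp φ.open_target (g := fun x => N (ψ.symm x)) (A := A)
      (fun x hx => congrArg N (h.symm_eq hx)) hX
      (((contDiffOn_comp_chart_symm (k := 2) ENat.LEInfty.out h.mem_right hN).contDiffAt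
        (ψ.open_target.mem_nhds (h.map_target hX))).differentiableAt two_ne_zero)
  simp only [totalMomentum, add_apply, ContinuousLinearMap.comp_apply, h1,
    hc.localMom_apply hjd h ht, hc.localPos_eq h ht]

variable [IsManifold 𝓘(ℝ, E) ∞ M]

theorem Corresponds.localVelocity_eq (hab : a < b) (hc : Corresponds j a b y z)
    (hy : IsPath a b x₁ x₂ y) (hz : IsPath a b q₁ q₂ z) (h : IsSliceChart j φ ψ A)
    (ht : t ∈ chartTimes a b y φ) : localVelocity ψ a b z t = A (localVelocity φ a b y t) := by
  have h1 := hz.hasDerivWithinAt_localPos h.mem_right ht.1 (hc.mem_chartTimes h ht).2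
  have h2 := A.hasFDerivAt.comp_hasDerivWithinAt t
    (hy.hasDerivWithinAt_localPos h.mem_left ht.1 ht.2)
  refine (uniqueDiffOn_Icc hab t ht.1).eq_deriv _ h1 (h2.congr_of_eventuallyEq ?_
    (hc.localPos_eq h ht))
  have h3 : chartTimes a b y φ ∈ 𝓝[Icc a b] t := inter_mem self_mem_nhdsWithin
    (hy.contMDiffOn.continuousOn t ht.1 (φ.open_source.mem_nhds ht.2))
  filter_upwards [h3] with r hr using hc.localPos_eq h hr

theorem Corresponds.totalForce_apply (hab : a < b) (hjd : MDifferentiable 𝓘(ℝ, E') 𝓘(ℝ, E) j)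
    (hL : ContMDiff 𝓘(ℝ, E).tangent 𝓘(ℝ, ℝ) 1 L)
    (hN : ContMDiff 𝓘(ℝ, E) 𝓘(ℝ, F) 2 N)
    (hc : Corresponds j a b y z) (hy : IsPath a b x₁ x₂ y) (hz : IsPath a b q₁ q₂ z)
    (h : IsSliceChart j φ ψ A) (ht : t ∈ chartTimes a b y φ) (ζ : E') :
    totalForce φ (fun v => L (tangentMap 𝓘(ℝ, E') 𝓘(ℝ, E) j v)) (fun x => N (j x)) a b y μ t ζ =
      totalForce ψ L N a b z μ t (A ζ) := by
  have hX := φ.map_source ht.2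
  have h1 := fderiv_fderiv_of_eqOn_comp φ.open_target ψ.open_target (fun x hx => h.map_target hx)
    (f := fun x => N (j (φ.symm x))) (fun x hx => congrArg N (h.symm_eq hx))
    (contDiffOn_comp_chart_symm (k := 2) ENat.LEInfty.out h.mem_right hN) hX
    (localVelocity φ a b y t) ζ
  have hLd : DifferentiableAt ℝ (fun x => localLagrangian L ψ x (A (localVel φ y t)))
      (A (φ (y t).proj)) :=
    (((contDiffOn_localLagrangian h.mem_right hL).contDiffAt
      (x := (A (φ (y t).proj), A (localVel φ y t)))
      ((ψ.open_target.preimage continuous_fst).mem_nhds (h.map_target hX))).differentiableAt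
      one_ne_zero).comp (f := fun x : E => (x, A (localVel φ y t))) (A (φ (y t).proj))
      (by fun_prop)
  have h2 := fderiv_of_eqOn_comp φ.open_target (A := A)
    (f := fun x => localLagrangian (fun v => L (tangentMap 𝓘(ℝ, E') 𝓘(ℝ, E) j v)) φ x
      (localVel φ y t)) (g := fun x => localLagrangian L ψ x (A (localVel φ y t)))
    (fun x hx => h.localLagrangian_eq hjd L hx _) hX hLd
  have h2' := DFunLike.congr_fun h2 ζ
  simp only [totalForce, add_apply, ContinuousLinearMap.comp_apply, hc.localPos_eq h ht,
    hc.localVel_eq hjd h ht, hc.localVelocity_eq hab hy hz h ht, innerSL_apply_apply]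
  exact congrArg₂ (fun c d : ℝ => c + d) h2' (congrArg (fun c => (inner ℝ (μ t) c : ℝ)) h1)

/-- The momentum balance on a submanifold is the tangential part of the ambient balance. -/
theorem Corresponds.momentumBalance_iff (hab : a < b)
    (hjd : MDifferentiable 𝓘(ℝ, E') 𝓘(ℝ, E) j)
    (hL : ContMDiff 𝓘(ℝ, E).tangent 𝓘(ℝ, ℝ) 1 L)
    (hN : ContMDiff 𝓘(ℝ, E) 𝓘(ℝ, F) 2 N)
    (hc : Corresponds j a b y z) (hy : IsPath a b x₁ x₂ y) (hz : IsPath a b q₁ q₂ z)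
    (h : IsSliceChart j φ ψ A) {s t : ℝ} (hst : s ≤ t) (hsub : Icc s t ⊆ chartTimes a b y φ) :
    MomentumBalance φ (fun v => L (tangentMap 𝓘(ℝ, E') 𝓘(ℝ, E) j v)) (fun x => N (j x)) a b y μ
      s t ↔ ∀ ζ, totalMomentum ψ N z μ t (A ζ) - totalMomentum ψ N z μ s (A ζ) =
        ∫ τ in s..t, totalForce ψ L N a b z μ τ (A ζ) := by
  refine forall_congr' fun ζ => ?_
  rw [hc.totalMomentum_apply hjd hN h (hsub (left_mem_Icc.2 hst)),
    hc.totalMomentum_apply hjd hN h (hsub (right_mem_Icc.2 hst)),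
    intervalIntegral.integral_congr fun τ hτ => ?_]
  rw [uIcc_of_le hst] at hτ
  exact hc.totalForce_apply hab hjd hL hN hy hz h (hsub hτ) ζ

theorem contMDiff_comp_tangentMap {r : WithTop ℕ∞} (hr : r + 1 ≤ ∞)
    (hj : ContMDiff 𝓘(ℝ, E') 𝓘(ℝ, E) ∞ j)
    (hL : ContMDiff 𝓘(ℝ, E).tangent 𝓘(ℝ, ℝ) r L) :
    ContMDiff 𝓘(ℝ, E').tangent 𝓘(ℝ, ℝ) r (fun v => L (tangentMap 𝓘(ℝ, E') 𝓘(ℝ, E) j v)) :=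
  hL.comp (hj.contMDiff_tangentMap hr)

variable {m k : ℕ} {w : Fin m → ℝ → ℝ} {ℓ : ℝ → EuclideanSpace ℝ (Fin k)} {γ : Fin m → M → ℝ}
  {g : M → EuclideanSpace ℝ (Fin k)}

/-- A solution of the constrained equations restricts to a critical point of the restricted
action. -/
theorem ConstrainedHPEquations.isAugmentedCritical_of_corresponds [CompleteSpace E'] (hab : a < b)
    (hL : ContMDiff 𝓘(ℝ, E).tangent 𝓘(ℝ, ℝ) 1 L)
    (hγ : ∀ i, ContMDiff 𝓘(ℝ, E) 𝓘(ℝ, ℝ) 2 (γ i))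
    (hg : ContMDiff 𝓘(ℝ, E) 𝓘(ℝ, EuclideanSpace ℝ (Fin k)) 2 g)
    (hw : ∀ i, ContinuousOn (w i) (Icc a b)) (hℓ : ContinuousOn ℓ (Icc a b))
    (hj : IsImmersion 𝓘(ℝ, E') 𝓘(ℝ, E) ∞ j) (hgj : ∀ x, g (j x) = 0)
    (hy : IsPath a b x₁ x₂ y) (hz : IsPath a b q₁ q₂ z) (hc : Corresponds j a b y z)
    (h : ConstrainedHPEquations L γ g w a b z (fun t => -ℓ t)) :
    IsAugmentedCritical (fun v => L (tangentMap 𝓘(ℝ, E') 𝓘(ℝ, E) j v)) (fun i x => γ i (j x))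
      (fun x => g (j x)) w a b x₁ x₂ y ℓ := by
  have hj' : ContMDiff 𝓘(ℝ, E') 𝓘(ℝ, E) ∞ j := hj.contMDiff
  have hjd : MDifferentiable 𝓘(ℝ, E') 𝓘(ℝ, E) j := hj'.mdifferentiable (by simp)
  have hj2 : ContMDiff 𝓘(ℝ, E') 𝓘(ℝ, E) 2 j := hj'.of_le ENat.LEInfty.out
  have hLS := contMDiff_comp_tangentMap one_add_one_le_infty hj' hL
  choose φ ψ A hmem hsl using exists_isSliceChart (E := E) (E' := E') hj
  obtain ⟨T, r, hT, hT0, hTr, hsub⟩ := hy.exists_partition hab φ fun t _ => hmem _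
  refine isAugmentedCritical_of_momentumBalance hab hLS (fun i => (hγ i).comp hj2) (hg.comp hj2) hw
    hℓ hy (fun t ht => ?_) (fun t ht => ?_) (fun t _ => hgj _) hT hT0 hTr fun n hn => ?_
  · have h0 : t ∈ chartTimes a b y (φ (y t).proj) := ⟨ht, hmem _⟩
    have hs := hsl (y t).proj
    have h1 := (localVelocity_eq_localVel_iff hs.mem_right
      (hc.mem_chartTimes hs h0).2).2 (h.kinematic t ht)
    rw [hc.localVelocity_eq hab hy hz hs h0, hc.localVel_eq hjd hs h0] at h1
    exact (localVelocity_eq_localVel_iff hs.mem_left h0.2).1 (hs.injective h1)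
  · have h0 : t ∈ chartTimes a b y (φ (y t).proj) := ⟨ht, hmem _⟩
    have hs := hsl (y t).proj
    have h1 := (localMom_eq_fderiv_iff hs.mem_right hL
      (hc.mem_chartTimes hs h0).2).2 (h.legendre t ht)
    refine (localMom_eq_fderiv_iff hs.mem_left hLS h0.2).1 ?_
    rw [localPos, hs.fderiv_localLagrangian_right hjd hL ((φ _).map_source h0.2)]
    ext ζ
    rw [hc.localMom_apply hjd hs h0, h1, hc.localPos_eq hs h0, hc.localVel_eq hjd hs h0]
    rfl
  · obtain ⟨τ₀, -, hτ₀⟩ := hsub n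
    have hs := hsl (y τ₀).proj
    refine ⟨_, hs.mem_left, fun t ht => (hτ₀ ht).2, fun t ht => ?_⟩
    have hsub' := (Icc_subset_Icc_right ht.2).trans hτ₀
    refine (hc.momentumBalance_iff hab hjd hL (contMDiff_pairedPotential hγ hg) hy hz hs ht.1
      hsub').2 fun ζ => ?_
    exact h.momentumBalance hab hL hγ hg hw hℓ hz hs.mem_right
      (hT0 ▸ hT (Nat.zero_le n)) ht.1 (ht.2.trans (hTr ▸ hT hn))
      (fun τ hτ => hc.mem_chartTimes hs (hsub' hτ)) _

end Slice

/-! ### Solving for the multiplier -/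

section Multiplier

theorem isUnit_of_injective {F : Type*} [NormedAddCommGroup F] [NormedSpace ℝ F]
    [FiniteDimensional ℝ F] {H : F →L[ℝ] F} (h : ∀ c, H c = 0 → c = 0) : IsUnit H := by
  have := FiniteDimensional.complete ℝ F
  have hi : Function.Injective (H : F →ₗ[ℝ] F) := (injective_iff_map_eq_zero _).2 h
  exact ContinuousLinearMap.isUnit_iff_bijective.2 ⟨hi, LinearMap.injective_iff_surjective.1 hi⟩

/-- The equation `d(Λ H) = dρ + Λ dH`, in integrated form, has a continuous solution with a
prescribed initial value. Formally `dΛ = dρ H⁻¹`, and integrating by parts gives a formula for `Λ`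
in which `ρ` need only be continuous. -/
theorem exists_multiplier {F : Type*} [NormedAddCommGroup F] [NormedSpace ℝ F] [CompleteSpace F]
    {s t : ℝ} (hst : s ≤ t) {H H' : ℝ → F →L[ℝ] F} {ρ : ℝ → F →L[ℝ] ℝ}
    (hH : ∀ τ ∈ Icc s t, HasDerivWithinAt H (H' τ) (Icc s t) τ)
    (hH' : ContinuousOn H' (Icc s t)) (hu : ∀ τ ∈ Icc s t, IsUnit (H τ))
    (hρ : ContinuousOn ρ (Icc s t)) (hρs : ρ s = 0) (Λ₀ : F →L[ℝ] ℝ) :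
    ∃ Λ : ℝ → F →L[ℝ] ℝ, ContinuousOn Λ (Icc s t) ∧ Λ s = Λ₀ ∧
      ∀ τ ∈ Icc s t, ∀ c, Λ τ (H τ c) - Λ s (H s c) = ρ τ c + ∫ r in s..τ, Λ r (H' r c) := by
  set J : ℝ → F →L[ℝ] F := fun τ => Ring.inverse (H τ) with hJdef
  have hJH : ∀ τ ∈ Icc s t, ∀ c, J τ (H τ c) = c := fun τ hτ c =>
    DFunLike.congr_fun (Ring.inverse_mul_cancel (H τ) (hu τ hτ)) c
  have hHc : ContinuousOn H (Icc s t) := fun τ hτ => (hH τ hτ).continuousWithinAt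
  have hJc : ContinuousOn J (Icc s t) := fun τ hτ => by
    obtain ⟨x, hx⟩ := hu τ hτ
    exact ContinuousAt.comp_continuousWithinAt (g := Ring.inverse)
      (hx ▸ NormedRing.inverse_continuousAt x) (hHc τ hτ)
  have ms : s ∈ Icc s t := left_mem_Icc.2 hst
  -- `σ = -ρ dJ/dt`
  set σ : ℝ → F →L[ℝ] ℝ := fun τ => (ρ τ).comp ((J τ).comp ((H' τ).comp (J τ))) with hσdef
  have hσ : ContinuousOn σ (Icc s t) := hρ.clm_comp (hJc.clm_comp (hH'.clm_comp hJc))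
  set K : ℝ → F →L[ℝ] ℝ := fun τ => ∫ r in s..τ, σ r with hKdef
  obtain ⟨hK, hKd⟩ : ContinuousOn K (Icc s t) ∧ ∀ τ ∈ Ioo s t, HasDerivAt K (σ τ) τ :=
    hasDerivAt_of_sub_eq_integral hst hσ fun τ _ => by simp [hKdef]
  set Λ : ℝ → F →L[ℝ] ℝ := fun τ => Λ₀ + (ρ τ).comp (J τ) + K τ with hΛdef
  have hΛ : ContinuousOn Λ (Icc s t) :=
    (continuousOn_const.add (hρ.clm_comp hJc)).add hK
  have hΛs : Λ s = Λ₀ := by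
    simp [hΛdef, hρs, hKdef]
  refine ⟨Λ, hΛ, hΛs, fun τ hτ c => ?_⟩
  have hsub : Icc s τ ⊆ Icc s t := Icc_subset_Icc_right hτ.2
  -- `(Λ₀ + K) H` is `Λ H - ρ`, and unlike its two terms it is differentiable.
  have hd : ∀ r ∈ Ioo s τ, HasDerivAt (fun r => (Λ₀ + K r) (H r c)) (Λ r (H' r c)) r := by
    intro r hr
    have hrI : r ∈ Icc s t := hsub (Ioo_subset_Icc_self hr)
    have hn : Icc s t ∈ 𝓝 r := Icc_mem_nhds hr.1 (hr.2.trans_le hτ.2)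
    have h2 := ((hKd r ⟨hr.1, hr.2.trans_le hτ.2⟩).const_add Λ₀).clm_apply
      (((hH r hrI).hasDerivAt hn).clm_apply (hasDerivAt_const r c))
    refine h2.congr_deriv ?_
    simp only [hσdef, hΛdef, ContinuousLinearMap.comp_apply, hJH r hrI, add_apply, map_zero,
      add_zero]
    ring
  have hcont : ContinuousOn (fun r => (Λ₀ + K r) (H r c)) (Icc s τ) :=
    ((continuousOn_const.add hK).clm_apply (hHc.clm_apply continuousOn_const)).mono hsub
  have hint : IntervalIntegrable (fun r => Λ r (H' r c)) volume s τ :=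
    ContinuousOn.intervalIntegrable (by
      rw [uIcc_of_le hτ.1]
      exact (hΛ.clm_apply (hH'.clm_apply continuousOn_const)).mono hsub)
  rw [intervalIntegral.integral_eq_sub_of_hasDerivAt_of_le hτ.1 hcont hd hint]
  simp only [hΛdef, hρs, add_apply, ContinuousLinearMap.comp_apply, hJH τ hτ,
    zero_apply]
  ring

/-- If the dimension of `E` is the sum of those of `E'` and `F`, and `G ∘ A = 0` with `A` injective
and `G` surjective, then the sequence `E' → E → F` is exact. -/
theorem mem_range_of_apply_eq_zero {E E' F : Type*} [NormedAddCommGroup E] [NormedSpace ℝ E]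
    [NormedAddCommGroup E'] [NormedSpace ℝ E'] [NormedAddCommGroup F] [NormedSpace ℝ F]
    [FiniteDimensional ℝ E] [FiniteDimensional ℝ E'] [FiniteDimensional ℝ F]
    (hdim : Module.finrank ℝ E = Module.finrank ℝ E' + Module.finrank ℝ F)
    {A : E' →L[ℝ] E} (hA : Function.Injective A) {G : E →L[ℝ] F} (hG : Function.Surjective G)
    (hGA : ∀ ζ, G (A ζ) = 0) {ξ : E} (hξ : G ξ = 0) : ∃ ζ, A ζ = ξ := by
  have h1 : LinearMap.range (A : E' →ₗ[ℝ] E) ≤ LinearMap.ker (G : E →ₗ[ℝ] F) := by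
    rintro _ ⟨ζ, rfl⟩
    exact hGA ζ
  have h2 := LinearMap.finrank_range_add_finrank_ker (G : E →ₗ[ℝ] F)
  rw [(G : E →ₗ[ℝ] F).range_eq_top_of_surjective hG, finrank_top] at h2
  have h3 := LinearMap.finrank_range_of_inj (f := (A : E' →ₗ[ℝ] E)) hA
  have h4 := Submodule.eq_of_le_of_finrank_eq h1 (by omega)
  have h5 : ξ ∈ LinearMap.range (A : E' →ₗ[ℝ] E) := h4 ▸ hξ
  exact h5

end Multiplier

/-! ### Splitting off the multiplier -/

section Split

open scoped ContDiff

theorem fderiv_clm_comp {E F G : Type*} [NormedAddCommGroup E] [NormedSpace ℝ E]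
    [NormedAddCommGroup F] [NormedSpace ℝ F] [NormedAddCommGroup G] [NormedSpace ℝ G]
    (P : F →L[ℝ] G) {f : E → F} {x : E} (hf : DifferentiableAt ℝ f x) :
    fderiv ℝ (fun x => P (f x)) x = P.comp (fderiv ℝ f x) :=
  (P.hasFDerivAt.comp x hf.hasFDerivAt).fderiv

theorem fderiv_fderiv_clm_comp {E F G : Type*} [NormedAddCommGroup E] [NormedSpace ℝ E]
    [NormedAddCommGroup F] [NormedSpace ℝ F] [NormedAddCommGroup G] [NormedSpace ℝ G]
    (P : F →L[ℝ] G) {f : E → F} {U : Set E} (hU : IsOpen U) (hf : ContDiffOn ℝ 2 f U) {x : E}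
    (hx : x ∈ U) (u v : E) :
    fderiv ℝ (fderiv ℝ (fun x => P (f x))) x u v = P (fderiv ℝ (fderiv ℝ f) x u v) := by
  have h1 : ∀ y ∈ U, fderiv ℝ (fun x => P (f x)) y = P.comp (fderiv ℝ f y) := fun y hy =>
    fderiv_clm_comp P ((hf.contDiffAt (hU.mem_nhds hy)).differentiableAt two_ne_zero)
  have h2 : HasFDerivAt (fderiv ℝ f) (fderiv ℝ (fderiv ℝ f) x) x :=
    (((hf.fderiv_of_isOpen hU one_add_one_eq_two.le).contDiffAt
      (hU.mem_nhds hx)).differentiableAt one_ne_zero).hasFDerivAt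
  have h3 : HasFDerivAt (fderiv ℝ (fun x => P (f x))) _ x :=
    ((hasFDerivAt_const P x).clm_comp h2).congr_of_eventuallyEq (by
      filter_upwards [hU.mem_nhds hx] with y hy using h1 y hy)
  rw [h3.fderiv]
  simp

variable {E : Type*} [NormedAddCommGroup E] [NormedSpace ℝ E]
  {M : Type*} [TopologicalSpace M] [ChartedSpace E M]
  {L : TangentBundle 𝓘(ℝ, E) M → ℝ} {m k : ℕ} {γ : Fin m → M → ℝ}
  {g : M → EuclideanSpace ℝ (Fin k)} {w : Fin m → ℝ → ℝ} {ℓ : ℝ → EuclideanSpace ℝ (Fin k)}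
  {a b : ℝ} {z : ℝ → PontryaginBundle E M} {e : OpenPartialHomeomorph M E} {t : ℝ}

/-- The total momentum is affine in the multiplier `ℓ` of the constraint. -/
theorem totalMomentum_pairedMultiplier (hγ : ∀ i, ContMDiff 𝓘(ℝ, E) 𝓘(ℝ, ℝ) 2 (γ i))
    (hg : ContMDiff 𝓘(ℝ, E) 𝓘(ℝ, EuclideanSpace ℝ (Fin k)) 2 g)
    (he : e ∈ IsManifold.maximalAtlas 𝓘(ℝ, E) ∞ M) (ht : (z t).proj ∈ e.source) (ξ : E) :
    totalMomentum e (pairedPotential γ g) z (pairedMultiplier w ℓ) t ξ =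
      totalMomentum e (pairedPotential γ g) z (pairedMultiplier w 0) t ξ
        + inner ℝ (ℓ t) (fderiv ℝ (fun x => g (e.symm x)) (localPos e z t) ξ) := by
  have hN := contDiffOn_comp_chart_symm (k := 2) ENat.LEInfty.out he
    (contMDiff_pairedPotential hγ hg)
  have h1 := DFunLike.congr_fun (fderiv_clm_comp (constraintProj m k)
    (f := fun x => pairedPotential γ g (e.symm x)) (x := localPos e z t)
    ((hN.contDiffAt (e.open_target.mem_nhds (e.map_source ht))).differentiableAt two_ne_zero)) ξ
  simp only [totalMomentum, add_apply, ContinuousLinearMap.comp_apply, innerSL_apply_apply,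
    pairedMultiplier_eq_add (ℓ := ℓ), inner_add_left, inner_constraintIncl, add_assoc]
  exact congrArg (fun c => _ + (_ + inner ℝ (ℓ t) c)) h1.symm

/-- The total force is affine in the multiplier `ℓ` of the constraint. -/
theorem totalForce_pairedMultiplier (hγ : ∀ i, ContMDiff 𝓘(ℝ, E) 𝓘(ℝ, ℝ) 2 (γ i))
    (hg : ContMDiff 𝓘(ℝ, E) 𝓘(ℝ, EuclideanSpace ℝ (Fin k)) 2 g)
    (he : e ∈ IsManifold.maximalAtlas 𝓘(ℝ, E) ∞ M) (ht : (z t).proj ∈ e.source) (ξ : E) :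
    totalForce e L (pairedPotential γ g) a b z (pairedMultiplier w ℓ) t ξ =
      totalForce e L (pairedPotential γ g) a b z (pairedMultiplier w 0) t ξ
        + inner ℝ (ℓ t) (fderiv ℝ (fderiv ℝ (fun x => g (e.symm x))) (localPos e z t)
          (localVelocity e a b z t) ξ) := by
  have hN := contDiffOn_comp_chart_symm (k := 2) ENat.LEInfty.out he
    (contMDiff_pairedPotential hγ hg)
  have h1 := fderiv_fderiv_clm_comp (constraintProj m k) e.open_target hN (e.map_source ht)
    (localVelocity e a b z t) ξ
  simp only [totalForce, add_apply, ContinuousLinearMap.comp_apply, innerSL_apply_apply,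
    pairedMultiplier_eq_add (ℓ := ℓ), inner_add_left, inner_constraintIncl, add_assoc]
  exact congrArg (fun c => _ + (_ + inner ℝ (ℓ t) c)) h1.symm

/-- The derivative of a function in a chart, in terms of its differential on the manifold. -/
theorem fderiv_comp_chart_symm {F : Type*} [NormedAddCommGroup F] [NormedSpace ℝ F] {N : M → F}
    (he : e ∈ IsManifold.maximalAtlas 𝓘(ℝ, E) ∞ M) (hN : MDifferentiable 𝓘(ℝ, E) 𝓘(ℝ, F) N)
    {q : M} (hq : q ∈ e.source) (v : E) :
    fderiv ℝ (fun x => N (e.symm x)) (e q) (chartDiff e q v) = modelDiff N F E q v := by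
  have hs := (mdifferentiable_of_mem_maximalAtlas he).mdifferentiableAt_symm (e.map_source hq)
  have hq' : MDifferentiableAt 𝓘(ℝ, E) 𝓘(ℝ, F) N (e.symm (e q)) := hN _
  have h1 : HasMFDerivAt 𝓘(ℝ, E) 𝓘(ℝ, F) (fun x => N (e.symm x)) (e q)
      ((modelDiff N F E (e.symm (e q))).comp (chartSymmDiff e (e q)) : E →L[ℝ] F) :=
    hq'.hasMFDerivAt.comp (e q) hs.hasMFDerivAt
  have h2 : HasFDerivAt (fun x => N (e.symm x))
      ((modelDiff N F E (e.symm (e q))).comp (chartSymmDiff e (e q))) (e q) :=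
    hasMFDerivAt_iff_hasFDerivAt.1 h1
  rw [h2.fderiv, ContinuousLinearMap.comp_apply, chartSymmDiff_chartDiff he hq, e.left_inv hq]

end Split

/-! ### The multiplier along a path in the submanifold -/

section Glue

/-- Glueing: a condition `R n` on the values on the `n`-th piece of a partition, for each `n`, is
satisfied by one continuous function if it can be satisfied on each piece with any initial value. -/
theorem exists_continuousOn_of_partition {X : Type*} [TopologicalSpace X] [Nonempty X]
    {T : ℕ → ℝ} (hT : Monotone T) (R : ℕ → (ℝ → X) → Prop)
    (hR : ∀ n ℓ ℓ', EqOn ℓ ℓ' (Icc (T n) (T (n + 1))) → R n ℓ → R n ℓ')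
    (h : ∀ n x, ∃ ℓ, ContinuousOn ℓ (Icc (T n) (T (n + 1))) ∧ ℓ (T n) = x ∧ R n ℓ) (r : ℕ) :
    ∃ ℓ, ContinuousOn ℓ (Icc (T 0) (T r)) ∧ ∀ n < r, R n ℓ := by
  induction r with
  | zero =>
    refine ⟨fun _ => Classical.arbitrary X, continuousOn_const, fun n hn => by omega⟩
  | succ r ih =>
    obtain ⟨ℓ, hℓ, hℓR⟩ := ih
    obtain ⟨ℓ', hℓ', h0, hℓ'R⟩ := h r (ℓ (T r))
    classical
    set κ : ℝ → X := fun t => if t ≤ T r then ℓ t else ℓ' t with hκ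
    have e1 : ∀ t ≤ T r, ℓ t = κ t := fun t ht => (if_pos ht).symm
    have e2 : ∀ t, T r ≤ t → ℓ' t = κ t := fun t ht => by
      rcases ht.eq_or_lt with rfl | ht
      · rw [h0, e1 _ le_rfl]
      · exact (if_neg (not_le.2 ht)).symm
    refine ⟨κ, ?_, fun n hn => ?_⟩
    · rw [← Icc_union_Icc_eq_Icc (hT (Nat.zero_le r)) (hT r.le_succ)]
      exact (hℓ.congr fun t ht => (e1 t ht.2).symm).union_of_isClosed
        (hℓ'.congr fun t ht => (e2 t ht.1).symm) isClosed_Icc isClosed_Icc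
    · rcases Nat.lt_succ_iff_lt_or_eq.1 hn with hn | rfl
      · exact hR n ℓ κ (fun t ht => e1 t (ht.2.trans (hT hn))) (hℓR n hn)
      · exact hR n ℓ' κ (fun t ht => e2 t ht.1) hℓ'R

end Glue

section Balance

open scoped ContDiff

variable {E : Type*} [NormedAddCommGroup E] [NormedSpace ℝ E]
  {M : Type*} [TopologicalSpace M] [ChartedSpace E M]
  {F : Type*} [NormedAddCommGroup F] [InnerProductSpace ℝ F]
  {L : TangentBundle 𝓘(ℝ, E) M → ℝ} {N : M → F}
  {a b : ℝ} {z : ℝ → PontryaginBundle E M} {e : OpenPartialHomeomorph M E}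

theorem MomentumBalance.congr_multiplier {μ μ' : ℝ → F} {s t : ℝ} (hst : s ≤ t)
    (hμ : EqOn μ μ' (Icc s t)) (h : MomentumBalance e L N a b z μ s t) :
    MomentumBalance e L N a b z μ' s t := fun ξ => by
  have h1 := h ξ
  simp only [totalMomentum, hμ (left_mem_Icc.2 hst), hμ (right_mem_Icc.2 hst)] at h1
  refine h1.trans (intervalIntegral.integral_congr fun τ hτ => ?_)
  rw [uIcc_of_le hst] at hτ
  simp only [totalForce, hμ hτ]

end Balance

section Existence

open scoped ContDiff

variable {E : Type*} [NormedAddCommGroup E] [NormedSpace ℝ E]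
  {M : Type*} [TopologicalSpace M] [ChartedSpace E M] [IsManifold 𝓘(ℝ, E) ∞ M]
  {E' : Type*} [NormedAddCommGroup E'] [NormedSpace ℝ E']
  {S : Type*} [TopologicalSpace S] [ChartedSpace E' S] [IsManifold 𝓘(ℝ, E') ∞ S]
  {j : S → M} {φ : OpenPartialHomeomorph S E'} {ψ : OpenPartialHomeomorph M E} {A : E' →L[ℝ] E}
  {L : TangentBundle 𝓘(ℝ, E) M → ℝ} {m k : ℕ} {γ : Fin m → M → ℝ}
  {g : M → EuclideanSpace ℝ (Fin k)} {w : Fin m → ℝ → ℝ} {ℓ : ℝ → EuclideanSpace ℝ (Fin k)}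
  {a b : ℝ} {y : ℝ → PontryaginBundle E' S} {z : ℝ → PontryaginBundle E M}
  {x₁ x₂ : S} {q₁ q₂ : M}

/-- In a slice chart, the tangential part of the momentum balance determines a multiplier that
supplies the normal part. The multiplier can be prescribed at the initial time. -/
theorem Corresponds.exists_multiplier_chart [FiniteDimensional ℝ E] [FiniteDimensional ℝ E']
    (hab : a < b) (hL : ContMDiff 𝓘(ℝ, E).tangent 𝓘(ℝ, ℝ) 1 L)
    (hγ : ∀ i, ContMDiff 𝓘(ℝ, E) 𝓘(ℝ, ℝ) 2 (γ i))
    (hg : ContMDiff 𝓘(ℝ, E) 𝓘(ℝ, EuclideanSpace ℝ (Fin k)) 2 g)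
    (hreg : ∀ x, g x = 0 → Function.Surjective (modelDiff g (EuclideanSpace ℝ (Fin k)) E x))
    (hdim : Module.finrank ℝ E = Module.finrank ℝ E' + k) (hgj : ∀ x, g (j x) = 0)
    (hw : ∀ i, ContinuousOn (w i) (Icc a b))
    (hc : Corresponds j a b y z) (hy : IsPath a b x₁ x₂ y) (hz : IsPath a b q₁ q₂ z)
    (h : IsSliceChart j φ ψ A) {s t : ℝ} (hst : s ≤ t) (hsub : Icc s t ⊆ chartTimes a b y φ)
    (htan : ∀ τ ∈ Icc s t, ∀ ζ,
      totalMomentum ψ (pairedPotential γ g) z (pairedMultiplier w 0) τ (A ζ)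
        - totalMomentum ψ (pairedPotential γ g) z (pairedMultiplier w 0) s (A ζ) =
        ∫ r in s..τ, totalForce ψ L (pairedPotential γ g) a b z (pairedMultiplier w 0) r (A ζ))
    (ℓ₀ : EuclideanSpace ℝ (Fin k)) :
    ∃ ℓ : ℝ → EuclideanSpace ℝ (Fin k), ContinuousOn ℓ (Icc s t) ∧ ℓ s = ℓ₀ ∧
      ∀ τ ∈ Icc s t,
        MomentumBalance ψ L (pairedPotential γ g) a b z (pairedMultiplier w ℓ) s τ := by
  have hN : ContMDiff 𝓘(ℝ, E) 𝓘(ℝ, PairSpace m k) 2 (pairedPotential γ g) :=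
    contMDiff_pairedPotential hγ hg
  have ms : s ∈ Icc s t := left_mem_Icc.2 hst
  have hsz : Icc s t ⊆ chartTimes a b z ψ := fun τ hτ => hc.mem_chartTimes h (hsub hτ)
  have hX : ∀ τ ∈ Icc s t, localPos ψ z τ ∈ ψ.target := fun τ hτ => ψ.map_source (hsz hτ).2
  have cX := (hz.continuousOn_localPos h.mem_right).mono hsz
  have cV := (hz.continuousOn_localVelocity hab h.mem_right).mono hsz
  have hg1 := contDiffOn_comp_chart_symm (k := 2) ENat.LEInfty.out h.mem_right hg
  have hg2 := hg1.fderiv_of_isOpen ψ.open_target one_add_one_eq_two.le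
  set G : ℝ → E →L[ℝ] EuclideanSpace ℝ (Fin k) := fun τ =>
    fderiv ℝ (fun x => g (ψ.symm x)) (localPos ψ z τ) with hG
  set G' : ℝ → E →L[ℝ] EuclideanSpace ℝ (Fin k) := fun τ =>
    fderiv ℝ (fderiv ℝ (fun x => g (ψ.symm x))) (localPos ψ z τ) (localVelocity ψ a b z τ) with hG'
  have hGd : ∀ τ ∈ Icc s t, HasDerivWithinAt G (G' τ) (Icc s t) τ := fun τ hτ =>
    ((hg2.contDiffAt (ψ.open_target.mem_nhds (hX τ hτ))).differentiableAt
      one_ne_zero).hasFDerivAt.comp_hasDerivWithinAt τ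
      ((hz.hasDerivWithinAt_localPos h.mem_right (hsz hτ).1 (hsz hτ).2).mono
        (hsub.trans inter_subset_left))
  have cG' : ContinuousOn G' (Icc s t) :=
    ((hg2.continuousOn_fderiv_of_isOpen ψ.open_target le_rfl).comp cX hX).clm_apply cV
  -- The constraint vanishes on the slice, so its derivatives do along the slice.
  have hgA : ∀ x ∈ φ.target, (fun _ : E' => (0 : EuclideanSpace ℝ (Fin k))) x =
      (fun x => g (ψ.symm x)) (A x) := fun x hx => by
    simp only [← h.symm_eq hx, hgj]
  have hXy : ∀ τ ∈ Icc s t, localPos φ y τ ∈ φ.target := fun τ hτ => φ.map_source (hsub hτ).2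
  have hGA : ∀ τ ∈ Icc s t, ∀ ζ, G τ (A ζ) = 0 := fun τ hτ ζ => by
    have h1 := fderiv_of_eqOn_comp φ.open_target hgA (hXy τ hτ)
      ((hg1.contDiffAt (ψ.open_target.mem_nhds (h.map_target (hXy τ hτ)))).differentiableAt
        two_ne_zero)
    rw [← hc.localPos_eq h (hsub hτ)] at h1
    simpa using (DFunLike.congr_fun h1 ζ).symm
  have hGA' : ∀ τ ∈ Icc s t, ∀ ζ, G' τ (A ζ) = 0 := fun τ hτ ζ => by
    have h1 := fderiv_fderiv_of_eqOn_comp φ.open_target ψ.open_target (fun x hx => h.map_target hx)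
      hgA hg1 (hXy τ hτ) (localVelocity φ a b y τ) ζ
    rw [← hc.localPos_eq h (hsub hτ), ← hc.localVelocity_eq hab hy hz h (hsub hτ)] at h1
    simpa using h1.symm
  have hGs : ∀ τ ∈ Icc s t, Function.Surjective (G τ) := fun τ hτ c => by
    have h0 : g (z τ).proj = 0 := by rw [hc.proj_eq (hsub hτ).1, hgj]
    obtain ⟨v, hv⟩ := hreg _ h0 c
    exact ⟨chartDiff ψ (z τ).proj v, (fderiv_comp_chart_symm h.mem_right
      (hg.mdifferentiable two_ne_zero) (hsz hτ).2 v).trans hv⟩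
  have hker : ∀ τ ∈ Icc s t, ∀ ξ, G τ ξ = 0 → ∃ ζ, A ζ = ξ := fun τ hτ ξ hξ =>
    mem_range_of_apply_eq_zero (by rw [hdim, finrank_euclideanSpace_fin]) h.injective (hGs τ hτ)
      (hGA τ hτ) hξ
  obtain ⟨σ, hσ⟩ := (G s).exists_rightInverse_of_surjective
    (LinearMap.range_eq_top.2 (hGs s ms))
  have hσ' : ∀ c, G s (σ c) = c := fun c => DFunLike.congr_fun hσ c
  -- The range of `σ` is a complement to the slice on which every `G τ` is invertible.
  have hu : ∀ τ ∈ Icc s t, IsUnit ((G τ).comp σ) := fun τ hτ => isUnit_of_injective fun c hc => by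
    obtain ⟨ζ, hζ⟩ := hker τ hτ (σ c) hc
    rw [← hσ' c, ← hζ, hGA s ms]
  set p₀ := totalMomentum ψ (pairedPotential γ g) z (pairedMultiplier w 0) with hp₀
  set f₀ := totalForce ψ L (pairedPotential γ g) a b z (pairedMultiplier w 0) with hf₀
  have hμ : ContinuousOn (pairedMultiplier w (0 : ℝ → EuclideanSpace ℝ (Fin k))) (Icc a b) :=
    continuousOn_pairedMultiplier hw continuousOn_const
  have cp : ContinuousOn p₀ (Icc s t) :=
    (hz.continuousOn_totalMomentum h.mem_right hN hμ).mono hsz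
  have cf : ContinuousOn f₀ (Icc s t) :=
    (hz.continuousOn_totalForce hab h.mem_right hL hN hμ).mono hsz
  have fi : IntervalIntegrable f₀ volume s t :=
    ContinuousOn.intervalIntegrable (by rwa [uIcc_of_le hst])
  have fi' : ∀ τ ∈ Icc s t, IntervalIntegrable f₀ volume s τ := fun τ hτ =>
    fi.mono_set (by rw [uIcc_of_le hst, uIcc_of_le hτ.1]; exact Icc_subset_Icc_right hτ.2)
  -- `R` is the defect of the balance without multiplier.
  set R : ℝ → E →L[ℝ] ℝ := fun τ => (∫ r in s..τ, f₀ r) - (p₀ τ - p₀ s) with hRdef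
  have hR : ∀ τ ∈ Icc s t, ∀ ξ, R τ ξ = (∫ r in s..τ, f₀ r ξ) - (p₀ τ ξ - p₀ s ξ) :=
    fun τ hτ ξ => by
      simp only [hRdef, sub_apply, ContinuousLinearMap.intervalIntegral_apply (fi' τ hτ)]
  have cR : ContinuousOn R (Icc s t) := by
    have h1 := intervalIntegral.continuousOn_primitive_interval' fi left_mem_uIcc
    rw [uIcc_of_le hst] at h1
    exact h1.sub (cp.sub continuousOn_const)
  have hRA : ∀ τ ∈ Icc s t, ∀ ζ, R τ (A ζ) = 0 := fun τ hτ ζ => by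
    rw [hR τ hτ, htan τ hτ, sub_self]
  obtain ⟨Λ, hΛ, hΛs, hΛeq⟩ := exists_multiplier hst (H := fun τ => (G τ).comp σ)
    (H' := fun τ => (G' τ).comp σ) (ρ := fun τ => (R τ).comp σ)
    (fun τ hτ => by
      simpa using (hGd τ hτ).clm_comp (hasDerivWithinAt_const τ (Icc s t) σ))
    (cG'.clm_comp continuousOn_const) hu (cR.clm_comp continuousOn_const)
    (by simp [hRdef]) (innerSL ℝ ℓ₀)
  set D := (InnerProductSpace.toDual ℝ (EuclideanSpace ℝ (Fin k))).symm with hD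
  have hin : ∀ τ c, (inner ℝ (D (Λ τ)) c : ℝ) = Λ τ c := fun τ c =>
    InnerProductSpace.toDual_symm_apply
  refine ⟨fun τ => D (Λ τ), D.continuous.comp_continuousOn hΛ, ?_, fun τ hτ ξ => ?_⟩
  · refine ext_inner_right ℝ fun c => ?_
    rw [hin, hΛs, innerSL_apply_apply]
  obtain ⟨ζ, hζ⟩ := hker s ms (ξ - σ (G s ξ)) (by rw [map_sub, hσ', sub_self])
  have hξ : ξ = σ (G s ξ) + A ζ := by rw [hζ]; abel
  have hsub' : Icc s τ ⊆ Icc s t := Icc_subset_Icc_right hτ.2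
  have e1 : ∀ r ∈ Icc s t, G r ξ = G r (σ (G s ξ)) := fun r hr => by
    conv_lhs => rw [hξ, map_add, hGA r hr, add_zero]
  have e2 : ∀ r ∈ Icc s t, G' r ξ = G' r (σ (G s ξ)) := fun r hr => by
    conv_lhs => rw [hξ, map_add, hGA' r hr, add_zero]
  have e3 : R τ ξ = R τ (σ (G s ξ)) := by
    conv_lhs => rw [hξ, map_add, hRA τ hτ, add_zero]
  have e4 : ∀ r ∈ Icc s t, totalMomentum ψ (pairedPotential γ g) z
      (pairedMultiplier w fun τ => D (Λ τ)) r ξ = p₀ r ξ + Λ r (G r ξ) := fun r hr => by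
    rw [totalMomentum_pairedMultiplier hγ hg h.mem_right (hsz hr).2, hin]
  have e5 : ∀ r ∈ Icc s t, totalForce ψ L (pairedPotential γ g) a b z
      (pairedMultiplier w fun τ => D (Λ τ)) r ξ = f₀ r ξ + Λ r (G' r ξ) := fun r hr => by
    rw [totalForce_pairedMultiplier hγ hg h.mem_right (hsz hr).2, hin]
  have e6 := hΛeq τ hτ (G s ξ)
  simp only [ContinuousLinearMap.comp_apply, ← e3, ← e1 τ hτ, ← e1 s ms] at e6
  rw [hR τ hτ] at e6
  rw [e4 τ hτ, e4 s ms, intervalIntegral.integral_congr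
    (g := fun r => f₀ r ξ + Λ r (G' r (σ (G s ξ)))) fun r hr => ?_,
    intervalIntegral.integral_add]
  · linarith
  · exact ContinuousOn.intervalIntegrable (by
      rw [uIcc_of_le hτ.1]; exact (cf.clm_apply continuousOn_const).mono hsub')
  · exact ContinuousOn.intervalIntegrable (by
      rw [uIcc_of_le hτ.1]
      exact (hΛ.clm_apply (cG'.clm_apply continuousOn_const)).mono hsub')
  · rw [uIcc_of_le hτ.1] at hr
    simp only [e5 r (hsub' hr), e2 r (hsub' hr)]

/-- A path over a critical path of the restricted action, with the kinematic and the Legendre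
relation, solves the constrained equations for a suitable multiplier. -/
theorem Corresponds.exists_constrainedHPEquations [FiniteDimensional ℝ E] [FiniteDimensional ℝ E']
    (hab : a < b) (hL : ContMDiff 𝓘(ℝ, E).tangent 𝓘(ℝ, ℝ) 1 L)
    (hγ : ∀ i, ContMDiff 𝓘(ℝ, E) 𝓘(ℝ, ℝ) 2 (γ i))
    (hg : ContMDiff 𝓘(ℝ, E) 𝓘(ℝ, EuclideanSpace ℝ (Fin k)) 2 g)
    (hreg : ∀ x, g x = 0 → Function.Surjective (modelDiff g (EuclideanSpace ℝ (Fin k)) E x))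
    (hdim : Module.finrank ℝ E = Module.finrank ℝ E' + k)
    (hj : IsImmersion 𝓘(ℝ, E') 𝓘(ℝ, E) ∞ j) (hgj : ∀ x, g (j x) = 0)
    (hw : ∀ i, ContinuousOn (w i) (Icc a b))
    (hc : Corresponds j a b y z) (hz : IsPath a b q₁ q₂ z)
    (hkin : ∀ t ∈ Icc a b, velocity a b (fun r => (z r).proj) t = (z t).2.1)
    (hleg : ∀ t ∈ Icc a b, (z t).2.2 = fiberDeriv L (z t).proj (z t).2.1)
    (h : IsAugmentedCritical (fun v => L (tangentMap 𝓘(ℝ, E') 𝓘(ℝ, E) j v))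
      (fun i x => γ i (j x)) (fun x => g (j x)) w a b x₁ x₂ y 0) :
    ∃ ℓ, ContinuousOn ℓ (Icc a b) ∧ ConstrainedHPEquations L γ g w a b z ℓ := by
  have hj' : ContMDiff 𝓘(ℝ, E') 𝓘(ℝ, E) ∞ j := hj.contMDiff
  have hjd : MDifferentiable 𝓘(ℝ, E') 𝓘(ℝ, E) j := hj'.mdifferentiable (by simp)
  have hj2 : ContMDiff 𝓘(ℝ, E') 𝓘(ℝ, E) 2 j := hj'.of_le ENat.LEInfty.out
  have hLS := contMDiff_comp_tangentMap one_add_one_le_infty hj' hL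
  have hcon : ∀ t ∈ Icc a b, g (z t).proj = 0 := fun t ht => by rw [hc.proj_eq ht, hgj]
  choose φ ψ A hmem hsl using exists_isSliceChart (E := E) (E' := E') hj
  obtain ⟨T, r, hT, hT0, hTr, hsub⟩ := h.1.exists_partition hab φ fun t _ => hmem _
  choose τ₀ _ hτ₀ using hsub
  have hTn : ∀ n, T n ≤ T (n + 1) := fun n => hT n.le_succ
  obtain ⟨ℓ, hℓ, hbal⟩ := exists_continuousOn_of_partition hT
    (fun n ℓ => ∀ τ ∈ Icc (T n) (T (n + 1)), MomentumBalance (ψ (y (τ₀ n)).proj) L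
      (pairedPotential γ g) a b z (pairedMultiplier w ℓ) (T n) τ)
    (fun n ℓ ℓ' hℓ hb τ hτ => (hb τ hτ).congr_multiplier hτ.1 fun r hr => by
      rw [pairedMultiplier, pairedMultiplier, hℓ ⟨hr.1, hr.2.trans hτ.2⟩])
    (fun n ℓ₀ => hc.exists_multiplier_chart hab hL hγ hg hreg hdim hgj hw h.1 hz (hsl _) (hTn n)
      (hτ₀ n) (fun τ hτ => by
        have hsub' := (Icc_subset_Icc_right hτ.2).trans (hτ₀ n)
        refine (hc.momentumBalance_iff hab hjd hL (contMDiff_pairedPotential hγ hg) h.1 hz (hsl _)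
          hτ.1 hsub').1 ?_
        exact h.momentumBalance hab hLS (fun i => (hγ i).comp hj2) (hg.comp hj2) hw
          (hsl _).mem_left (hsub' (left_mem_Icc.2 hτ.1)).1.1 hτ.1
          (hsub' (right_mem_Icc.2 hτ.1)).1.2 hsub') ℓ₀) r
  rw [hT0, hTr] at hℓ
  have := FiniteDimensional.complete ℝ E
  have h1 : IsAugmentedCritical L γ g w a b q₁ q₂ z ℓ :=
    isAugmentedCritical_of_momentumBalance hab hL hγ hg hw hℓ hz hkin hleg hcon hT hT0 hTr
      fun n hn => ⟨_, (hsl (y (τ₀ n)).proj).mem_right,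
        fun τ hτ => (hc.mem_chartTimes (hsl _) (hτ₀ n hτ)).2, hbal n hn⟩
  exact ⟨_, hℓ.fun_neg, h1.constrainedHPEquations hab hL hγ hg hw
    (hz.left ▸ hcon a (left_mem_Icc.2 hab.le))⟩

end Existence

/-! ### Lifting and restricting paths -/

section Lift

open scoped ContDiff

variable {E : Type*} [NormedAddCommGroup E] [NormedSpace ℝ E]
  {M : Type*} [TopologicalSpace M] [ChartedSpace E M]
  {E' : Type*} [NormedAddCommGroup E'] [NormedSpace ℝ E']
  {S : Type*} [TopologicalSpace S] [ChartedSpace E' S]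
  {j : S → M} {L : TangentBundle 𝓘(ℝ, E) M → ℝ}
  {a b : ℝ} {y : ℝ → PontryaginBundle E' S} {z : ℝ → PontryaginBundle E M}
  {x₁ x₂ : S} {q₁ q₂ : M} {e : OpenPartialHomeomorph M E} {t : ℝ}

/-- A continuous curve in an immersed submanifold is `C¹` if it is `C¹` in the ambient manifold. -/
theorem contMDiffOn_of_comp_immersion (hj : IsImmersion 𝓘(ℝ, E') 𝓘(ℝ, E) ∞ j) {q : ℝ → S}
    {T : Set ℝ} (hq : ContinuousOn q T)
    (hjq : ContMDiffOn 𝓘(ℝ, ℝ) 𝓘(ℝ, E) 1 (fun t => j (q t)) T) :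
    ContMDiffOn 𝓘(ℝ, ℝ) 𝓘(ℝ, E') 1 q T := by
  intro t ht
  obtain ⟨φ, ψ, A, hm, h⟩ := exists_isSliceChart (E := E) (E' := E') hj (q t)
  obtain ⟨P, hP⟩ := h.exists_retraction
  have h1 : ∀ x ∈ φ.source, φ.symm (P (ψ (j x))) = x := fun x hx => by
    rw [h.eq x hx, hP, φ.left_inv hx]
  have h2 : ContMDiffAt 𝓘(ℝ, E) 𝓘(ℝ, E) 1 ψ (j (q t)) :=
    (contMDiffAt_of_mem_maximalAtlas h.mem_right (h.map_source _ hm)).of_le (by simp)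
  have h3 : ContMDiffAt 𝓘(ℝ, E') 𝓘(ℝ, E') 1 φ.symm (P (ψ (j (q t)))) := by
    rw [h.eq _ hm, hP]
    exact (contMDiffAt_symm_of_mem_maximalAtlas h.mem_left (φ.map_source hm)).of_le (by simp)
  have h4 := (h3.comp (j (q t)) (P.contMDiff.contMDiffAt.comp _ h2)).comp_contMDiffWithinAt t
    (hjq t ht)
  refine h4.congr_of_eventuallyEq ?_ (h1 _ hm).symm
  filter_upwards [hq t ht (φ.open_source.mem_nhds hm)] with r hr using (h1 _ hr).symm

variable [IsManifold 𝓘(ℝ, E) ∞ M]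

/-- A curve in the Pontryagin bundle is continuous if its coordinates in a chart are. -/
theorem continuousWithinAt_of_pontryaginCoord (he : e ∈ IsManifold.maximalAtlas 𝓘(ℝ, E) ∞ M)
    (ht : t ∈ Icc a b) {T : Set ℝ} (hT : T ∈ 𝓝[Icc a b] t) (hTe : T ⊆ chartTimes a b z e)
    (hz : ContinuousOn (fun t => pontryaginCoord e (z t)) T) :
    ContinuousWithinAt z (Icc a b) t := by
  have h1 : ContinuousOn (fun t => pontryaginOfCoord e (pontryaginCoord e (z t))) T :=
    (contMDiffOn_pontryaginOfCoord he).continuousOn.comp hz fun r hr => e.map_source (hTe hr).2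
  have h2 : ContinuousOn z T :=
    h1.congr fun r hr => (pontryaginOfCoord_pontryaginCoord he (hTe hr).2).symm
  exact (h2 t (mem_of_mem_nhdsWithin ht hT)).mono_of_mem_nhdsWithin hT

theorem differentiableAt_fiber (hL : ContMDiff 𝓘(ℝ, E).tangent 𝓘(ℝ, ℝ) 1 L) (q : M) (v : E) :
    DifferentiableAt ℝ (fun u : E => L ⟨q, u⟩) v := by
  have he : chartAt E q ∈ IsManifold.maximalAtlas 𝓘(ℝ, E) ∞ M :=
    IsManifold.chart_mem_maximalAtlas q
  have hq := mem_chart_source E q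
  have h1 : (fun u : E => L ⟨q, u⟩) = (fun c : E × E => localLagrangian L (chartAt E q) c.1 c.2) ∘
      (fun u => (chartAt E q q, chartDiff (chartAt E q) q u)) := by
    funext u
    exact congrArg L (tangentOfCoord_tangentCoord he (z := ⟨q, u⟩) hq).symm
  rw [h1]
  exact DifferentiableAt.comp v (((contDiffOn_localLagrangian he hL).contDiffAt
    (((chartAt E q).open_target.preimage continuous_fst).mem_nhds
      ((chartAt E q).map_source hq))).differentiableAt one_ne_zero) (by fun_prop)

/-- The fiber derivative of the restricted Lagrangian is the pullback of the fiber derivative. -/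
theorem fiberDeriv_comp_tangentMap (hL : ContMDiff 𝓘(ℝ, E).tangent 𝓘(ℝ, ℝ) 1 L) (x : S) (v : E') :
    (fiberDeriv (fun v => L (tangentMap 𝓘(ℝ, E') 𝓘(ℝ, E) j v)) x v : E' →L[ℝ] ℝ) =
      (fiberDeriv L (j x) (modelDiff j E E' x v) : E →L[ℝ] ℝ).comp (modelDiff j E E' x) :=
  HasFDerivAt.fderiv ((differentiableAt_fiber hL (j x) (modelDiff j E E' x v)).hasFDerivAt.comp
    v (modelDiff j E E' x).hasFDerivAt)

variable [IsManifold 𝓘(ℝ, E') ∞ S]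

variable (j L y) in
/-- The path over `y` with velocity `Tj v` and with the momentum `∂L/∂v` given by the Legendre
transformation. -/
noncomputable def liftPath (t : ℝ) : PontryaginBundle E M :=
  ⟨j (y t).proj, ((modelDiff j E E' (y t).proj (y t).2.1 : E),
    (fiberDeriv L (j (y t).proj) (modelDiff j E E' (y t).proj (y t).2.1) : E →L[ℝ] ℝ))⟩

theorem corresponds_liftPath (hL : ContMDiff 𝓘(ℝ, E).tangent 𝓘(ℝ, ℝ) 1 L)
    (hleg : ∀ t ∈ Icc a b, (y t).2.2 =
      fiberDeriv (fun v => L (tangentMap 𝓘(ℝ, E') 𝓘(ℝ, E) j v)) (y t).proj (y t).2.1) :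
    Corresponds j a b y (liftPath j L y) := fun t ht =>
  ⟨_, rfl, (hleg t ht).trans (fiberDeriv_comp_tangentMap hL _ _)⟩

/-- The lift is a path: `L` being `C¹`, the momentum `∂L/∂v` is continuous. -/
theorem isPath_liftPath (hL : ContMDiff 𝓘(ℝ, E).tangent 𝓘(ℝ, ℝ) 1 L)
    (hj : IsImmersion 𝓘(ℝ, E') 𝓘(ℝ, E) ∞ j) (hy : IsPath a b x₁ x₂ y)
    (hc : Corresponds j a b y (liftPath j L y)) :
    IsPath a b (j x₁) (j x₂) (liftPath j L y) := by
  have hj' : ContMDiff 𝓘(ℝ, E') 𝓘(ℝ, E) ∞ j := hj.contMDiff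
  have hjd : MDifferentiable 𝓘(ℝ, E') 𝓘(ℝ, E) j := hj'.mdifferentiable (by simp)
  refine ⟨fun t ht => ?_, (hj'.of_le (by simp)).comp_contMDiffOn hy.contMDiffOn,
    congrArg j hy.left, congrArg j hy.right⟩
  obtain ⟨φ, ψ, A, hm, h⟩ := exists_isSliceChart (E := E) (E' := E') hj (y t).proj
  have hT : chartTimes a b y φ ∈ 𝓝[Icc a b] t := inter_mem self_mem_nhdsWithin
    (hy.contMDiffOn.continuousOn t ht (φ.open_source.mem_nhds hm))
  have hsub : chartTimes a b y φ ⊆ chartTimes a b (liftPath j L y) ψ :=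
    fun r hr => hc.mem_chartTimes h hr
  have c1 : ContinuousOn (localPos ψ (liftPath j L y)) (chartTimes a b y φ) :=
    (A.continuous.comp_continuousOn (hy.continuousOn_localPos h.mem_left)).congr
      fun r hr => hc.localPos_eq h hr
  have c2 : ContinuousOn (localVel ψ (liftPath j L y)) (chartTimes a b y φ) :=
    (A.continuous.comp_continuousOn (hy.continuousOn_localVel h.mem_left)).congr
      fun r hr => hc.localVel_eq hjd h hr
  have c3 : ContinuousOn (localMom ψ (liftPath j L y)) (chartTimes a b y φ) :=
    (continuousOn_fderiv_localLagrangian_right h.mem_right hL c1 c2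
      fun r hr => ψ.map_source (hsub hr).2).congr
      fun r hr => (localMom_eq_fderiv_iff h.mem_right hL (hsub hr).2).2 rfl
  exact continuousWithinAt_of_pontryaginCoord h.mem_right ht hT hsub (c1.prodMk (c2.prodMk c3))

theorem Corresponds.kinematic_right (hab : a < b) (hj : IsImmersion 𝓘(ℝ, E') 𝓘(ℝ, E) ∞ j)
    (hc : Corresponds j a b y z) (hy : IsPath a b x₁ x₂ y) (hz : IsPath a b q₁ q₂ z)
    (ht : t ∈ Icc a b) (hkin : velocity a b (fun r => (y r).proj) t = (y t).2.1) :
    velocity a b (fun r => (z r).proj) t = (z t).2.1 := by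
  have hj' : ContMDiff 𝓘(ℝ, E') 𝓘(ℝ, E) ∞ j := hj.contMDiff
  have hjd : MDifferentiable 𝓘(ℝ, E') 𝓘(ℝ, E) j := hj'.mdifferentiable (by simp)
  obtain ⟨φ, ψ, A, hm, h⟩ := exists_isSliceChart (E := E) (E' := E') hj (y t).proj
  have h0 : t ∈ chartTimes a b y φ := ⟨ht, hm⟩
  refine (localVelocity_eq_localVel_iff h.mem_right (hc.mem_chartTimes h h0).2).1 ?_
  rw [hc.localVelocity_eq hab hy hz h h0, hc.localVel_eq hjd h h0,
    (localVelocity_eq_localVel_iff h.mem_left hm).2 hkin]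

/-- A curve in the Pontryagin bundle of a submanifold over which a path lies is continuous if its
base curve is. -/
theorem Corresponds.continuousOn_left (hj : IsImmersion 𝓘(ℝ, E') 𝓘(ℝ, E) ∞ j)
    (hc : Corresponds j a b y z) (hz : IsPath a b q₁ q₂ z)
    (hy : ContinuousOn (fun t => (y t).proj) (Icc a b)) : ContinuousOn y (Icc a b) := by
  have hj' : ContMDiff 𝓘(ℝ, E') 𝓘(ℝ, E) ∞ j := hj.contMDiff
  have hjd : MDifferentiable 𝓘(ℝ, E') 𝓘(ℝ, E) j := hj'.mdifferentiable (by simp)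
  intro t ht
  obtain ⟨φ, ψ, A, hm, h⟩ := exists_isSliceChart (E := E) (E' := E') hj (y t).proj
  obtain ⟨P, hP⟩ := h.exists_retraction
  have hT : chartTimes a b y φ ∈ 𝓝[Icc a b] t := inter_mem self_mem_nhdsWithin
    (hy t ht (φ.open_source.mem_nhds hm))
  have hsub : chartTimes a b y φ ⊆ chartTimes a b z ψ := fun r hr => hc.mem_chartTimes h hr
  have c1 : ContinuousOn (localPos φ y) (chartTimes a b y φ) :=
    (P.continuous.comp_continuousOn ((hz.continuousOn_localPos h.mem_right).mono hsub)).congr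
      fun r hr => by simp only [Function.comp_apply, hc.localPos_eq h hr, hP]
  have c2 : ContinuousOn (localVel φ y) (chartTimes a b y φ) :=
    (P.continuous.comp_continuousOn ((hz.continuousOn_localVel h.mem_right).mono hsub)).congr
      fun r hr => by simp only [Function.comp_apply, hc.localVel_eq hjd h hr, hP]
  have c3 : ContinuousOn (localMom φ y) (chartTimes a b y φ) :=
    (((hz.continuousOn_localMom h.mem_right).mono hsub).clm_comp
      (continuousOn_const (c := A))).congr
      fun r hr => ContinuousLinearMap.ext fun ζ => hc.localMom_apply hjd h hr ζ
  exact continuousWithinAt_of_pontryaginCoord h.mem_left ht hT subset_rfl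
    (c1.prodMk (c2.prodMk c3))

/-- A path whose base curve lies in an embedded submanifold and whose velocity component is the
velocity of the base curve lies over a path in the submanifold. -/
theorem IsPath.exists_corresponds (hab : a < b) (hj : IsImmersion 𝓘(ℝ, E') 𝓘(ℝ, E) ∞ j)
    (hje : IsEmbedding j) (hz : IsPath a b (j x₁) (j x₂) z)
    (hkin : ∀ t ∈ Icc a b, velocity a b (fun r => (z r).proj) t = (z t).2.1)
    {q : ℝ → S} (hq : ∀ t ∈ Icc a b, j (q t) = (z t).proj) :
    ∃ y : ℝ → PontryaginBundle E' S, IsPath a b x₁ x₂ y ∧ Corresponds j a b y z := by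
  have hj' : ContMDiff 𝓘(ℝ, E') 𝓘(ℝ, E) ∞ j := hj.contMDiff
  have hjd : MDifferentiable 𝓘(ℝ, E') 𝓘(ℝ, E) j := hj'.mdifferentiable (by simp)
  have hjq : ContMDiffOn 𝓘(ℝ, ℝ) 𝓘(ℝ, E) 1 (fun t => j (q t)) (Icc a b) :=
    hz.contMDiffOn.congr hq
  have hqc : ContinuousOn q (Icc a b) := hje.isInducing.continuousOn_iff.2 hjq.continuousOn
  have hqd := contMDiffOn_of_comp_immersion (E := E) hj hqc hjq
  have hv : ∀ t ∈ Icc a b,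
      modelDiff j E E' (q t) (velocity (E := E') a b q t) = ((z t).2.1 : E) := by
    intro t ht
    have h1 : HasMFDerivWithinAt 𝓘(ℝ, ℝ) 𝓘(ℝ, E) (fun r => j (q r)) (Icc a b) t
        ((modelDiff j E E' (q t)).comp (mfderivWithin 𝓘(ℝ, ℝ) 𝓘(ℝ, E') q (Icc a b) t : ℝ →L[ℝ] E') :
          ℝ →L[ℝ] E) :=
      (hjd (q t)).hasMFDerivAt.comp_hasMFDerivWithinAt t
        ((hqd t ht).mdifferentiableWithinAt one_ne_zero).hasMFDerivWithinAt
    have h2 : HasMFDerivWithinAt 𝓘(ℝ, ℝ) 𝓘(ℝ, E) (fun r => (z r).proj) (Icc a b) t _ :=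
      h1.congr_of_eventuallyEq (eventually_nhdsWithin_of_forall fun r hr => (hq r hr).symm)
        (hq t ht).symm
    have h3 := h2.mfderivWithin ((uniqueDiffOn_Icc hab).uniqueMDiffOn t ht)
    exact (DFunLike.congr_fun h3 (1 : ℝ)).symm.trans (hkin t ht)
  let y : ℝ → PontryaginBundle E' S := fun t => ⟨q t, ((velocity (E := E') a b q t : E'),
    (((z t).2.2 : E →L[ℝ] ℝ).comp (modelDiff j E E' (q t)) : E' →L[ℝ] ℝ))⟩
  have hc : Corresponds j a b y z := fun t ht => by
    refine ⟨(z t).2.2, TotalSpace.ext (hq t ht).symm (heq_of_eq ?_), rfl⟩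
    exact Prod.ext (hv t ht).symm rfl
  refine ⟨y, ⟨hc.continuousOn_left hj hz hqc, hqd, hje.injective ?_, hje.injective ?_⟩, hc⟩
  · exact (hq a (left_mem_Icc.2 hab.le)).trans hz.left
  · exact (hq b (right_mem_Icc.2 hab.le)).trans hz.right

end Lift

end StochasticHP

theorem mainTheorem2
    {Ω : Type*} {mΩ : MeasurableSpace Ω} (P : Measure Ω) [IsProbabilityMeasure P]
    (a b : ℝ) (hab : a < b) (ℱ : Filtration ℝ mΩ)
    (m : ℕ) (W : Fin m → ℝ → Ω → ℝ) (hW : IsWienerFamily P ℱ a b W)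
    (n k : ℕ) (hkn : k < n)
    {Q : Type*} [TopologicalSpace Q] [T2Space Q] [ParacompactSpace Q]
    [ChartedSpace (EuclideanSpace ℝ (Fin n)) Q]
    [IsManifold 𝓘(ℝ, EuclideanSpace ℝ (Fin n)) (⊤ : ℕ∞) Q]
    (L : TangentBundle 𝓘(ℝ, EuclideanSpace ℝ (Fin n)) Q → ℝ)
    (hL : ContMDiff 𝓘(ℝ, EuclideanSpace ℝ (Fin n)).tangent 𝓘(ℝ, ℝ) 2 L)
    (hL_inv : HasInvertibleFiberHessian L)
    (γ : Fin m → Q → ℝ)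
    (hγ : ∀ i, ContMDiff 𝓘(ℝ, EuclideanSpace ℝ (Fin n)) 𝓘(ℝ, ℝ) 2 (γ i))
    (g : Q → EuclideanSpace ℝ (Fin k))
    (hg : ContMDiff 𝓘(ℝ, EuclideanSpace ℝ (Fin n)) 𝓘(ℝ, EuclideanSpace ℝ (Fin k)) (⊤ : ℕ∞) g)
    (hg_reg : ∀ x, g x = 0 → Function.Surjective
      (mfderiv 𝓘(ℝ, EuclideanSpace ℝ (Fin n)) 𝓘(ℝ, EuclideanSpace ℝ (Fin k)) g x))
    [ChartedSpace (EuclideanSpace ℝ (Fin (n - k))) {x : Q // g x = 0}]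
    [IsManifold 𝓘(ℝ, EuclideanSpace ℝ (Fin (n - k))) (⊤ : ℕ∞) {x : Q // g x = 0}]
    (hS : IsSmoothEmbedding 𝓘(ℝ, EuclideanSpace ℝ (Fin (n - k))) 𝓘(ℝ, EuclideanSpace ℝ (Fin n))
      (⊤ : ℕ∞) (Subtype.val : {x : Q // g x = 0} → Q))
    (q₁ q₂ : {x : Q // g x = 0}) :
    ∀ᵐ ω ∂P,
      (∀ y : ℝ → PontryaginBundle (EuclideanSpace ℝ (Fin (n - k))) {x : Q // g x = 0},
        IsPath a b q₁ q₂ y →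
        List.TFAE [
          IsCriticalPath
            (fun x => L (tangentMap 𝓘(ℝ, EuclideanSpace ℝ (Fin (n - k)))
              𝓘(ℝ, EuclideanSpace ℝ (Fin n)) Subtype.val x))
            (fun i x => γ i x.val) (fun i t => W i t ω) a b q₁ q₂ y,
          ∃ (z : ℝ → PontryaginBundle (EuclideanSpace ℝ (Fin n)) Q)
            (ℓ : ℝ → EuclideanSpace ℝ (Fin k)),
            Corresponds Subtype.val a b y z ∧
            IsAugmentedCritical L γ g (fun i t => W i t ω) a b q₁.val q₂.val z ℓ,
          ∃ (z : ℝ → PontryaginBundle (EuclideanSpace ℝ (Fin n)) Q)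
            (ℓ : ℝ → EuclideanSpace ℝ (Fin k)),
            Corresponds Subtype.val a b y z ∧
            IsPath a b q₁.val q₂.val z ∧ ContinuousOn ℓ (Icc a b) ∧
            ConstrainedHPEquations L γ g (fun i t => W i t ω) a b z ℓ]) ∧
      (∀ z : ℝ → PontryaginBundle (EuclideanSpace ℝ (Fin n)) Q,
        IsPath a b q₁.val q₂.val z →
        ((∃ ℓ, IsAugmentedCritical L γ g (fun i t => W i t ω) a b q₁.val q₂.val z ℓ) ↔
          ∃ ℓ, ContinuousOn ℓ (Icc a b) ∧
            ConstrainedHPEquations L γ g (fun i t => W i t ω) a b z ℓ) ∧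
        ((∃ ℓ, ContinuousOn ℓ (Icc a b) ∧
            ConstrainedHPEquations L γ g (fun i t => W i t ω) a b z ℓ) →
          ∃ y : ℝ → PontryaginBundle (EuclideanSpace ℝ (Fin (n - k))) {x : Q // g x = 0},
            IsPath a b q₁ q₂ y ∧ Corresponds Subtype.val a b y z)) := by
  have hL1 := hL.of_le (one_le_two (α := WithTop ℕ∞))
  have hg2 : ContMDiff 𝓘(ℝ, EuclideanSpace ℝ (Fin n)) 𝓘(ℝ, EuclideanSpace ℝ (Fin k)) 2 g :=
    hg.of_le ENat.LEInfty.out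
  have hj := hS.isImmersion
  have hdim : Module.finrank ℝ (EuclideanSpace ℝ (Fin n)) =
      Module.finrank ℝ (EuclideanSpace ℝ (Fin (n - k))) + k := by
    rw [finrank_euclideanSpace_fin, finrank_euclideanSpace_fin]
    omega
  filter_upwards [hW.continuous_paths] with ω hω
  have haug : ∀ (z : ℝ → PontryaginBundle (EuclideanSpace ℝ (Fin n)) Q) ℓ,
      IsAugmentedCritical L γ g (fun i t => W i t ω) a b q₁.val q₂.val z ℓ ↔
        IsPath a b q₁.val q₂.val z ∧ ContinuousOn ℓ (Icc a b) ∧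
          ConstrainedHPEquations L γ g (fun i t => W i t ω) a b z (fun t => -ℓ t) := fun z ℓ =>
    isAugmentedCritical_iff hab hL1 hγ hg2 hω q₁.2
  -- The multiplier of the action is minus the multiplier of the equations.
  have haug' : ∀ (z : ℝ → PontryaginBundle (EuclideanSpace ℝ (Fin n)) Q) ℓ,
      IsPath a b q₁.val q₂.val z → ContinuousOn ℓ (Icc a b) →
      ConstrainedHPEquations L γ g (fun i t => W i t ω) a b z ℓ →
      IsAugmentedCritical L γ g (fun i t => W i t ω) a b q₁.val q₂.val z (fun t => -ℓ t) :=
    fun z ℓ hz hℓ h => (haug z _).2 ⟨hz, hℓ.fun_neg, by simpa only [neg_neg] using h⟩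
  refine ⟨fun y hy => ?_, fun z hz => ⟨⟨?_, ?_⟩, ?_⟩⟩
  · -- On the submanifold the constraint holds identically, so the action is an augmented action.
    tfae_have 1 → 3 := fun h => by
      have h1 := (isCriticalPath_iff_isAugmentedCritical
        (g := fun x : {x : Q // g x = 0} => g x.val) (ℓ := 0) (fun x => x.2)
        continuousOn_const).1 h
      have hj' := hj.contMDiff
      have h2 := h1.constrainedHPEquations hab
        (contMDiff_comp_tangentMap one_add_one_le_infty hj' hL1)
        (fun i => (hγ i).comp (hj'.of_le ENat.LEInfty.out))
        (hg2.comp (hj'.of_le ENat.LEInfty.out)) hω q₁.2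
      have hc := corresponds_liftPath (j := Subtype.val) hL1 h2.legendre
      have hz := isPath_liftPath hL1 hj hy hc
      obtain ⟨ℓ, hℓ, h3⟩ := hc.exists_constrainedHPEquations hab hL1 hγ hg2 hg_reg hdim hj
        (fun x => x.2) hω hz
        (fun t ht => hc.kinematic_right hab hj hy hz ht (h2.kinematic t ht)) (fun t _ => rfl) h1
      exact ⟨_, ℓ, hc, hz, hℓ, h3⟩
    tfae_have 3 → 2 := by
      rintro ⟨z, ℓ, hc, hz, hℓ, h⟩
      exact ⟨z, _, hc, haug' z ℓ hz hℓ h⟩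
    tfae_have 2 → 1 := by
      rintro ⟨z, ℓ, hc, h⟩
      obtain ⟨hz, hℓ, h⟩ := (haug z ℓ).1 h
      exact (isCriticalPath_iff_isAugmentedCritical
        (g := fun x : {x : Q // g x = 0} => g x.val) (fun x => x.2) hℓ).2
        (h.isAugmentedCritical_of_corresponds hab hL1 hγ hg2 hω hℓ hj (fun x => x.2) hy hz hc)
    tfae_finish
  · rintro ⟨ℓ, h⟩
    obtain ⟨-, hℓ, h⟩ := (haug z ℓ).1 h
    exact ⟨_, hℓ.fun_neg, h⟩
  · rintro ⟨ℓ, hℓ, h⟩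
    exact ⟨_, haug' z ℓ hz hℓ h⟩
  · rintro ⟨ℓ, -, h⟩
    classical
    -- Off `[a, b]` the base curve need not lie in the submanifold; its value there is irrelevant.
    refine hz.exists_corresponds hab hj hS.isEmbedding h.kinematic
      (q := fun t => if h : g (z t).proj = 0 then ⟨(z t).proj, h⟩ else q₁) fun t ht => ?_
    simp only [h.constraint t ht, dif_pos]
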